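/- **Asymptotic Bernstein–von Mises theorem for GLMs.** For every integer $n\ge1$ let $d_n,k_n$ be dimensions with $d_n\ge1$, let $X_{1,n},\dots,X_{n,n}\in\mathbb R^{d_n\times k_n}$ be (deterministic) matrices, and let $\mu_n$ be a base measure on $\mathbb R^{k_n}$. Put $$\Omega_n=\Big\{\omega\in\mathbb R^{k_n}:\int e^{\omega^\top y}\,d\mu_n(y)<\infty\Big\},\qquad \psi_n(\omega)=\log\int e^{\omega^\top y}\,d\mu_n(y),\qquad p_n(y\mid\omega)=e^{\omega^\top y-\psi_n(\omega)},$$ and assume that the exponential family is regular ($\Omega_n$ is open) and minimal ($\mu_n$ is not concentrated on an affine hyperplane of $\mathbb R^{k_n}$). Let $\Theta_n=\{\theta\in\mathbb R^{d_n}: X_{i,n}^\top\theta\in\Omega_n,\ i=1,\dots,n\}$, let $\theta_n^*\in\Theta_n$ be the ground truth, and let $Y_1,\dots,Y_n$ be independent with $Y_i\sim p_n(\cdot\mid X_{i,n}^\top\theta^*_n)\,d\mu_n$. Let $\varpi_n$ be a (possibly improper) measurable prior density which is strictly positive on $\Theta_n$. Define the normalized negative log likelihood $\ell_n(\theta)=-\frac1n\log\prod_{i=1}^np_n(Y_i\mid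 X_{i,n}^\top\theta)$, the posterior density $\pi_{v_n}(\theta)\propto e^{-n\ell_n(\theta)}\varpi_n(\theta)$ on $\Theta_n$ (zero outside $\Theta_n$), the maximum likelihood estimator $\hat\theta_n=\arg\min_{\Theta_n}\ell_n$, the Fisher information matrix $$F_n^*=\frac1n\sum_{i=1}^nX_{i,n}\nabla^2\psi_n(X_{i,n}^\top\theta_n^*)X_{i,n}^\top,$$ and $\gamma_n^*=\mathcal N(\hat\theta_n,(nF_n^*)^{-1})$. Write $|u|_{F}=(u^\top Fu)^{1/2}$ and $\|g\|_F=\sup_{|u|_F=1}g^\top u$, and for $s\ge0$ let $$\mathcal U_n^*(s)=\{\theta\in\mathbb R^{d_n}:|\theta-\theta_n^*|_{F_n^*}\le s\sqrt{d_n/n}\},\qquad \delta^*_{01n}(s)=\sup_{\theta\in\mathcal U_n^*(s)}\|\nabla\log\varpi_n(\theta)\|_{F_n^*},\qquad M_{0n}^*=\frac1{d_n}\log\sup_{\theta\in\Theta_n}\frac{\varpi_n(\theta)}{\varpi_n(\theta_n^*)},$$ with $\delta^*_{01n}(s)=\infty$ if $\varpi_n$ is not $C^1$ (at every point) or not strictly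 positive on $\mathcal U_n^*(s)$, and $$\delta^*_{3n}(s)=\sup_{\theta\in\mathcal U_n^*(s),\,u\ne0}\frac{\frac1n\sum_{i=1}^n\langle\nabla^3\psi_n(X_{i,n}^\top\theta),(X_{i,n}^\top u)^{\otimes3}\rangle}{\Big(\frac1n\sum_{i=1}^n\langle\nabla^2\psi_n(X_{i,n}^\top\theta_n^*),(X_{i,n}^\top u)^{\otimes2}\rangle\Big)^{3/2}}.$$ Suppose that for each $n$ the columns of $X_{1,n},\dots,X_{n,n}$ span $\mathbb R^{d_n}$, that $M^*_{0n}=O(1)$ as $n\to\infty$, and that for each fixed $s\ge0$: (1) $\mathcal U_n^*(s)\subset\Theta_n$ for all large enough $n$; (2) $\delta^*_{01n}(s)=o(\sqrt n)$; (3) $\delta^*_{3n}(s)\,d_n/\sqrt n=o(1)$. Then $\mathrm{TV}(\pi_{v_n},\gamma_n^*)\to0$ with probability tending to $1$. That is, for every $\varepsilon>0$ there are events $A_n$ in the space of $(Y_1,\dots,Y_n)$, whose probability tends to $1$ as $n\to\infty$, such that on $A_n$ the MLE $\hat\theta_n$ exists and is unique, the posterior $\pi_{v_n}$ is a well-defined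 probability measure, and $\mathrm{TV}(\pi_{v_n},\gamma_n^*)\le\varepsilon$, where $\mathrm{TV}(P,Q)=\sup_A|P(A)-Q(A)|$ over Borel sets $A$. -/

import Mathlib

open MeasureTheory ProbabilityTheory Filter Topology
open scoped ENNReal Matrix

noncomputable section

/-- Total variation distance `sup_A |μ(A) - ν(A)|` over measurable sets `A`
(a supremum of numbers in `[0, 1]` for probability measures). -/
def tvDist {α : Type*} [MeasurableSpace α] (μ ν : Measure α) : ℝ :=
  ⨆ A : {A : Set α // MeasurableSet A}, |μ.real A - ν.real A|

/-- Hessian matrix `∇² f(x)`. -/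
def hessian {k : ℕ} (f : EuclideanSpace ℝ (Fin k) → ℝ) (x : EuclideanSpace ℝ (Fin k)) :
    Matrix (Fin k) (Fin k) ℝ :=
  Matrix.of fun a b =>
    iteratedFDeriv ℝ 2 f x ![EuclideanSpace.single a 1, EuclideanSpace.single b 1]

/-- `|u|_A = |A^{1/2} u| = (uᵀ A u)^{1/2}` for a positive definite matrix `A`. -/
def wnorm {d : ℕ} (A : Matrix (Fin d) (Fin d) ℝ) (u : EuclideanSpace ℝ (Fin d)) : ℝ :=
  √(u.ofLp ⬝ᵥ A *ᵥ u.ofLp)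

/-- `‖g‖_A = sup_{|u|_A = 1} ⟨g, u⟩` for a vector `g`. The supremum runs over a symmetric set,
so replacing negative values of `⟨g, u⟩` by zero does not change it. -/
def dualNorm {d : ℕ} (A : Matrix (Fin d) (Fin d) ℝ) (g : EuclideanSpace ℝ (Fin d)) : ℝ≥0∞ :=
  ⨆ (u : EuclideanSpace ℝ (Fin d)) (_ : wnorm A u = 1), ENNReal.ofReal (inner ℝ g u)

namespace ExpFam

variable {k : ℕ} (μ : Measure (EuclideanSpace ℝ (Fin k)))

/-- The full natural parameter domain `Ω = {ω | ∫ exp(ωᵀ y) dμ(y) < ∞}`. -/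
def Omega : Set (EuclideanSpace ℝ (Fin k)) :=
  {ω | Integrable (fun y => Real.exp (inner ℝ ω y)) μ}

/-- `ψ(ω) = log ∫ exp(ωᵀ y) dμ(y)`. -/
def psi (ω : EuclideanSpace ℝ (Fin k)) : ℝ :=
  Real.log (∫ y, Real.exp (inner ℝ ω y) ∂μ)

/-- The density `p(y | ω) = exp(ωᵀ y - ψ(ω))` with respect to `μ`. -/
def density (ω y : EuclideanSpace ℝ (Fin k)) : ℝ :=
  Real.exp (inner ℝ ω y - psi μ ω)

/-- The family is regular: its natural parameter domain is open. -/
def IsRegular : Prop := IsOpen (Omega μ)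

/-- The family is minimal: `μ` is not carried by an affine hyperplane of `ℝᵏ`. (For a regular
family with non-empty `Ω`, the parameters `ω` satisfy no affine relation either.) -/
def IsMinimal : Prop :=
  ∀ u : EuclideanSpace ℝ (Fin k), u ≠ 0 → ∀ c : ℝ, ¬ ∀ᵐ y ∂μ, inner ℝ u y = c

end ExpFam

/-- The data of a Bayesian generalized linear model with `n` observations, parameter in `ℝᵈ` and
labels in `ℝᵏ`: design matrices `X₁, …, Xₙ`, base measure, ground truth parameter, and
prior density (of which only the values on the parameter domain matter). -/
structure GLM (n d k : ℕ) where
  X : Fin n → Matrix (Fin d) (Fin k) ℝ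
  base : Measure (EuclideanSpace ℝ (Fin k))
  truth : EuclideanSpace ℝ (Fin d)
  prior : EuclideanSpace ℝ (Fin d) → ℝ

namespace GLM

variable {n d k : ℕ} (M : GLM n d k)

/-- The linear predictor `X_iᵀ θ`. -/
def pred (i : Fin n) (θ : EuclideanSpace ℝ (Fin d)) : EuclideanSpace ℝ (Fin k) :=
  Matrix.toEuclideanLin (M.X i)ᵀ θ

/-- `Θ = {θ | X_iᵀ θ ∈ Ω for all i}`. -/
def Theta : Set (EuclideanSpace ℝ (Fin d)) :=
  {θ | ∀ i, M.pred i θ ∈ ExpFam.Omega M.base}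

/-- The law of `(Y₁, …, Yₙ)` under `θ`: independent, with `Y_i ∼ p(· | X_iᵀ θ) dμ`. -/
def law (θ : EuclideanSpace ℝ (Fin d)) : Measure (Fin n → EuclideanSpace ℝ (Fin k)) :=
  Measure.pi fun i =>
    M.base.withDensity fun y => ENNReal.ofReal (ExpFam.density M.base (M.pred i θ) y)

/-- The normalized negative log likelihood `ℓ(θ) = -(1/n) log ∏ᵢ p(Y_i | X_iᵀ θ)`. -/
def nll (Y : Fin n → EuclideanSpace ℝ (Fin k)) (θ : EuclideanSpace ℝ (Fin d)) : ℝ :=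
  -(n : ℝ)⁻¹ * Real.log (∏ i, ExpFam.density M.base (M.pred i θ) (Y i))

/-- `θhat` is the unique maximum likelihood estimator over `Θ`. -/
def IsUniqueMLE (Y : Fin n → EuclideanSpace ℝ (Fin k)) (θhat : EuclideanSpace ℝ (Fin d)) : Prop :=
  θhat ∈ M.Theta ∧ ∀ θ ∈ M.Theta, θ ≠ θhat → M.nll Y θhat < M.nll Y θ

/-- The unnormalized posterior: density `exp(-n ℓ(θ)) prior(θ)` on `Θ`. -/
def unnormPosterior (Y : Fin n → EuclideanSpace ℝ (Fin k)) :
    Measure (EuclideanSpace ℝ (Fin d)) :=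
  (volume.restrict M.Theta).withDensity fun θ =>
    ENNReal.ofReal (Real.exp (-(n : ℝ) * M.nll Y θ) * M.prior θ)

/-- The posterior `π_v`. It is a probability measure exactly when the
total mass of `unnormPosterior` is neither zero nor infinite. -/
def posterior (Y : Fin n → EuclideanSpace ℝ (Fin k)) : Measure (EuclideanSpace ℝ (Fin d)) :=
  (M.unnormPosterior Y Set.univ)⁻¹ • M.unnormPosterior Y

/-- The Fisher information matrix `F* = (1/n) ∑ᵢ X_i ∇²ψ(X_iᵀ θ*) X_iᵀ`. -/
def fisher : Matrix (Fin d) (Fin d) ℝ :=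
  (n : ℝ)⁻¹ • ∑ i, M.X i * hessian (ExpFam.psi M.base) (M.pred i M.truth) * (M.X i)ᵀ

/-- `γ* = N(θhat, (n F*)⁻¹)`. -/
def bvmGaussian (θhat : EuclideanSpace ℝ (Fin d)) : Measure (EuclideanSpace ℝ (Fin d)) :=
  multivariateGaussian θhat ((n : ℝ) • M.fisher)⁻¹

/-- `U*(s) = {θ | |θ - θ*|_{F*} ≤ s √(d/n)}`. -/
def nbhd (s : ℝ) : Set (EuclideanSpace ℝ (Fin d)) :=
  {θ | wnorm M.fisher (θ - M.truth) ≤ s * √((d : ℝ) / n)}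

open Classical in
/-- `δ*₀₁(s) = sup_{θ ∈ U*(s)} ‖∇ log prior(θ)‖_{F*}`, and `∞` if the prior is not `C¹` or not
strictly positive on `U*(s)`. -/
def delta01 (s : ℝ) : ℝ≥0∞ :=
  if ∀ θ ∈ M.nbhd s, ContDiffAt ℝ 1 M.prior θ ∧ 0 < M.prior θ then
    ⨆ θ ∈ M.nbhd s, dualNorm M.fisher (gradient (fun t => Real.log (M.prior t)) θ)
  else ∞

/-- `M₀* = d⁻¹ log sup_{θ ∈ Θ} prior(θ) / prior(θ*)`, possibly `+∞`. -/
def M0 : EReal :=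
  ENNReal.log (⨆ θ ∈ M.Theta, ENNReal.ofReal (M.prior θ / M.prior M.truth)) / (d : EReal)

/-- `δ*₃(s)`: the supremum over `θ ∈ U*(s)` and `u ≠ 0` of
`(1/n) ∑ᵢ ⟨∇³ψ(X_iᵀ θ), (X_iᵀ u)^{⊗3}⟩` divided by
`((1/n) ∑ᵢ ⟨∇²ψ(X_iᵀ θ*), (X_iᵀ u)^{⊗2}⟩)^{3/2}`. The ratio is odd in `u`, so
replacing its negative values by zero does not change the supremum. -/
def delta3 (s : ℝ) : ℝ≥0∞ :=
  ⨆ (θ ∈ M.nbhd s) (u : EuclideanSpace ℝ (Fin d)) (_ : u ≠ 0),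
    ENNReal.ofReal
      (((n : ℝ)⁻¹ * ∑ i,
          iteratedFDeriv ℝ 3 (ExpFam.psi M.base) (M.pred i θ) (fun _ => M.pred i u)) /
        ((n : ℝ)⁻¹ * ∑ i,
          iteratedFDeriv ℝ 2 (ExpFam.psi M.base) (M.pred i M.truth)
            (fun _ => M.pred i u)) ^ (3 / 2 : ℝ))

/-- The event that the unique MLE exists, the posterior is a probability measure, and
`TV(π_v, γ*) ≤ ε`. -/
def bvmEvent (ε : ℝ) : Set (Fin n → EuclideanSpace ℝ (Fin k)) :=
  {Y | ∃ θhat, M.IsUniqueMLE Y θhat ∧ IsProbabilityMeasure (M.posterior Y) ∧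
    tvDist (M.posterior Y) (M.bvmGaussian θhat) ≤ ε}

end GLM

end

/-! Substitute θ = θ* + (nF*)^{-1/2} z (`GLM.reparam`). The ball |z| ≤ s√d lands in U*(s), the
negative log likelihood G is convex with Hessian the identity at 0, and the data enter it only
through a linear term. The third derivative is at most δ₃/√n on the diagonal, so on the ball G -
|z|²/2 has a τ-Lipschitz gradient with τ·s√d of order s²·δ₃·d/√n, which tends to 0 by hypothesis
(3). Likewise the log prior has Lipschitz constant δ₀₁/√n, which tends to 0 by (2).

The only randomness left is the score ∇G(0). It is centred with identity covariance, so E|∇G(0)|² =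
d and |∇G(0)| ≤ r√d with probability at least 1 - 1/r² (`GLM.Regular.law_score_ge`). On that event
the rest is deterministic (`exists_gaussian_approximation`).

Outside the ball: G grows quadratically up to the sphere of radius s√d, and convexity turns this
into linear growth beyond it. Hence the minimizer is unique and within 3r√d of the origin, and the
posterior mass outside the ball is a small fraction of the total once s² exceeds a multiple of M₀ +
r + 2 plus a term depending on the tolerance.

Inside the ball: the posterior has density proportional to e^f with respect to the Gaussian centred
at the MLE, where f has a small Lipschitz constant L. The oscillation of f need not be small, since
the radius grows like √d. But the Gaussian Poincaré inequality is dimension-free: it gives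
Var(e^{f/2}) ≤ 2L²·E e^f (`integral_sq_exp_half_sub_mean_le`), so e^{f/2} is nearly constant in L²,
and this bounds the total variation (`abs_div_sub_le_of_agree`).

The quantifiers are chosen in this order: r from the probability, then s from r and the accuracy,
then n large. -/

noncomputable section

/-! ### Density, second moments and rotation invariance of the standard Gaussian. -/

section Gaussian

variable {E : Type*} [NormedAddCommGroup E] [InnerProductSpace ℝ E] [FiniteDimensional ℝ E]
  [MeasurableSpace E] [BorelSpace E]

lemma integrable_exp_neg_half_sq_norm :
    Integrable (fun x : E => Real.exp (-‖x‖ ^ 2 / 2)) := by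
  have h := (GaussianFourier.integrable_cexp_neg_mul_sq_norm_add (V := E) (b := (1 / 2 : ℂ))
    (by norm_num) 0 0).re
  refine h.congr (ae_of_all _ fun x => ?_)
  have : (-(1 / 2 : ℂ) * (‖x‖ : ℂ) ^ 2 + 0 * ((inner ℝ (0 : E) x : ℝ) : ℂ)) =
      ((-‖x‖ ^ 2 / 2 : ℝ) : ℂ) := by
    push_cast; ring
  simp only [this]
  exact Complex.exp_ofReal_re _

/-- The standard Gaussian measure has a density proportional to `exp(-‖x‖² / 2)`. -/
lemma exists_stdGaussian_eq_withDensity :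
    ∃ c : ℝ, 0 < c ∧ stdGaussian E =
      volume.withDensity fun x => ENNReal.ofReal (c * Real.exp (-‖x‖ ^ 2 / 2)) := by
  set I : ℝ := ∫ x : E, Real.exp (-‖x‖ ^ 2 / 2) with hI
  have hIpos : 0 < I := integral_exp_pos integrable_exp_neg_half_sq_norm
  have hint : Integrable (fun x : E => I⁻¹ * Real.exp (-‖x‖ ^ 2 / 2)) :=
    integrable_exp_neg_half_sq_norm.const_mul _
  have hmeas : Measurable fun x : E => ENNReal.ofReal (I⁻¹ * Real.exp (-‖x‖ ^ 2 / 2)) := by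
    fun_prop
  -- The Fourier transform is computed only up to the factor `I`, which the normalization cancels;
  -- the value of `I` is never needed.
  have hform : ∀ t : E, ∫ x : E, Complex.exp (-(1 / 2 : ℂ) * ‖x‖ ^ 2 +
      Complex.I * (inner ℝ t x : ℝ)) = I * Complex.exp (-‖t‖ ^ 2 / 2) := by
    have h0 := GaussianFourier.integral_cexp_neg_mul_sq_norm_add (V := E) (b := (1 / 2 : ℂ))
      (by norm_num) 0 0
    have hI' : (I : ℂ) = ∫ x : E, Complex.exp (-(1 / 2 : ℂ) * ‖x‖ ^ 2 +
        0 * (inner ℝ (0 : E) x : ℝ)) := by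
      rw [hI, ← integral_complex_ofReal]
      congr 1 with x
      push_cast
      congr 1
      ring
    rw [← hI'] at h0
    intro t
    rw [GaussianFourier.integral_cexp_neg_mul_sq_norm_add (by norm_num), h0]
    simp only [ne_eq, OfNat.ofNat_ne_zero, not_false_eq_true, zero_pow, norm_zero,
      Complex.ofReal_zero, mul_zero, zero_div, Complex.exp_zero, mul_one, Complex.I_sq]
    congr 2
    ring
  refine ⟨I⁻¹, inv_pos.2 hIpos, ?_⟩
  have : IsFiniteMeasure (volume.withDensity fun x : E =>
      ENNReal.ofReal (I⁻¹ * Real.exp (-‖x‖ ^ 2 / 2))) :=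
    isFiniteMeasure_withDensity_ofReal hint.2
  refine Measure.ext_of_charFun ?_
  ext t
  rw [charFun_stdGaussian, charFun_apply,
    integral_withDensity_eq_integral_toReal_smul hmeas (by simp)]
  have : ∀ x : E, (ENNReal.ofReal (I⁻¹ * Real.exp (-‖x‖ ^ 2 / 2))).toReal •
      Complex.exp ((inner ℝ x t : ℝ) * Complex.I) =
      (I⁻¹ : ℂ) * Complex.exp (-(1 / 2 : ℂ) * ‖x‖ ^ 2 + Complex.I * (inner ℝ t x : ℝ)) := by
    intro x
    rw [ENNReal.toReal_ofReal (by positivity), real_inner_comm, Complex.exp_add,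
      Complex.real_smul]
    push_cast
    rw [mul_comm Complex.I, mul_assoc]
    congr 3
    ring
  simp_rw [this]
  rw [integral_const_mul, hform, ← mul_assoc, inv_mul_cancel₀, one_mul]
  exact_mod_cast hIpos.ne'

lemma stdGaussian_absolutelyContinuous : stdGaussian E ≪ (volume : Measure E) := by
  obtain ⟨c, -, h⟩ := exists_stdGaussian_eq_withDensity (E := E)
  rw [h]
  exact withDensity_absolutelyContinuous _ _

lemma integral_sq_dual_stdGaussian (ℓ : E →L[ℝ] ℝ) :
    ∫ y, (ℓ y) ^ 2 ∂(stdGaussian E) = ‖ℓ‖ ^ 2 := by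
  rw [← variance_dual_stdGaussian ℓ, variance_of_integral_eq_zero (by fun_prop)]
  exact integral_strongDual_stdGaussian ℓ

lemma integral_sq_norm_stdGaussian :
    ∫ y, ‖y‖ ^ 2 ∂(stdGaussian E) = Module.finrank ℝ E := by
  let b := stdOrthonormalBasis ℝ E
  have h : ∀ y : E, ‖y‖ ^ 2 = ∑ i, (innerSL ℝ (b i) y) ^ 2 := fun y => by
    simpa [innerSL_apply_apply ℝ] using (b.sum_sq_inner_right y).symm
  simp_rw [h]
  rw [integral_finsetSum]
  · simp_rw [integral_sq_dual_stdGaussian]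
    simp
  · intro i _
    exact (IsGaussian.memLp_dual _ (innerSL ℝ (b i)) 2 (by simp)).integrable_sq

lemma integral_rotation_stdGaussian {F : E × E → ℝ} (hF : Continuous F) (a : ℝ) :
    ∫ p, F (Real.cos a • p.1 + Real.sin a • p.2, -Real.sin a • p.1 + Real.cos a • p.2)
      ∂((stdGaussian E).prod (stdGaussian E)) = ∫ p, F p ∂((stdGaussian E).prod (stdGaussian E)) := by
  have h := IsGaussian.map_rotation_eq_self (μ := stdGaussian E) (by simp) a
  conv_rhs => rw [← h]
  rw [integral_map (by fun_prop) hF.aestronglyMeasurable]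
  rfl

end Gaussian

end

noncomputable section

/-! ### A dimension-free Gaussian Poincaré inequality by rotating independent copies. -/

section Poincare

variable {E : Type*} [NormedAddCommGroup E] [InnerProductSpace ℝ E] [FiniteDimensional ℝ E]
  [MeasurableSpace E] [BorelSpace E]

lemma integrable_sq_norm_add_norm_stdGaussian :
    Integrable (fun p : E × E => (‖p.1‖ + ‖p.2‖) ^ 2)
      ((stdGaussian E).prod (stdGaussian E)) := by
  have h2 : Integrable (fun x : E => ‖x‖ ^ 2) (stdGaussian E) :=
    (IsGaussian.memLp_two_id (μ := stdGaussian E)).norm.integrable_sq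
  have h : Integrable (fun p : E × E => 2 * (‖p.1‖ ^ 2 + ‖p.2‖ ^ 2))
      ((stdGaussian E).prod (stdGaussian E)) :=
    ((h2.comp_fst _).add (h2.comp_snd _)).const_mul 2
  refine h.mono' (by fun_prop) (ae_of_all _ fun p => ?_)
  rw [Real.norm_of_nonneg (by positivity)]
  nlinarith [sq_nonneg (‖p.1‖ - ‖p.2‖)]

omit [FiniteDimensional ℝ E] [MeasurableSpace E] [BorelSpace E] in
lemma norm_cos_smul_add_sin_smul_sub_le (δ : ℝ) (x y : E) :
    ‖Real.cos δ • x + Real.sin δ • y - x‖ ≤ |δ| * (‖x‖ + ‖y‖) := by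
  have h1 : |Real.cos δ - 1| ≤ |δ| := by
    have := Real.abs_cos_sub_cos_le δ 0
    simpa using this
  have h2 : |Real.sin δ| ≤ |δ| := Real.abs_sin_le_abs
  calc ‖Real.cos δ • x + Real.sin δ • y - x‖
      = ‖(Real.cos δ - 1) • x + Real.sin δ • y‖ := by rw [sub_smul, one_smul]; congr 1; abel
    _ ≤ |Real.cos δ - 1| * ‖x‖ + |Real.sin δ| * ‖y‖ := by
        refine (norm_add_le _ _).trans ?_
        rw [norm_smul, norm_smul, Real.norm_eq_abs, Real.norm_eq_abs]
    _ ≤ |δ| * (‖x‖ + ‖y‖) := by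
        rw [mul_add]; gcongr

/-- Splitting a quarter rotation of a pair of independent standard Gaussian vectors
into `N` equal steps. -/
lemma integral_sq_sub_le_rotation_steps {w : E → ℝ} (hw : Continuous w) {C : ℝ}
    (hC : ∀ x, |w x| ≤ C) (N : ℕ) (hN : 0 < N) :
    ∫ p, (w p.1 - w p.2) ^ 2 ∂((stdGaussian E).prod (stdGaussian E)) ≤
      ∫ p, (N * (w (Real.cos (Real.pi / 2 / N) • p.1 + Real.sin (Real.pi / 2 / N) • p.2)
        - w p.1)) ^ 2 ∂((stdGaussian E).prod (stdGaussian E)) := by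
  set δ : ℝ := Real.pi / 2 / N with hδ
  set ν := (stdGaussian E).prod (stdGaussian E)
  let rot : ℝ → E × E → E := fun a p => Real.cos a • p.1 + Real.sin a • p.2
  have hrot : ∀ a, Continuous (rot a) := fun a => by fun_prop
  let g : ℕ → E × E → ℝ := fun j p => w (rot (j * δ) p)
  have hg : ∀ j, Continuous (g j) := fun j => hw.comp (hrot _)
  have hgi : ∀ j, Integrable (fun p => (g (j + 1) p - g j p) ^ 2) ν := by
    intro j
    refine Integrable.of_bound (C := (C + C) ^ 2)
      (((hg _).sub (hg _)).pow 2).aestronglyMeasurable (ae_of_all _ fun p => ?_)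
    rw [norm_pow, Real.norm_eq_abs]
    gcongr
    exact (abs_sub _ _).trans (add_le_add (hC _) (hC _))
  have hNδ : (N : ℝ) * δ = Real.pi / 2 := by
    rw [hδ]; field_simp
  -- Rotating the pair by `j * δ` preserves its law and carries the first increment to the `j`-th,
  -- so all increments have the same second moment.
  have hstep : ∀ j, ∫ p, (g (j + 1) p - g j p) ^ 2 ∂ν =
      ∫ p, (w (rot δ p) - w p.1) ^ 2 ∂ν := by
    intro j
    rw [← integral_rotation_stdGaussian (E := E)
      (F := fun p => (w (rot δ p) - w p.1) ^ 2) (by fun_prop) (j * δ)]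
    congr 1 with p
    simp only [g, rot]
    congr 3
    rw [Nat.cast_add, Nat.cast_one, add_mul, one_mul, Real.cos_add, Real.sin_add]
    module
  -- The angles 0 and π/2 give `p.1` and `p.2`. Telescope and apply Cauchy–Schwarz: this costs a
  -- factor `N`, and summing `N` equal terms costs another.
  have hpt : ∀ p : E × E, (w p.1 - w p.2) ^ 2 ≤
      N * ∑ j ∈ Finset.range N, (g (j + 1) p - g j p) ^ 2 := by
    intro p
    have h0 : w p.1 = g 0 p := by simp [g, rot]
    have h1 : w p.2 = g N p := by simp [g, rot, hNδ]
    rw [h0, h1, ← neg_sub, neg_sq, ← Finset.sum_range_sub (fun j => g j p)]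
    simpa using sq_sum_le_card_mul_sum_sq (s := Finset.range N)
      (f := fun j => g (j + 1) p - g j p)
  calc ∫ p, (w p.1 - w p.2) ^ 2 ∂ν
      ≤ ∫ p, N * ∑ j ∈ Finset.range N, (g (j + 1) p - g j p) ^ 2 ∂ν := by
        refine integral_mono_of_nonneg (ae_of_all _ fun p => by positivity)
          ((integrable_finsetSum _ fun j _ => hgi j).const_mul _) (ae_of_all _ hpt)
    _ = N * ∑ j ∈ Finset.range N, ∫ p, (w (rot δ p) - w p.1) ^ 2 ∂ν := by
        rw [integral_const_mul, integral_finsetSum _ fun j _ => hgi j]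
        simp_rw [hstep]
    _ = _ := by
        rw [Finset.sum_const, Finset.card_range, nsmul_eq_mul, ← mul_assoc,
          ← integral_const_mul]
        congr 1 with p
        simp only [rot]
        ring

-- The curve t ↦ cos t • x + sin t • y leaves `x` with velocity `y`; a single step of angle π/(2N),
-- rescaled by `N`, is a difference quotient along it.
omit [FiniteDimensional ℝ E] [MeasurableSpace E] [BorelSpace E] in
lemma tendsto_rotation_difference {w : E → ℝ} {x : E} (hx : DifferentiableAt ℝ w x) (y : E) :
    Tendsto (fun N : ℕ => (N : ℝ) * (w (Real.cos (Real.pi / 2 / N) • x +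
      Real.sin (Real.pi / 2 / N) • y) - w x)) atTop (𝓝 (Real.pi / 2 * fderiv ℝ w x y)) := by
  have hc : HasDerivAt (fun t : ℝ => Real.cos t • x + Real.sin t • y) y 0 := by
    have := ((Real.hasDerivAt_cos 0).smul_const x).add ((Real.hasDerivAt_sin 0).smul_const y)
    convert! this using 1
    simp
  have hd : HasDerivAt (fun t : ℝ => w (Real.cos t • x + Real.sin t • y)) (fderiv ℝ w x y) 0 := by
    have h0 : HasFDerivAt w (fderiv ℝ w x) (Real.cos 0 • x + Real.sin 0 • y) := by
      simpa using hx.hasFDerivAt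
    exact h0.comp_hasDerivAt 0 hc
  have hlim : Tendsto (fun N : ℕ => Real.pi / 2 / (N : ℝ)) atTop (𝓝[≠] 0) := by
    refine tendsto_nhdsWithin_iff.2 ⟨tendsto_const_div_atTop_nhds_zero_nat _, ?_⟩
    filter_upwards [eventually_gt_atTop 0] with N hN
    have : (0 : ℝ) < N := by exact_mod_cast hN
    have := Real.pi_pos
    simp only [Set.mem_compl_iff, Set.mem_singleton_iff]
    positivity
  have := ((hasDerivAt_iff_tendsto_slope.1 hd).comp hlim).const_mul (Real.pi / 2)
  refine this.congr' ?_
  filter_upwards [eventually_gt_atTop 0] with N hN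
  have hN' : (0 : ℝ) < N := by exact_mod_cast hN
  have := Real.pi_pos
  simp only [Function.comp, slope, vsub_eq_sub, sub_zero, Real.cos_zero, Real.sin_zero, one_smul,
    zero_smul, add_zero, smul_eq_mul]
  field_simp

/-- A dimension-free Poincaré inequality for the standard Gaussian measure, in the form of a bound
on `∫∫ (w x - w y)²`, for a Lipschitz function whose derivative is dominated by `ρ`. -/
lemma integral_sq_sub_le_of_norm_fderiv_le {w ρ : E → ℝ} {K : NNReal} (hw : LipschitzWith K w)
    {C : ℝ} (hC : ∀ x, |w x| ≤ C) (hρ : Integrable (fun x => ρ x ^ 2) (stdGaussian E))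
    (hwρ : ∀ x, DifferentiableAt ℝ w x → ‖fderiv ℝ w x‖ ≤ ρ x) :
    ∫ p, (w p.1 - w p.2) ^ 2 ∂((stdGaussian E).prod (stdGaussian E)) ≤
      Real.pi ^ 2 / 4 * ∫ x, ρ x ^ 2 ∂(stdGaussian E) := by
  set γ := stdGaussian E
  set ν := γ.prod γ
  -- Rademacher's theorem, transferred from Lebesgue measure.
  have hdiff : ∀ᵐ x ∂γ, DifferentiableAt ℝ w x :=
    stdGaussian_absolutelyContinuous.ae_le hw.ae_differentiableAt
  let F : ℕ → E × E → ℝ := fun N p => (N * (w (Real.cos (Real.pi / 2 / N) • p.1 +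
    Real.sin (Real.pi / 2 / N) • p.2) - w p.1)) ^ 2
  let G : E × E → ℝ := fun p => (Real.pi / 2 * fderiv ℝ w p.1 p.2) ^ 2
  have hFc : ∀ N, Continuous (F N) := fun N => by
    have := hw.continuous
    fun_prop
  -- The Lipschitz constant `K` serves only for dominated convergence and does not enter the final
  -- bound.
  have hFb : ∀ N, 0 < N → ∀ p, ‖F N p‖ ≤ (K * (Real.pi / 2)) ^ 2 * (‖p.1‖ + ‖p.2‖) ^ 2 := by
    intro N hN p
    have hN' : (0 : ℝ) < N := by exact_mod_cast hN
    have hpi := Real.pi_pos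
    rw [← mul_pow, norm_pow]
    gcongr
    rw [Real.norm_eq_abs, abs_mul, Nat.abs_cast, ← Real.dist_eq]
    calc (N : ℝ) * dist (w _) (w p.1)
        ≤ N * (K * (|Real.pi / 2 / N| * (‖p.1‖ + ‖p.2‖))) := by
          gcongr
          refine (hw.dist_le_mul _ _).trans ?_
          rw [dist_eq_norm]
          gcongr
          exact norm_cos_smul_add_sin_smul_sub_le _ _ _
      _ = K * (Real.pi / 2) * (‖p.1‖ + ‖p.2‖) := by
          rw [abs_of_pos (by positivity)]
          field_simp
  have hlim : ∀ᵐ p ∂ν, Tendsto (fun N => F (N + 1) p) atTop (𝓝 (G p)) := by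
    have : ∀ᵐ p ∂ν, DifferentiableAt ℝ w p.1 := Measure.quasiMeasurePreserving_fst.ae hdiff
    filter_upwards [this] with p hp
    exact ((tendsto_rotation_difference hp p.2).pow 2).comp (tendsto_add_atTop_nat 1)
  have hdom := (integrable_sq_norm_add_norm_stdGaussian (E := E)).const_mul
    ((K * (Real.pi / 2)) ^ 2)
  have hGm : AEStronglyMeasurable G ν :=
    aestronglyMeasurable_of_tendsto_ae _ (fun N => (hFc (N + 1)).aestronglyMeasurable) hlim
  have hGi : Integrable G ν := by
    refine hdom.mono' hGm ?_
    filter_upwards [hlim] with p hp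
    exact le_of_tendsto hp.norm (Eventually.of_forall fun N => hFb _ N.succ_pos p)
  have hconv : Tendsto (fun N => ∫ p, F (N + 1) p ∂ν) atTop (𝓝 (∫ p, G p ∂ν)) :=
    tendsto_integral_of_dominated_convergence _ (fun N => (hFc _).aestronglyMeasurable) hdom
      (fun N => ae_of_all _ fun p => hFb _ N.succ_pos p) hlim
  have h1 : ∫ p, (w p.1 - w p.2) ^ 2 ∂ν ≤ ∫ p, G p ∂ν :=
    ge_of_tendsto' hconv fun N => by
      simpa only [F] using integral_sq_sub_le_rotation_steps hw.continuous hC (N + 1) N.succ_pos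
  -- For fixed `x` the inner variable is Gaussian, so the squared directional derivative averages to
  -- the squared norm of the gradient, with no dimensional factor.
  have hinner : ∀ x, ∫ y, G (x, y) ∂γ = Real.pi ^ 2 / 4 * ‖fderiv ℝ w x‖ ^ 2 := by
    intro x
    simp only [G, mul_pow]
    rw [integral_const_mul, integral_sq_dual_stdGaussian]
    ring
  refine h1.trans ?_
  rw [integral_prod _ hGi, ← integral_const_mul]
  refine integral_mono_ae hGi.integral_prod_left (hρ.const_mul _) ?_
  filter_upwards [hdiff] with x hx
  simp only [hinner]
  have := hwρ x hx
  gcongr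

/-- Bounded Lipschitz functions have exponentials that are almost constant in `L²`
for the standard Gaussian measure. -/
lemma integral_sq_exp_half_sub_mean_le {f : E → ℝ} {L : NNReal} (hf : LipschitzWith L f) {C : ℝ}
    (hC : ∀ x, |f x| ≤ C) :
    ∫ x, (Real.exp (f x / 2) - ∫ y, Real.exp (f y / 2) ∂(stdGaussian E)) ^ 2 ∂(stdGaussian E) ≤
      2 * L ^ 2 * ∫ x, Real.exp (f x / 2) ^ 2 ∂(stdGaussian E) := by
  set γ := stdGaussian E
  set w : E → ℝ := fun x => Real.exp (f x / 2) with hwdef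
  have hfc := hf.continuous
  have hwc : Continuous w := by fun_prop
  have hwb : ∀ x, |w x| ≤ Real.exp (C / 2) := fun x => by
    rw [Real.abs_exp]
    gcongr
    exact (le_abs_self _).trans (hC x)
  -- Qualitative only: this constant depends on `C`. The quantitative input is the pointwise bound
  -- |∇w| ≤ (L/2)·w used in `hmain`.
  have hwL : LipschitzWith ((Real.exp (C / 2)).toNNReal * (L / 2)) w := by
    have h1 : LipschitzWith (L / 2) fun x => f x / 2 := by
      refine LipschitzWith.of_dist_le_mul fun x y => ?_
      have := hf.dist_le_mul x y
      rw [Real.dist_eq] at this ⊢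
      rw [← sub_div, abs_div, abs_two]
      push_cast
      linarith
    have h2 : LipschitzOnWith (Real.exp (C / 2)).toNNReal Real.exp (Set.Iic (C / 2)) := by
      refine (convex_Iic _).lipschitzOnWith_of_nnnorm_deriv_le
        (fun x _ => Real.differentiableAt_exp) fun x hx => ?_
      rw [Real.deriv_exp, ← NNReal.coe_le_coe, coe_nnnorm, Real.norm_eq_abs, Real.abs_exp,
        Real.coe_toNNReal _ (Real.exp_pos _).le]
      exact Real.exp_le_exp.2 hx
    have h3 := h2.comp (h1.lipschitzOnWith (s := Set.univ)) fun x _ => by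
      have := (le_abs_self _).trans (hC x)
      simp only [Set.mem_Iic]; linarith
    rwa [lipschitzOnWith_univ] at h3
  have hw2 : Integrable (fun x => w x ^ 2) γ :=
    Integrable.of_bound (C := Real.exp (C / 2) ^ 2) (by fun_prop) (ae_of_all _ fun x => by
      rw [norm_pow, Real.norm_eq_abs]; gcongr; exact hwb x)
  have hw1 : Integrable w γ :=
    Integrable.of_bound (C := Real.exp (C / 2)) (by fun_prop) (ae_of_all _ fun x => hwb x)
  have hmain := integral_sq_sub_le_of_norm_fderiv_le hwL hwb
    (ρ := fun x => (L / 2) * w x) (by simpa only [mul_pow] using hw2.const_mul _) (by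
      intro x hx
      have hfx : DifferentiableAt ℝ f x := by
        -- Differentiability is known for `w`, not for `f`; it passes back through the logarithm.
        have h : f = fun x => 2 * Real.log (w x) := by
          funext z; simp only [hwdef, Real.log_exp]; ring
        rw [h]
        exact (hx.log (Real.exp_pos _).ne').const_mul _
      have hd : HasFDerivAt w (Real.exp (f x / 2) • ((2 : ℝ)⁻¹ • fderiv ℝ f x)) x := by
        have := (hfx.hasFDerivAt.const_mul (2 : ℝ)⁻¹).exp
        have e : (fun x => Real.exp (2⁻¹ * f x)) = w := by
          funext z; simp only [hwdef]; congr 1; ring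
        rw [e] at this
        convert! this using 3
        ring
      rw [hd.fderiv, norm_smul, norm_smul, Real.norm_eq_abs, Real.abs_exp, Real.norm_eq_abs,
        abs_of_pos (by norm_num : (0:ℝ) < 2⁻¹)]
      have := norm_fderiv_le_of_lipschitz ℝ hf (x₀ := x)
      simp only [hwdef]
      have he := Real.exp_pos (f x / 2)
      nlinarith)
  -- The double integral over independent copies is twice the variance.
  have hexp : ∫ p, (w p.1 - w p.2) ^ 2 ∂(γ.prod γ) = 2 * ∫ x, (w x - ∫ y, w y ∂γ) ^ 2 ∂γ := by
    have hprod : Integrable (fun p : E × E => w p.1 * w p.2) (γ.prod γ) := hw1.mul_prod hw1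
    have e1 : ∀ p : E × E, (w p.1 - w p.2) ^ 2 = w p.1 ^ 2 + w p.2 ^ 2 - 2 * (w p.1 * w p.2) :=
      fun p => by ring
    have e2 : ∀ x : E, (w x - ∫ y, w y ∂γ) ^ 2 =
        w x ^ 2 - 2 * (∫ y, w y ∂γ) * w x + (∫ y, w y ∂γ) ^ 2 := fun x => by ring
    simp_rw [e1, e2]
    have i1 : Integrable (fun p : E × E => w p.1 ^ 2) (γ.prod γ) := hw2.comp_fst _
    have i2 : Integrable (fun p : E × E => w p.2 ^ 2) (γ.prod γ) := hw2.comp_snd _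
    have i3 : Integrable (fun p : E × E => w p.1 ^ 2 + w p.2 ^ 2) (γ.prod γ) := i1.add i2
    have i4 : Integrable (fun x => w x ^ 2 - 2 * (∫ y, w y ∂γ) * w x) γ :=
      hw2.sub (hw1.const_mul _)
    rw [integral_sub i3 (hprod.const_mul 2), integral_add i1 i2, integral_const_mul,
      integral_prod_mul, integral_add i4 (integrable_const _),
      integral_sub hw2 (hw1.const_mul _), integral_const_mul, integral_const,
      integral_fun_fst (fun x => w x ^ 2), integral_fun_snd (fun x => w x ^ 2)]
    simp
    ring
  rw [hexp] at hmain
  have hpi : Real.pi ^ 2 ≤ 16 := by nlinarith [Real.pi_le_four, Real.pi_pos]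
  have hnn : 0 ≤ ∫ x, w x ^ 2 ∂γ := integral_nonneg fun x => by positivity
  simp_rw [mul_pow] at hmain
  rw [integral_const_mul] at hmain
  have : Real.pi ^ 2 / 4 * ((L / 2 : ℝ) ^ 2 * ∫ x, w x ^ 2 ∂γ) ≤
      16 / 4 * ((L / 2 : ℝ) ^ 2 * ∫ x, w x ^ 2 ∂γ) := by gcongr
  have h3 : 0 ≤ (L : ℝ) ^ 2 * ∫ x, w x ^ 2 ∂γ := by positivity
  nlinarith

end Poincare

end

noncomputable section

/-! ### From small relative variance of a weight to closeness of measures. -/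

section Comparison

variable {α : Type*} [MeasurableSpace α]

/-- If a bounded weight `w` has small relative variance then `w² γ` is close to `(∫ w)² γ`. -/
lemma abs_setIntegral_sq_sub_le {γ : Measure α} [IsProbabilityMeasure γ] {w : α → ℝ}
    (hwm : Measurable w) {C : ℝ} (hC : ∀ x, |w x| ≤ C) {ρ : ℝ} (hρ : 0 < ρ)
    (hvar : ∫ x, (w x - ∫ y, w y ∂γ) ^ 2 ∂γ ≤ ρ ^ 2 * ∫ x, w x ^ 2 ∂γ)
    (A : Set α) :
    |∫ x in A, w x ^ 2 ∂γ - (∫ y, w y ∂γ) ^ 2 * γ.real A| ≤ 3 * ρ * ∫ x, w x ^ 2 ∂γ := by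
  set a := ∫ y, w y ∂γ
  set b := ∫ x, w x ^ 2 ∂γ
  have hw2 : Integrable (fun x => w x ^ 2) γ :=
    Integrable.of_bound (C := C ^ 2) (by fun_prop) (ae_of_all _ fun x => by
      rw [norm_pow, Real.norm_eq_abs]; gcongr; exact hC x)
  have hw1 : Integrable w γ :=
    Integrable.of_bound (C := C) (by fun_prop) (ae_of_all _ fun x => hC x)
  have hb : 0 ≤ b := integral_nonneg fun x => by positivity
  have hd : Integrable (fun x => (w x - a) ^ 2) γ := by
    have : Integrable (fun x => w x ^ 2 - 2 * a * w x + a ^ 2) γ :=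
      (hw2.sub (hw1.const_mul _)).add (integrable_const _)
    refine this.congr (ae_of_all _ fun x => ?_)
    ring
  have hvar' : ∫ x, (w x - a) ^ 2 ∂γ = b - a ^ 2 := by
    have i4 : Integrable (fun x => w x ^ 2 - 2 * a * w x) γ := hw2.sub (hw1.const_mul _)
    have e : ∀ x, (w x - a) ^ 2 = w x ^ 2 - 2 * a * w x + a ^ 2 := fun x => by ring
    simp_rw [e]
    rw [integral_add i4 (integrable_const _), integral_sub hw2 (hw1.const_mul _),
      integral_const_mul, integral_const]
    simp only [probReal_univ, smul_eq_mul, one_mul]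
    ring
  have ha : a ^ 2 ≤ b := by
    have : 0 ≤ ∫ x, (w x - a) ^ 2 ∂γ := integral_nonneg fun x => by positivity
    linarith
  have hs : Integrable (fun x => 2 * w x ^ 2 + 2 * a ^ 2) γ :=
    (hw2.const_mul 2).add (integrable_const _)
  have hsi : ∫ x, (2 * w x ^ 2 + 2 * a ^ 2) ∂γ ≤ 4 * b := by
    rw [integral_add (hw2.const_mul 2) (integrable_const _), integral_const_mul, integral_const]
    simp only [probReal_univ, smul_eq_mul, one_mul]
    linarith
  have h1 : ∫ x in A, w x ^ 2 ∂γ - a ^ 2 * γ.real A = ∫ x in A, (w x ^ 2 - a ^ 2) ∂γ := by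
    rw [integral_sub hw2.integrableOn (integrable_const _), setIntegral_const, smul_eq_mul,
      mul_comm]
  -- Factor w² - a² and use AM–GM with weight `ρ`, which balances a variance of order ρ²b against (w
  -- + a)², whose integral is of order b.
  have hpt : ∀ x, |w x ^ 2 - a ^ 2| ≤
      (2 * ρ)⁻¹ * (w x - a) ^ 2 + ρ / 2 * (2 * w x ^ 2 + 2 * a ^ 2) := by
    intro x
    have e : w x ^ 2 - a ^ 2 = (w x - a) * (w x + a) := by ring
    rw [e, abs_mul]
    have h2 : (w x + a) ^ 2 ≤ 2 * w x ^ 2 + 2 * a ^ 2 := by nlinarith [sq_nonneg (w x - a)]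
    have h3 : |w x - a| * |w x + a| ≤ (2 * ρ)⁻¹ * |w x - a| ^ 2 + ρ / 2 * |w x + a| ^ 2 := by
      have : 0 ≤ (2 * ρ)⁻¹ * (|w x - a| - ρ * |w x + a|) ^ 2 := by positivity
      have e2 : (2 * ρ)⁻¹ * (|w x - a| - ρ * |w x + a|) ^ 2 =
        (2 * ρ)⁻¹ * |w x - a| ^ 2 + ρ / 2 * |w x + a| ^ 2 - |w x - a| * |w x + a| := by
        field_simp
        ring
      linarith
    rw [sq_abs, sq_abs] at h3
    have : ρ / 2 * (w x + a) ^ 2 ≤ ρ / 2 * (2 * w x ^ 2 + 2 * a ^ 2) := by gcongr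
    linarith
  have hi : Integrable (fun x => |w x ^ 2 - a ^ 2|) γ := (hw2.sub (integrable_const _)).abs
  calc |∫ x in A, w x ^ 2 ∂γ - a ^ 2 * γ.real A|
      = |∫ x in A, (w x ^ 2 - a ^ 2) ∂γ| := by rw [h1]
    _ ≤ ∫ x in A, |w x ^ 2 - a ^ 2| ∂γ := abs_integral_le_integral_abs
    _ ≤ ∫ x, |w x ^ 2 - a ^ 2| ∂γ :=
        setIntegral_le_integral hi (ae_of_all _ fun x => abs_nonneg _)
    _ ≤ ∫ x, ((2 * ρ)⁻¹ * (w x - a) ^ 2 + ρ / 2 * (2 * w x ^ 2 + 2 * a ^ 2)) ∂γ :=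
        integral_mono hi ((hd.const_mul _).add (hs.const_mul _)) hpt
    _ = (2 * ρ)⁻¹ * ∫ x, (w x - a) ^ 2 ∂γ + ρ / 2 * ∫ x, (2 * w x ^ 2 + 2 * a ^ 2) ∂γ := by
        rw [integral_add (hd.const_mul _) (hs.const_mul _), integral_const_mul,
          integral_const_mul]
    _ ≤ (2 * ρ)⁻¹ * (ρ ^ 2 * b) + ρ / 2 * (4 * b) := by gcongr
    _ ≤ 3 * ρ * b := by
        have : (2 * ρ)⁻¹ * (ρ ^ 2 * b) = ρ / 2 * b := by field_simp
        rw [this]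
        nlinarith [mul_nonneg hρ.le hb]

/-- A finite measure that agrees with `c w² γ` on a set `U` carrying most of both masses, where
`w` has small relative variance, is close to `γ` after normalization. -/
lemma abs_div_sub_le_of_agree {P γ : Measure α} [IsFiniteMeasure P] [IsProbabilityMeasure γ]
    {w : α → ℝ} (hwm : Measurable w) {C : ℝ} (hC : ∀ x, |w x| ≤ C) {ρ : ℝ} (hρ : 0 < ρ)
    (hρ' : ρ ≤ 1 / 16) (hvar : ∫ x, (w x - ∫ y, w y ∂γ) ^ 2 ∂γ ≤ ρ ^ 2 * ∫ x, w x ^ 2 ∂γ)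
    {U : Set α} (hU : MeasurableSet U) {c : ℝ} (hc : 0 < c) {e : ℝ} (he : 0 ≤ e) (he' : e ≤ 1 / 4)
    (hagree : ∀ A, MeasurableSet A → A ⊆ U → P.real A = c * ∫ x in A, w x ^ 2 ∂γ)
    (hPU : P.real Uᶜ ≤ e * P.real Set.univ) (hγU : γ.real Uᶜ ≤ e)
    (hP : 0 < P.real Set.univ) {A : Set α} (hA : MeasurableSet A) :
    |P.real A / P.real Set.univ - γ.real A| ≤ 18 * ρ + 8 * e := by
  set a := ∫ y, w y ∂γ with ha_def
  set b := ∫ x, w x ^ 2 ∂γ with hb_def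
  set Z := P.real Set.univ
  have hb : 0 ≤ b := integral_nonneg fun x => by positivity
  have key := fun (S : Set α) => abs_setIntegral_sq_sub_le hwm hC hρ hvar S
  have hvar' : b - a ^ 2 ≤ ρ ^ 2 * b := by
    have hw2 : MemLp w 2 γ := MemLp.of_bound (by fun_prop) C (ae_of_all _ hC)
    have := variance_eq_sub hw2
    rw [variance_eq_integral (by fun_prop)] at this
    simp only [Pi.pow_apply] at this
    linarith
  have ha : a ^ 2 ≤ b := by
    have hw2 : MemLp w 2 γ := MemLp.of_bound (by fun_prop) C (ae_of_all _ hC)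
    have := variance_eq_sub hw2
    have h0 := variance_nonneg w γ
    simp only [Pi.pow_apply] at this
    linarith
  -- Inside `U` the two measures agree up to the relative variance. Outside, each contributes at
  -- most its own tail, and a² ≤ b converts the Gaussian tail to the scale c·b.
  have hmain : ∀ S, MeasurableSet S →
      |P.real S - c * a ^ 2 * γ.real S| ≤ 3 * ρ * (c * b) + e * (c * b) + e * Z := by
    intro S hS
    have h1 : P.real S = P.real (S ∩ U) + P.real (S \ U) :=
      (measureReal_inter_add_sdiff hU).symm
    have h2 : γ.real S = γ.real (S ∩ U) + γ.real (S \ U) :=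
      (measureReal_inter_add_sdiff hU).symm
    have h3 : P.real (S \ U) ≤ e * Z :=
      (measureReal_mono fun x hx => hx.2).trans hPU
    have h4 : γ.real (S \ U) ≤ e := (measureReal_mono fun x hx => hx.2).trans hγU
    have h5 := key (S ∩ U)
    have h6 : 0 ≤ P.real (S \ U) := measureReal_nonneg
    have h7 : 0 ≤ γ.real (S \ U) := measureReal_nonneg
    rw [h1, h2, hagree _ (hS.inter hU) Set.inter_subset_right]
    have h8 : c * a ^ 2 * γ.real (S \ U) ≤ e * (c * b) := by
      calc c * a ^ 2 * γ.real (S \ U) ≤ c * b * e := by gcongr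
        _ = _ := by ring
    have h9 : 0 ≤ c * a ^ 2 * γ.real (S \ U) := by positivity
    have h10 : |c * (∫ x in S ∩ U, w x ^ 2 ∂γ - a ^ 2 * γ.real (S ∩ U))| ≤ 3 * ρ * (c * b) := by
      rw [abs_mul, abs_of_pos hc]
      calc _ ≤ c * (3 * ρ * b) := by gcongr
        _ = _ := by ring
    rw [abs_le] at h10 ⊢
    constructor <;> nlinarith
  have huniv := hmain Set.univ MeasurableSet.univ
  rw [probReal_univ (μ := γ), mul_one] at huniv
  have hcb : 0 ≤ c * b := by positivity
  -- The case of the whole space shows that the total mass is comparable to c·a², hence to c·b; all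
  -- later errors can then be measured relative to `Z`.
  have hcbZ : c * b ≤ 3 * Z := by
    have h1 := (abs_le.1 huniv).1
    have h2 : c * b - c * a ^ 2 ≤ ρ ^ 2 * (c * b) := by nlinarith
    have h3 : ρ ^ 2 * (c * b) ≤ 1 / 256 * (c * b) := by
      gcongr; nlinarith
    have h4 : 3 * ρ * (c * b) ≤ 3 / 16 * (c * b) := by gcongr; linarith
    have h5 : e * (c * b) ≤ 1 / 4 * (c * b) := by gcongr
    have h6 : e * Z ≤ 1 / 4 * Z := by gcongr
    change -(3 * ρ * (c * b) + e * (c * b) + e * Z) ≤ Z - c * a ^ 2 at h1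
    linarith
  have hAm := hmain A hA
  have hγ0 : 0 ≤ γ.real A := measureReal_nonneg
  have hγ1 : γ.real A ≤ 1 := measureReal_le_one
  have hdiff : |P.real A - Z * γ.real A| ≤ 2 * (3 * ρ * (c * b) + e * (c * b) + e * Z) := by
    have e1 : P.real A - Z * γ.real A =
        (P.real A - c * a ^ 2 * γ.real A) - γ.real A * (Z - c * a ^ 2) := by ring
    rw [e1]
    refine (abs_sub _ _).trans ?_
    rw [abs_mul, abs_of_nonneg hγ0]
    have : γ.real A * |Z - c * a ^ 2| ≤ 1 * (3 * ρ * (c * b) + e * (c * b) + e * Z) := by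
      gcongr
    linarith
  have e2 : P.real A / Z - γ.real A = (P.real A - Z * γ.real A) / Z := by
    field_simp
  rw [e2, abs_div, abs_of_pos hP, div_le_iff₀ hP]
  refine hdiff.trans ?_
  have h4 : 3 * ρ * (c * b) ≤ 3 * ρ * (3 * Z) := by gcongr
  have h5 : e * (c * b) ≤ e * (3 * Z) := by gcongr
  nlinarith

end Comparison

/-! ### Integrals and tails of exponentials of the norm. -/

section ExponentialTail

variable {E : Type*} [NormedAddCommGroup E] [InnerProductSpace ℝ E] [FiniteDimensional ℝ E]
  [MeasurableSpace E] [BorelSpace E]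

open Module in
lemma integral_exp_neg_mul_norm {a : ℝ} (ha : 0 < a) :
    ∫ z : E, Real.exp (-(a * ‖z‖)) =
      (finrank ℝ E).factorial * a⁻¹ ^ finrank ℝ E * volume.real (Metric.ball (0 : E) 1) := by
  have h1 := MeasureTheory.measure_unitBall_eq_integral_div_gamma (volume : Measure E)
    (p := 1) one_pos
  have h2 : ∫ z : E, Real.exp (-‖z‖) =
      (finrank ℝ E).factorial * volume.real (Metric.ball (0 : E) 1) := by
    have h0 : 0 ≤ ∫ z : E, Real.exp (-‖z‖) := integral_nonneg fun z => (Real.exp_pos _).le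
    rw [measureReal_def, h1]
    simp only [Real.rpow_one, div_one, Real.Gamma_nat_eq_factorial]
    rw [ENNReal.toReal_ofReal (by positivity)]
    field_simp
  have h3 := Measure.integral_comp_smul (volume : Measure E) (fun z => Real.exp (-‖z‖)) a
  simp only [norm_smul, Real.norm_eq_abs, abs_of_pos ha] at h3
  rw [h3, h2, abs_of_pos (by positivity), smul_eq_mul, inv_pow]
  ring

-- A non-integrable function has Bochner integral 0, whereas the formula gives a positive value.
open Module in
lemma integrable_exp_neg_mul_norm {a : ℝ} (ha : 0 < a) :
    Integrable fun z : E => Real.exp (-(a * ‖z‖)) := by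
  by_contra h
  have h1 := integral_undef h
  rw [integral_exp_neg_mul_norm ha] at h1
  have : 0 < volume.real (Metric.ball (0 : E) 1) :=
    ENNReal.toReal_pos (Metric.measure_ball_pos _ _ one_pos).ne' measure_ball_lt_top.ne
  have h2 : (0 : ℝ) < (finrank ℝ E).factorial := by positivity
  have : 0 < (finrank ℝ E).factorial * a⁻¹ ^ finrank ℝ E * volume.real (Metric.ball (0 : E) 1) := by
    positivity
  exact this.ne' h1

open Module in
/-- The exponential tail beyond radius `s √d`, compared with the volume of the ball of
radius `√d`. -/
lemma lintegral_exp_neg_norm_tail_le (hd : 0 < finrank ℝ E) {s : ℝ} (hs : 8 ≤ s) :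
    ∫⁻ z in (Metric.closedBall (0 : E) (s * √(finrank ℝ E)))ᶜ,
        ENNReal.ofReal (Real.exp (-(s * √(finrank ℝ E) / 4 * ‖z‖))) ≤
      ENNReal.ofReal (Real.exp (-(s ^ 2 / 8 * finrank ℝ E))) *
        volume (Metric.closedBall (0 : E) (√(finrank ℝ E))) := by
  set d := finrank ℝ E with hdd
  have hd' : (0 : ℝ) < d := by exact_mod_cast hd
  set q := √(d : ℝ) with hq
  have hq0 : 0 < q := Real.sqrt_pos.2 hd'
  have hq2 : q * q = d := Real.mul_self_sqrt hd'.le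
  have hs0 : 0 < s := by linarith
  set a := s * q / 8 with ha
  have ha0 : 0 < a := by positivity
  have hvol : volume (Metric.closedBall (0 : E) q) =
      ENNReal.ofReal (q ^ d * volume.real (Metric.ball (0 : E) 1)) := by
    rw [Measure.addHaar_closedBall _ _ hq0.le, ENNReal.ofReal_mul (by positivity), measureReal_def,
      ENNReal.ofReal_toReal measure_ball_lt_top.ne]
  have hint : ∫⁻ z : E, ENNReal.ofReal (Real.exp (-(a * ‖z‖))) ≤
      volume (Metric.closedBall (0 : E) q) := by
    rw [← ofReal_integral_eq_lintegral_ofReal (integrable_exp_neg_mul_norm ha0)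
      (ae_of_all _ fun z => (Real.exp_pos _).le), integral_exp_neg_mul_norm ha0, hvol]
    refine ENNReal.ofReal_le_ofReal ?_
    rw [← hdd]
    gcongr
    -- With d! ≤ d^d and d = q·q, the integral is compared to the volume of the ball of radius q;
    -- the ratio (8/s)^d is at most 1 because s ≥ 8.
    calc (d.factorial : ℝ) * a⁻¹ ^ d ≤ (d : ℝ) ^ d * a⁻¹ ^ d := by
          gcongr; exact_mod_cast Nat.factorial_le_pow d
      _ = (q * (8 / s)) ^ d := by
          rw [← mul_pow, ← hq2, ha]; congr 1; field_simp
      _ ≤ q ^ d := by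
          gcongr
          have : 8 / s ≤ 1 := (div_le_one hs0).2 hs
          nlinarith
  calc ∫⁻ z in (Metric.closedBall (0 : E) (s * q))ᶜ,
        ENNReal.ofReal (Real.exp (-(s * q / 4 * ‖z‖)))
      ≤ ∫⁻ z in (Metric.closedBall (0 : E) (s * q))ᶜ,
          ENNReal.ofReal (Real.exp (-(s ^ 2 / 8 * d))) *
            ENNReal.ofReal (Real.exp (-(a * ‖z‖))) := by
        refine setLIntegral_mono (by fun_prop) fun z hz => ?_
        rw [← ENNReal.ofReal_mul (Real.exp_pos _).le, ← Real.exp_add]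
        refine ENNReal.ofReal_le_ofReal (Real.exp_le_exp.2 ?_)
        have hz' : s * q ≤ ‖z‖ := by
          simp only [Set.mem_compl_iff, mem_closedBall_zero_iff, not_le] at hz
          exact hz.le
        have : s ^ 2 * d ≤ s * q * ‖z‖ := by
          calc s ^ 2 * d = s * q * (s * q) := by rw [← hq2]; ring
            _ ≤ _ := by gcongr
        rw [ha]
        nlinarith
    _ ≤ ∫⁻ z : E, ENNReal.ofReal (Real.exp (-(s ^ 2 / 8 * d))) *
            ENNReal.ofReal (Real.exp (-(a * ‖z‖))) := setLIntegral_le_lintegral _ _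
    _ = ENNReal.ofReal (Real.exp (-(s ^ 2 / 8 * d))) *
          ∫⁻ z : E, ENNReal.ofReal (Real.exp (-(a * ‖z‖))) :=
        lintegral_const_mul _ (by fun_prop)
    _ ≤ _ := by gcongr

end ExponentialTail

end

noncomputable section

/-! ### Nearly quadratic functions: growth and minimizer. -/

section NearlyQuadratic

variable {E : Type*} [NormedAddCommGroup E] [InnerProductSpace ℝ E]

/-- On the closed ball of radius `R`, the function `G` has gradient `G'`, and `G - ‖·‖² / 2` has
`τ`-Lipschitz gradient. -/
structure NearlyQuadratic (G : E → ℝ) (G' : E → E →L[ℝ] ℝ) (R τ : ℝ) : Prop where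
  hasFDerivAt : ∀ z ∈ Metric.closedBall (0 : E) R, HasFDerivAt G (G' z) z
  norm_sub_le : ∀ z ∈ Metric.closedBall (0 : E) R, ∀ y ∈ Metric.closedBall (0 : E) R,
    ‖G' z - G' y - innerSL ℝ (z - y)‖ ≤ τ * ‖z - y‖

namespace NearlyQuadratic

variable {G : E → ℝ} {G' : E → E →L[ℝ] ℝ} {R τ : ℝ}

lemma hasFDerivAt_half_sq_norm_sub (y z : E) :
    HasFDerivAt (fun x : E => ‖x - y‖ ^ 2 / 2) (innerSL ℝ (z - y)) z := by
  have h := ((hasFDerivAt_id z).sub_const y).norm_sq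
  have h2 := h.const_mul (2 : ℝ)⁻¹
  convert! h2 using 1
  · funext x; simp; ring
  · ext v; simp [innerSL_apply_apply ℝ]

lemma abs_sub_quadratic_le (hG : NearlyQuadratic G G' R τ) (hτ : 0 ≤ τ) {y z : E}
    (hy : y ∈ Metric.closedBall (0 : E) R) (hz : z ∈ Metric.closedBall (0 : E) R) :
    |G z - G y - G' y (z - y) - ‖z - y‖ ^ 2 / 2| ≤ τ * ‖z - y‖ ^ 2 := by
  let k : E → ℝ := fun x => G x - G' y x - ‖x - y‖ ^ 2 / 2
  have hk : ∀ x ∈ Metric.closedBall (0 : E) R,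
      HasFDerivAt k (G' x - G' y - innerSL ℝ (x - y)) x := fun x hx =>
    ((hG.hasFDerivAt x hx).sub (G' y).hasFDerivAt).sub (hasFDerivAt_half_sq_norm_sub y x)
  -- Intersecting with the ball around `y` keeps the set convex and makes the gradient of `k` at
  -- most τ‖z - y‖ on it, so the mean value inequality gives a quadratic error.
  let s : Set E := Metric.closedBall 0 R ∩ Metric.closedBall y ‖z - y‖
  have hs : Convex ℝ s := (convex_closedBall _ _).inter (convex_closedBall _ _)
  have := hs.norm_image_sub_le_of_norm_hasFDerivWithin_le (f := k) (C := τ * ‖z - y‖)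
    (fun x hx => (hk x hx.1).hasFDerivWithinAt) (fun x hx => by
      refine (hG.norm_sub_le x hx.1 y hy).trans ?_
      have := hx.2
      rw [Metric.mem_closedBall, dist_eq_norm] at this
      gcongr) (x := y) (y := z) ⟨hy, by simp⟩ ⟨hz, by simp [dist_eq_norm]⟩
  rw [Real.norm_eq_abs] at this
  have e : k z - k y = G z - G y - G' y (z - y) - ‖z - y‖ ^ 2 / 2 := by
    simp only [k, sub_self, norm_zero, map_sub]; ring
  rw [e] at this
  calc _ ≤ _ := this
    _ = _ := by ring

/-- Lower and upper growth bounds at the origin. -/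
lemma abs_growth_le (hG : NearlyQuadratic G G' R τ) (hτ : 0 ≤ τ) (hR : 0 ≤ R) {z : E}
    (hz : z ∈ Metric.closedBall (0 : E) R) :
    |G z - G 0 - ‖z‖ ^ 2 / 2| ≤ ‖G' 0‖ * ‖z‖ + τ * ‖z‖ ^ 2 := by
  have h := hG.abs_sub_quadratic_le hτ (Metric.mem_closedBall_self hR) hz
  simp only [sub_zero] at h
  have h2 : |G' 0 z| ≤ ‖G' 0‖ * ‖z‖ := (G' 0).le_opNorm z
  rw [abs_le] at h h2 ⊢
  constructor <;> linarith [h.1, h.2, h2.1, h2.2]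

/-- The log-ratio of `exp (-G)` to a Gaussian density centred at `y`
is Lipschitz on the ball. -/
lemma abs_logRatio_sub_le (hG : NearlyQuadratic G G' R τ) (hτ : 0 ≤ τ) {y : E}
    (hy : y ∈ Metric.closedBall (0 : E) R) (hy0 : G' y = 0) {x z : E}
    (hx : x ∈ Metric.closedBall (0 : E) R) (hz : z ∈ Metric.closedBall (0 : E) R) :
    |(G z - ‖z - y‖ ^ 2 / 2) - (G x - ‖x - y‖ ^ 2 / 2)| ≤ 2 * (τ * R) * ‖z - x‖ := by
  have hk : ∀ x ∈ Metric.closedBall (0 : E) R,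
      HasFDerivAt (fun x => G x - ‖x - y‖ ^ 2 / 2) (G' x - innerSL ℝ (x - y)) x := fun x hx =>
    (hG.hasFDerivAt x hx).sub (hasFDerivAt_half_sq_norm_sub y x)
  have := (convex_closedBall (0 : E) R).norm_image_sub_le_of_norm_hasFDerivWithin_le
    (C := 2 * (τ * R)) (fun x hx => (hk x hx).hasFDerivWithinAt) (fun x hx => by
      have h := hG.norm_sub_le x hx y hy
      rw [hy0, sub_zero] at h
      refine h.trans ?_
      rw [mem_closedBall_zero_iff] at hx hy
      have : ‖x - y‖ ≤ 2 * R := (_root_.norm_sub_le _ _).trans (by linarith)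
      calc τ * ‖x - y‖ ≤ τ * (2 * R) := by gcongr
        _ = _ := by ring) hx hz
  rwa [Real.norm_eq_abs] at this

section Minimizer

variable {Λ : Set E} {q r s : ℝ}

/-- Of the coefficient 1/2 in front of s²q², the linear term takes at most 1/8 (since r ≤ s/8) and
the error τ another 1/8; 1/4 remains. -/
lemma growth_on_sphere (hG : NearlyQuadratic G G' (s * q) τ) (hτ : 0 ≤ τ) (hτ' : τ ≤ 1 / 8)
    (hq : 0 < q) (hs : 0 < s) (hrs : 8 * r ≤ s) (h0 : ‖G' 0‖ ≤ r * q) {z : E}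
    (hz : ‖z‖ = s * q) : G 0 + s ^ 2 * q ^ 2 / 4 ≤ G z := by
  have h := (abs_le.1 (hG.abs_growth_le hτ (by positivity)
    (mem_closedBall_zero_iff.2 hz.le))).1
  have h1 : ‖G' 0‖ * ‖z‖ ≤ s ^ 2 * q ^ 2 / 8 := by
    rw [hz]
    calc ‖G' 0‖ * (s * q) ≤ (r * q) * (s * q) := by gcongr
      _ = r * (s * q ^ 2) := by ring
      _ ≤ (s / 8) * (s * q ^ 2) := by gcongr; linarith
      _ = _ := by ring
  have h2 : τ * ‖z‖ ^ 2 ≤ 1 / 8 * ‖z‖ ^ 2 := by gcongr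
  have h3 : ‖z‖ ^ 2 = s ^ 2 * q ^ 2 := by rw [hz]; ring
  rw [h3] at h h2
  linarith

/-- Convexity propagates the quadratic growth on a sphere to linear growth outside. -/
lemma growth_outside (hG : NearlyQuadratic G G' (s * q) τ) (hτ : 0 ≤ τ) (hτ' : τ ≤ 1 / 8)
    (hq : 0 < q) (hs : 0 < s) (hrs : 8 * r ≤ s) (h0 : ‖G' 0‖ ≤ r * q) (hconv : ConvexOn ℝ Λ G)
    (hΛ : Metric.closedBall (0 : E) (s * q) ⊆ Λ) {z : E} (hzΛ : z ∈ Λ) (hz : s * q ≤ ‖z‖) :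
    G 0 + s * q / 4 * ‖z‖ ≤ G z := by
  have hsq : 0 < s * q := by positivity
  have hz0 : 0 < ‖z‖ := hsq.trans_le hz
  -- The point t • z lies on the sphere between 0 and `z`; convexity along this segment divides the
  -- gain there by `t`.
  set t := s * q / ‖z‖ with ht
  have ht0 : 0 < t := by positivity
  have ht1 : t ≤ 1 := (div_le_one hz0).2 hz
  have hnorm : ‖t • z‖ = s * q := by
    rw [norm_smul, Real.norm_of_nonneg ht0.le, ht]; field_simp
  have h1 := hG.growth_on_sphere hτ hτ' hq hs hrs h0 hnorm
  have h2 := hconv.2 (hΛ (Metric.mem_closedBall_self hsq.le)) hzΛ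
    (sub_nonneg.2 ht1) ht0.le (sub_add_cancel 1 t)
  simp only [smul_zero, zero_add, smul_eq_mul] at h2
  have h3 : s ^ 2 * q ^ 2 / 4 = t * (s * q / 4 * ‖z‖) := by rw [ht]; field_simp
  have h4 : t * (G 0 + s * q / 4 * ‖z‖) ≤ t * G z := by linarith
  exact le_of_mul_le_mul_left h4 ht0

/-- Compactness gives a minimizer on the ball, and the growth bound places it well inside, so it is
critical. Uniqueness is strict near-quadratic growth around `y` in the ball and `growth_outside`
beyond it. -/
lemma exists_minimizer [FiniteDimensional ℝ E] (hG : NearlyQuadratic G G' (s * q) τ)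
    (hτ : 0 ≤ τ) (hτ' : τ ≤ 1 / 8)
    (hq : 0 < q) (hs : 0 < s) (hrs : 8 * r ≤ s) (h0 : ‖G' 0‖ ≤ r * q) (hconv : ConvexOn ℝ Λ G)
    (hΛ : Metric.closedBall (0 : E) (s * q) ⊆ Λ) :
    ∃ y ∈ Metric.closedBall (0 : E) (s * q), ‖y‖ ≤ 3 * r * q ∧ G' y = 0 ∧
      ∀ z ∈ Λ, z ≠ y → G y < G z := by
  have hsq : 0 < s * q := by positivity
  have hr : 0 ≤ r := by
    by_contra h
    have : r * q < 0 := mul_neg_of_neg_of_pos (not_le.1 h) hq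
    linarith [norm_nonneg (G' 0)]
  have hcont : ContinuousOn G (Metric.closedBall (0 : E) (s * q)) := fun z hz =>
    (hG.hasFDerivAt z hz).continuousAt.continuousWithinAt
  obtain ⟨y, hy, hmin⟩ := (isCompact_closedBall (0 : E) (s * q)).exists_isMinOn
    ⟨0, Metric.mem_closedBall_self hsq.le⟩ hcont
  have hy0 : G y ≤ G 0 := hmin (Metric.mem_closedBall_self hsq.le)
  have hyn : ‖y‖ ≤ 3 * r * q := by
    have h := (abs_le.1 (hG.abs_growth_le hτ hsq.le hy)).1
    have h2 : τ * ‖y‖ ^ 2 ≤ 1 / 8 * ‖y‖ ^ 2 := by gcongr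
    have h3 : ‖G' 0‖ * ‖y‖ ≤ r * q * ‖y‖ := by gcongr
    -- From G y ≤ G 0 and 1/2 - 1/8 = 3/8; this yields ‖y‖ ≤ (8/3)·r·q, rounded up to 3·r·q.
    have h4 : ‖y‖ * (3 / 8 * ‖y‖) ≤ ‖y‖ * (r * q) := by nlinarith
    rcases (norm_nonneg y).eq_or_lt with h5 | h5
    · rw [← h5]; positivity
    · have := le_of_mul_le_mul_left h4 h5
      nlinarith [mul_nonneg hr hq.le]
  have hylt : ‖y‖ < s * q := by
    rcases hr.eq_or_lt with h | h
    · rw [← h] at hyn; simp only [mul_zero, zero_mul] at hyn; linarith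
    · have : 3 * r * q < s * q := by gcongr; linarith
      linarith
  have hy' : G' y = 0 := by
    have hloc : IsLocalMin G y :=
      hmin.isLocalMin (Filter.mem_of_superset
        (Metric.isOpen_ball.mem_nhds (mem_ball_zero_iff.2 hylt)) Metric.ball_subset_closedBall)
    exact hloc.hasFDerivAt_eq_zero (hG.hasFDerivAt y hy)
  refine ⟨y, hy, hyn, hy', fun z hz hzy => ?_⟩
  by_cases hzB : z ∈ Metric.closedBall (0 : E) (s * q)
  · have h := (abs_le.1 (hG.abs_sub_quadratic_le hτ hy hzB)).1
    rw [hy'] at h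
    have hpos : 0 < ‖z - y‖ := norm_pos_iff.2 (sub_ne_zero.2 hzy)
    have h2 : τ * ‖z - y‖ ^ 2 ≤ 1 / 8 * ‖z - y‖ ^ 2 := by gcongr
    have : (0 : E →L[ℝ] ℝ) (z - y) = 0 := rfl
    nlinarith [pow_pos hpos 2]
  · have hz' : s * q ≤ ‖z‖ := by
      rw [mem_closedBall_zero_iff, not_le] at hzB; exact hzB.le
    have := hG.growth_outside hτ hτ' hq hs hrs h0 hconv hΛ hz hz'
    have : 0 < s * q / 4 * ‖z‖ := by have := hsq.trans_le hz'; positivity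
    linarith

end Minimizer

end NearlyQuadratic

end NearlyQuadratic

end

noncomputable section

/-! ### Gibbs measures: mass near the origin against mass outside the ball. -/

section LaplaceApproximation

open Module

variable {E : Type*} [NormedAddCommGroup E] [InnerProductSpace ℝ E] [FiniteDimensional ℝ E]
  [MeasurableSpace E] [BorelSpace E]

variable (E) in
lemma exists_shifted_stdGaussian_eq_withDensity :
    ∃ c : ℝ, 0 < c ∧ ∀ y : E, (stdGaussian E).map (y + ·) =
      volume.withDensity fun x => ENNReal.ofReal (c * Real.exp (-‖x - y‖ ^ 2 / 2)) := by
  obtain ⟨c, hc, h⟩ := exists_stdGaussian_eq_withDensity (E := E)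
  refine ⟨c, hc, fun y => ?_⟩
  ext A hA
  rw [Measure.map_apply (by fun_prop) hA, h, withDensity_apply _ (hA.preimage (by fun_prop)),
    withDensity_apply _ hA,
    ← (measurePreserving_add_left volume y).setLIntegral_comp_preimage hA (by fun_prop)]
  simp

/-- Markov's inequality for ‖x‖², whose mean is d = q²; the shift by `y` costs 3·r·q of the radius.
-/
lemma shifted_stdGaussian_compl_closedBall_le {y : E} {q r s : ℝ} (hq : 0 < q)
    (hd : q ^ 2 = finrank ℝ E) (hy : ‖y‖ ≤ 3 * r * q) (hs : 3 * r < s) :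
    ((stdGaussian E).map (y + ·)).real (Metric.closedBall (0 : E) (s * q))ᶜ ≤
      1 / (s - 3 * r) ^ 2 := by
  have hT : 0 < s - 3 * r := by linarith
  have hm := mul_meas_ge_le_integral_of_nonneg (μ := stdGaussian E) (f := fun x => ‖x‖ ^ 2)
    (ae_of_all _ fun x => by positivity)
    (IsGaussian.memLp_two_id (μ := stdGaussian E)).norm.integrable_sq (((s - 3 * r) * q) ^ 2)
  rw [integral_sq_norm_stdGaussian, ← hd] at hm
  rw [map_measureReal_apply (by fun_prop) measurableSet_closedBall.compl]
  have hsub : (y + ·) ⁻¹' (Metric.closedBall (0 : E) (s * q))ᶜ ⊆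
      {x : E | ((s - 3 * r) * q) ^ 2 ≤ ‖x‖ ^ 2} := by
    intro x hx
    simp only [Set.mem_preimage, Set.mem_compl_iff, mem_closedBall_zero_iff, not_le] at hx
    have := norm_add_le y x
    have h : (s - 3 * r) * q ≤ ‖x‖ := by linarith
    exact pow_le_pow_left₀ (by positivity) h 2
  refine (measureReal_mono hsub).trans ?_
  rw [le_div_iff₀ (by positivity)]
  have hq2 : 0 < q ^ 2 := by positivity
  refine le_of_mul_le_mul_right ?_ hq2
  calc _ = ((s - 3 * r) * q) ^ 2 * (stdGaussian E).real
        {x : E | ((s - 3 * r) * q) ^ 2 ≤ ‖x‖ ^ 2} := by ring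
    _ ≤ _ := by rw [one_mul]; exact hm

omit [MeasurableSpace E] [BorelSpace E] in
/-- A function that is Lipschitz on a ball extends to a bounded Lipschitz function. -/
lemma exists_bounded_lipschitz_extension {f : E → ℝ} {R : ℝ} {L : NNReal}
    (hf : LipschitzOnWith L f (Metric.closedBall (0 : E) R)) :
    ∃ g : E → ℝ, ∃ M : ℝ, LipschitzWith L g ∧ (∀ x, |g x| ≤ M) ∧
      Set.EqOn f g (Metric.closedBall (0 : E) R) := by
  obtain ⟨g, hg, hfg⟩ := hf.extend_real
  obtain ⟨M, hM⟩ := (isCompact_closedBall (0 : E) R).exists_bound_of_continuousOn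
    hg.continuous.continuousOn
  have hM' : ∀ x ∈ Metric.closedBall (0 : E) R, |g x| ≤ max M 0 := fun x hx =>
    (hM x hx).trans (le_max_left _ _)
  -- Truncation at the bound already valid on the ball changes nothing there and preserves the
  -- Lipschitz constant.
  refine ⟨fun x => max (min (g x) (max M 0)) (-(max M 0)), max M 0,
    (hg.min_const _).max_const _, fun x => ?_, fun x hx => ?_⟩
  · have : 0 ≤ max M 0 := le_max_right _ _
    rw [abs_le]
    exact ⟨le_max_right _ _, max_le (min_le_right _ _) (by linarith)⟩
  · have := abs_le.1 (hM' x hx)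
    change f x = max (min (g x) (max M 0)) (-(max M 0))
    rw [hfg hx, min_eq_left this.2, max_eq_left this.1]

/-- The measure on `Λ` with Lebesgue density `exp (-G) p`. -/
def gibbsMeasure (Λ : Set E) (G p : E → ℝ) : Measure E :=
  (volume.restrict Λ).withDensity fun z => ENNReal.ofReal (Real.exp (-G z) * p z)

variable {Λ : Set E} {G p : E → ℝ} {G' : E → E →L[ℝ] ℝ} {s q r τ η C : ℝ}

lemma gibbsMeasure_apply {A : Set E} (hA : MeasurableSet A) :
    gibbsMeasure Λ G p A = ∫⁻ z in A ∩ Λ, ENNReal.ofReal (Real.exp (-G z) * p z) := by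
  rw [gibbsMeasure, withDensity_apply _ hA, Measure.restrict_restrict hA]

omit [InnerProductSpace ℝ E] [FiniteDimensional ℝ E] [MeasurableSpace E] [BorelSpace E] in
lemma prior_lower_bound (hη1 : η ≤ 1) (hsq : 0 ≤ s * q)
    (hlip : ∀ x ∈ Metric.closedBall (0 : E) (s * q), ∀ z ∈ Metric.closedBall (0 : E) (s * q),
      |Real.log (p z) - Real.log (p x)| ≤ η * ‖z - x‖) {z : E}
    (hp0 : 0 < p 0) (hpz : 0 < p z) (hz : z ∈ Metric.closedBall (0 : E) (s * q)) :
    p 0 * Real.exp (-‖z‖) ≤ p z := by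
  have h := (abs_le.1 (hlip 0 (Metric.mem_closedBall_self hsq) z hz)).1
  rw [sub_zero] at h
  have h1 : η * ‖z‖ ≤ 1 * ‖z‖ := by gcongr
  rw [← Real.exp_log hp0, ← Real.exp_add, ← Real.exp_log hpz]
  exact Real.exp_le_exp.2 (by linarith)

/-- Only the ball of radius q = √d is kept. There G rises by at most (r + 1/2 + 1/8)·d and the log
prior drops by at most q ≤ d, which fits into (r + 2)·d. -/
lemma gibbsMeasure_univ_ge (hG : NearlyQuadratic G G' (s * q) τ) (hτ : 0 ≤ τ) (hτ' : τ ≤ 1 / 8)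
    (hq : 1 ≤ q) (hd : q ^ 2 = finrank ℝ E) (hs : 1 ≤ s) (h0 : ‖G' 0‖ ≤ r * q)
    (hΛ : Metric.closedBall (0 : E) (s * q) ⊆ Λ) (hp : ∀ z ∈ Λ, 0 < p z) (hη1 : η ≤ 1)
    (hlip : ∀ x ∈ Metric.closedBall (0 : E) (s * q), ∀ z ∈ Metric.closedBall (0 : E) (s * q),
      |Real.log (p z) - Real.log (p x)| ≤ η * ‖z - x‖) :
    ENNReal.ofReal (Real.exp (-G 0) * p 0 * Real.exp (-((r + 2) * finrank ℝ E))) *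
      volume (Metric.closedBall (0 : E) q) ≤ gibbsMeasure Λ G p Set.univ := by
  have hsq : 0 ≤ s * q := by positivity
  have hsub : Metric.closedBall (0 : E) q ⊆ Metric.closedBall (0 : E) (s * q) :=
    Metric.closedBall_subset_closedBall (by nlinarith)
  have hp0 := hp 0 (hΛ (Metric.mem_closedBall_self hsq))
  calc _ ≤ ∫⁻ z in Metric.closedBall (0 : E) q, ENNReal.ofReal (Real.exp (-G z) * p z) := by
        rw [← setLIntegral_const]
        refine setLIntegral_mono' measurableSet_closedBall fun z hz => ?_
        refine ENNReal.ofReal_le_ofReal ?_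
        have hz' := hsub hz
        have h1 := prior_lower_bound hη1 hsq hlip hp0 (hp z (hΛ hz')) hz'
        have h2 := (abs_le.1 (hG.abs_growth_le hτ hsq hz')).2
        rw [mem_closedBall_zero_iff] at hz
        have h3 : ‖z‖ ^ 2 ≤ q ^ 2 := by gcongr
        have h4 : ‖G' 0‖ * ‖z‖ ≤ r * q ^ 2 := by
          calc ‖G' 0‖ * ‖z‖ ≤ (r * q) * q := by
                have : 0 ≤ r * q := (norm_nonneg _).trans h0
                gcongr
            _ = _ := by ring
        have h5 : τ * ‖z‖ ^ 2 ≤ 1 / 8 * ‖z‖ ^ 2 := by gcongr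
        have h6 : q ≤ q ^ 2 := by nlinarith
        calc Real.exp (-G 0) * p 0 * Real.exp (-((r + 2) * finrank ℝ E))
            ≤ Real.exp (-G 0) * p 0 * Real.exp (G 0 - G z - ‖z‖) := by
              rw [← hd]
              gcongr
              linarith
          _ = Real.exp (-G z) * (p 0 * Real.exp (-‖z‖)) := by
              have : Real.exp (G 0 - G z - ‖z‖) =
                  Real.exp (G 0) * Real.exp (-G z) * Real.exp (-‖z‖) := by
                rw [← Real.exp_add, ← Real.exp_add]; congr 1
              rw [this, Real.exp_neg (G 0)]
              field_simp
          _ ≤ _ := by gcongr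
    _ ≤ _ := by
        rw [gibbsMeasure_apply MeasurableSet.univ, Set.univ_inter]
        exact lintegral_mono_set (hsub.trans hΛ)

/-- Outside the ball nothing is known about G except convexity, hence linear growth with rate s·q/4.
The prior ratio costs a factor exponential in d, to be absorbed by exp(-s²d/8). -/
lemma gibbsMeasure_compl_le (hG : NearlyQuadratic G G' (s * q) τ) (hτ : 0 ≤ τ) (hτ' : τ ≤ 1 / 8)
    (hq : 1 ≤ q) (hd : q ^ 2 = finrank ℝ E) (hs : 8 ≤ s) (hrs : 8 * r ≤ s)
    (h0 : ‖G' 0‖ ≤ r * q) (hconv : ConvexOn ℝ Λ G) (hΛm : MeasurableSet Λ)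
    (hΛ : Metric.closedBall (0 : E) (s * q) ⊆ Λ) (hp : ∀ z ∈ Λ, 0 < p z)
    (hpC : ∀ z ∈ Λ, p z ≤ Real.exp (C * finrank ℝ E) * p 0) :
    gibbsMeasure Λ G p (Metric.closedBall (0 : E) (s * q))ᶜ ≤
      ENNReal.ofReal (Real.exp (-G 0) * p 0 * Real.exp (C * finrank ℝ E)) *
        (ENNReal.ofReal (Real.exp (-(s ^ 2 / 8 * finrank ℝ E))) *
          volume (Metric.closedBall (0 : E) q)) := by
  have hq0 : 0 < q := by linarith
  have hdpos : 0 < finrank ℝ E := by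
    have : (0 : ℝ) < finrank ℝ E := by rw [← hd]; positivity
    exact_mod_cast this
  have hqs : q = √(finrank ℝ E) := by rw [← hd, Real.sqrt_sq hq0.le]
  have hsq : 0 ≤ s * q := by positivity
  have hp0 := hp 0 (hΛ (Metric.mem_closedBall_self hsq))
  have htail := lintegral_exp_neg_norm_tail_le (E := E) hdpos hs
  rw [← hqs] at htail
  set c : ℝ := Real.exp (-G 0) * p 0 * Real.exp (C * finrank ℝ E) with hc
  have hc0 : 0 ≤ c := by positivity
  rw [gibbsMeasure_apply measurableSet_closedBall.compl]
  calc ∫⁻ z in (Metric.closedBall (0 : E) (s * q))ᶜ ∩ Λ, ENNReal.ofReal (Real.exp (-G z) * p z)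
      ≤ ∫⁻ z in (Metric.closedBall (0 : E) (s * q))ᶜ ∩ Λ,
          ENNReal.ofReal c * ENNReal.ofReal (Real.exp (-(s * q / 4 * ‖z‖))) := by
        refine setLIntegral_mono' (measurableSet_closedBall.compl.inter hΛm) fun z hz => ?_
        rw [← ENNReal.ofReal_mul hc0]
        refine ENNReal.ofReal_le_ofReal ?_
        have hz' : s * q ≤ ‖z‖ := by
          have := hz.1
          rw [Set.mem_compl_iff, mem_closedBall_zero_iff, not_le] at this
          exact this.le
        have h1 := hG.growth_outside hτ hτ' hq0 (by linarith) hrs h0 hconv hΛ hz.2 hz'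
        calc Real.exp (-G z) * p z
            ≤ Real.exp (-G 0 + -(s * q / 4 * ‖z‖)) * (Real.exp (C * finrank ℝ E) * p 0) := by
              have := (hp z hz.2).le
              gcongr
              · linarith
              · exact hpC z hz.2
          _ = c * Real.exp (-(s * q / 4 * ‖z‖)) := by rw [Real.exp_add, hc]; ring
    _ ≤ ∫⁻ z in (Metric.closedBall (0 : E) (s * q))ᶜ,
          ENNReal.ofReal c * ENNReal.ofReal (Real.exp (-(s * q / 4 * ‖z‖))) :=
        lintegral_mono_set Set.inter_subset_left
    _ = ENNReal.ofReal c * ∫⁻ z in (Metric.closedBall (0 : E) (s * q))ᶜ,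
          ENNReal.ofReal (Real.exp (-(s * q / 4 * ‖z‖))) :=
        lintegral_const_mul _ (by fun_prop)
    _ ≤ _ := by gcongr

/-- The exponent condition makes the tail of the Gibbs measure a small fraction of its mass. -/
lemma gibbsMeasure_compl_le_mul_univ (hG : NearlyQuadratic G G' (s * q) τ) (hτ : 0 ≤ τ)
    (hτ' : τ ≤ 1 / 8)
    (hq : 1 ≤ q) (hd : q ^ 2 = finrank ℝ E) (hs : 8 ≤ s) (hrs : 8 * r ≤ s)
    (h0 : ‖G' 0‖ ≤ r * q) (hconv : ConvexOn ℝ Λ G) (hΛm : MeasurableSet Λ)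
    (hΛ : Metric.closedBall (0 : E) (s * q) ⊆ Λ) (hp : ∀ z ∈ Λ, 0 < p z)
    (hpC : ∀ z ∈ Λ, p z ≤ Real.exp (C * finrank ℝ E) * p 0) (hη1 : η ≤ 1)
    (hlip : ∀ x ∈ Metric.closedBall (0 : E) (s * q), ∀ z ∈ Metric.closedBall (0 : E) (s * q),
      |Real.log (p z) - Real.log (p x)| ≤ η * ‖z - x‖)
    {e : ℝ} (he : 0 < e) (hexp : C + r + 2 - Real.log e ≤ s ^ 2 / 8) (he1 : e ≤ 1) :
    gibbsMeasure Λ G p (Metric.closedBall (0 : E) (s * q))ᶜ ≤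
      ENNReal.ofReal e * gibbsMeasure Λ G p Set.univ := by
  have hsq : 0 ≤ s * q := by positivity
  have hp0 := hp 0 (hΛ (Metric.mem_closedBall_self hsq))
  have hd1 : (1 : ℝ) ≤ finrank ℝ E := by rw [← hd]; nlinarith
  refine (gibbsMeasure_compl_le hG hτ hτ' hq hd hs hrs h0 hconv hΛm hΛ hp hpC).trans ?_
  refine le_trans ?_ (mul_le_mul_right (gibbsMeasure_univ_ge hG hτ hτ' hq hd (by linarith) h0 hΛ hp
    hη1 hlip) _)
  rw [← mul_assoc, ← mul_assoc, ← ENNReal.ofReal_mul (by positivity), ← ENNReal.ofReal_mul he.le]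
  gcongr ENNReal.ofReal ?_ * _
  set D : ℝ := (finrank ℝ E : ℝ)
  have hlog : Real.log e ≤ 0 := Real.log_nonpos he.le he1
  -- The volume of the ball of radius √d has cancelled, so only exponents are compared. Since log e
  -- ≤ 0 and D ≥ 1, D·log e ≤ log e.
  have key : C * D + -(s ^ 2 / 8 * D) ≤ Real.log e + -((r + 2) * D) := by
    have := mul_le_mul_of_nonneg_right hexp (zero_le_one.trans hd1)
    nlinarith [mul_nonneg (neg_nonneg.2 hlog) (sub_nonneg.2 hd1)]
  calc Real.exp (-G 0) * p 0 * Real.exp (C * D) * Real.exp (-(s ^ 2 / 8 * D))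
      = Real.exp (-G 0) * p 0 * Real.exp (C * D + -(s ^ 2 / 8 * D)) := by
        rw [Real.exp_add]; ring
    _ ≤ Real.exp (-G 0) * p 0 * Real.exp (Real.log e + -((r + 2) * D)) := by
        gcongr Real.exp (-G 0) * p 0 * Real.exp ?_
    _ = e * (Real.exp (-G 0) * p 0 * Real.exp (-((r + 2) * D))) := by
        rw [Real.exp_add, Real.exp_log he]; ring

end LaplaceApproximation

end

noncomputable section

/-! ### Laplace approximation in total variation. -/

section LaplaceApproximationTheorem

open Module

variable {E : Type*} [NormedAddCommGroup E] [InnerProductSpace ℝ E] [FiniteDimensional ℝ E]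
  [MeasurableSpace E] [BorelSpace E]
  {Λ : Set E} {G p : E → ℝ} {G' : E → E →L[ℝ] ℝ} {s q r τ η C : ℝ}

lemma integral_sq_exp_half_sub_mean_le_shifted {f : E → ℝ} {L : NNReal} (hf : LipschitzWith L f)
    {M : ℝ} (hM : ∀ x, |f x| ≤ M) (y : E) :
    ∫ x, (Real.exp (f x / 2) - ∫ z, Real.exp (f z / 2) ∂((stdGaussian E).map (y + ·))) ^ 2
        ∂((stdGaussian E).map (y + ·)) ≤
      2 * L ^ 2 * ∫ x, Real.exp (f x / 2) ^ 2 ∂((stdGaussian E).map (y + ·)) := by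
  have hfc := hf.continuous
  have hg : LipschitzWith L fun x => f (y + x) := by
    simpa [Function.comp_def] using hf.comp (isometry_add_left y).lipschitz
  have h := integral_sq_exp_half_sub_mean_le hg fun x => hM (y + x)
  rw [integral_map (by fun_prop) (by fun_prop), integral_map (by fun_prop) (by fun_prop),
    integral_map (by fun_prop) (by fun_prop)]
  exact h

lemma gibbsMeasure_closedBall_lt_top (hc : ContinuousOn (fun z => Real.exp (-G z) * p z)
    (Metric.closedBall (0 : E) s)) (hΛ : Metric.closedBall (0 : E) s ⊆ Λ)
    (hp : ∀ z ∈ Λ, 0 < p z) :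
    gibbsMeasure Λ G p (Metric.closedBall (0 : E) s) < ∞ := by
  rw [gibbsMeasure_apply measurableSet_closedBall, Set.inter_eq_left.2 hΛ]
  have := (hc.integrableOn_compact (μ := volume) (isCompact_closedBall _ _)).2
  refine lt_of_eq_of_lt (setLIntegral_congr_fun measurableSet_closedBall fun z hz => ?_) this
  have := hp z (hΛ hz)
  rw [Real.enorm_eq_ofReal (by positivity)]

/-- On sets where `exp (-G) p = c₁ exp (-‖· - y‖² / 2) w²`, the Gibbs measure is a multiple
of `w²` times the Gaussian measure centred at `y`. -/
lemma gibbsMeasure_real_eq {c c₁ : ℝ} (hc : 0 < c) {y : E}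
    (hγ : (stdGaussian E).map (y + ·) =
      volume.withDensity fun x => ENNReal.ofReal (c * Real.exp (-‖x - y‖ ^ 2 / 2)))
    {w : E → ℝ} {U : Set E} (hUΛ : U ⊆ Λ)
    (hGw : ∀ z ∈ U, Real.exp (-G z) * p z = c₁ * (Real.exp (-‖z - y‖ ^ 2 / 2) * w z ^ 2))
    (hw : Measurable w) (hc₁ : 0 ≤ c₁) {A : Set E} (hA : MeasurableSet A) (hAU : A ⊆ U) :
    (gibbsMeasure Λ G p).real A = c₁ / c * ∫ x in A, w x ^ 2 ∂((stdGaussian E).map (y + ·)) := by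
  rw [hγ, setIntegral_withDensity_eq_setIntegral_toReal_smul (by fun_prop) (by simp) _ hA,
    measureReal_def, gibbsMeasure_apply hA, Set.inter_eq_left.2 (hAU.trans hUΛ),
    ← integral_const_mul]
  have h1 : ∀ x, c₁ / c * ((ENNReal.ofReal (c * Real.exp (-‖x - y‖ ^ 2 / 2))).toReal • w x ^ 2) =
      c₁ * (Real.exp (-‖x - y‖ ^ 2 / 2) * w x ^ 2) := fun x => by
    rw [ENNReal.toReal_ofReal (by positivity), smul_eq_mul]; field_simp
  simp_rw [h1]
  rw [integral_eq_lintegral_of_nonneg_ae (ae_of_all _ fun x => by positivity)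
    (by fun_prop)]
  congr 1
  exact setLIntegral_congr_fun hA fun z hz => by rw [hGw z (hAU hz)]

/-- Non-asymptotic Laplace approximation: a log-concave likelihood `exp (-G)` that is nearly
standard Gaussian on the ball of radius `s √d`, times a prior `p` that is nearly constant there,
is close in total variation to the Gaussian measure centred at the minimizer of `G`. -/
theorem exists_gaussian_approximation (hG : NearlyQuadratic G G' (s * q) τ) (hτ : 0 ≤ τ)
    (hq : 1 ≤ q) (hd : q ^ 2 = finrank ℝ E) (hs : 8 ≤ s) (hrs : 8 * r ≤ s)
    (h0 : ‖G' 0‖ ≤ r * q) (hconv : ConvexOn ℝ Λ G) (hΛm : MeasurableSet Λ)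
    (hΛ : Metric.closedBall (0 : E) (s * q) ⊆ Λ) (hp : ∀ z ∈ Λ, 0 < p z)
    (hpC : ∀ z ∈ Λ, p z ≤ Real.exp (C * finrank ℝ E) * p 0)
    (hlip : ∀ x ∈ Metric.closedBall (0 : E) (s * q), ∀ z ∈ Metric.closedBall (0 : E) (s * q),
      |Real.log (p z) - Real.log (p x)| ≤ η * ‖z - x‖) (hη : 0 ≤ η)
    {e ρ : ℝ} (he : 0 < e) (he' : e ≤ 1 / 4) (hexp : C + r + 2 - Real.log e ≤ s ^ 2 / 8)
    (hse : 1 / (s - 3 * r) ^ 2 ≤ e) (hρ : 0 < ρ) (hρ' : ρ ≤ 1 / 16)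
    (hτρ : 8 * (τ * (s * q)) ≤ ρ) (hηρ : 4 * η ≤ ρ) :
    ∃ y ∈ Λ, (∀ z ∈ Λ, z ≠ y → G y < G z) ∧ gibbsMeasure Λ G p Set.univ ≠ 0 ∧
      gibbsMeasure Λ G p Set.univ ≠ ∞ ∧ ∀ A, MeasurableSet A →
        |(gibbsMeasure Λ G p).real A / (gibbsMeasure Λ G p).real Set.univ -
          ((stdGaussian E).map (y + ·)).real A| ≤ 18 * ρ + 8 * e := by
  have hq0 : 0 < q := by linarith
  have hsq1 : 1 ≤ s * q := by nlinarith
  have hsq : 0 ≤ s * q := by linarith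
  have hr : 0 ≤ r := by
    by_contra h
    have : r * q < 0 := mul_neg_of_neg_of_pos (not_le.1 h) hq0
    linarith [norm_nonneg (G' 0)]
  have hτ' : τ ≤ 1 / 8 := by nlinarith
  have hη1 : η ≤ 1 := by linarith
  obtain ⟨y, hy, hyn, hy', hmin⟩ := hG.exists_minimizer hτ hτ' hq0 (by linarith) hrs h0 hconv hΛ
  set U := Metric.closedBall (0 : E) (s * q) with hU
  set P := gibbsMeasure Λ G p with hPdef
  have hp0 := hp 0 (hΛ (Metric.mem_closedBall_self hsq))
  have hge := gibbsMeasure_univ_ge hG hτ hτ' hq hd (by linarith) h0 hΛ hp hη1 hlip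
  have hcompl := gibbsMeasure_compl_le_mul_univ hG hτ hτ' hq hd hs hrs h0 hconv hΛm hΛ hp hpC
    hη1 hlip he hexp (by linarith)
  have hP0 : P Set.univ ≠ 0 := by
    refine (lt_of_lt_of_le ?_ hge).ne'
    exact ENNReal.mul_pos (ENNReal.ofReal_pos.2 (by positivity)).ne'
      (Metric.measure_closedBall_pos _ _ hq0).ne'
  have hGc : ContinuousOn G U := fun z hz => (hG.hasFDerivAt z hz).continuousAt.continuousWithinAt
  have hlogLip : LipschitzOnWith η.toNNReal (fun z => Real.log (p z)) U :=
    LipschitzOnWith.of_dist_le_mul fun z hz x hx => by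
      rw [Real.dist_eq, dist_eq_norm, Real.coe_toNNReal _ hη]
      exact hlip x hx z hz
  have hpc : ContinuousOn p U := by
    refine (hlogLip.continuousOn.rexp).congr fun z hz => ?_
    exact (Real.exp_log (hp z (hΛ hz))).symm
  have hPU : P U < ∞ := gibbsMeasure_closedBall_lt_top (by fun_prop) hΛ hp
  have hPUc : P Uᶜ < ∞ := by
    refine (gibbsMeasure_compl_le hG hτ hτ' hq hd hs hrs h0 hconv hΛm hΛ hp hpC).trans_lt ?_
    exact ENNReal.mul_lt_top ENNReal.ofReal_lt_top
      (ENNReal.mul_lt_top ENNReal.ofReal_lt_top measure_closedBall_lt_top)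
  have hPtop : P Set.univ < ∞ := by
    rw [← measure_add_measure_compl (μ := P) (s := U) measurableSet_closedBall]
    exact ENNReal.add_lt_top.2 ⟨hPU, hPUc⟩
  have : IsFiniteMeasure P := ⟨hPtop⟩
  refine ⟨y, hΛ hy, hmin, hP0, hPtop.ne, fun A hA => ?_⟩
  obtain ⟨c, hc, hγ⟩ := exists_shifted_stdGaussian_eq_withDensity E
  set γ := (stdGaussian E).map (y + ·) with hγdef
  have : IsProbabilityMeasure γ := Measure.isProbabilityMeasure_map (by fun_prop)
  -- Up to a constant, the log density of the Gibbs measure with respect to the Gaussian centred at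
  -- `y`. Because G' vanishes at `y`, its Lipschitz constant is only η + 2τsq ≤ ρ/4 + ρ/4.
  let f : E → ℝ := fun z => Real.log (p z) - (G z - ‖z - y‖ ^ 2 / 2)
  have hf : LipschitzOnWith (ρ / 2).toNNReal f U := by
    refine LipschitzOnWith.of_dist_le_mul fun z hz x hx => ?_
    rw [Real.dist_eq, dist_eq_norm, Real.coe_toNNReal _ (by positivity)]
    have h1 := hlip x hx z hz
    have h2 := hG.abs_logRatio_sub_le hτ hy hy' hx hz
    have e1 : f z - f x = (Real.log (p z) - Real.log (p x)) -
      ((G z - ‖z - y‖ ^ 2 / 2) - (G x - ‖x - y‖ ^ 2 / 2)) := by simp only [f]; ring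
    rw [e1]
    refine (abs_sub _ _).trans ?_
    have : (η + 2 * (τ * (s * q))) * ‖z - x‖ ≤ ρ / 2 * ‖z - x‖ := by gcongr; linarith
    linarith
  -- Poincaré needs a global function; its values outside `U` are irrelevant because agreement is
  -- required only on `U`.
  obtain ⟨g, M, hg, hgM, hfg⟩ := exists_bounded_lipschitz_extension hf
  have hgc := hg.continuous
  refine abs_div_sub_le_of_agree (w := fun z => Real.exp (g z / 2)) (C := Real.exp (M / 2))
    (by fun_prop) (fun x => ?_) hρ hρ' ?_ (U := U) measurableSet_closedBall
    (c := 1 / c) (by positivity) he.le he' ?_ ?_ ?_ ?_ hA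
  · rw [Real.abs_exp]
    gcongr
    exact (le_abs_self _).trans (hgM x)
  · refine (integral_sq_exp_half_sub_mean_le_shifted hg hgM y).trans ?_
    rw [Real.coe_toNNReal _ (by positivity)]
    have : 0 ≤ ∫ x, Real.exp (g x / 2) ^ 2 ∂γ := integral_nonneg fun x => by positivity
    gcongr
    nlinarith
  · intro S hS hSU
    refine gibbsMeasure_real_eq hc (hγ y) hΛ (fun z hz => ?_) (by fun_prop) (by positivity) hS hSU
    rw [one_mul, ← hfg hz, ← Real.exp_nat_mul, ← Real.exp_add]
    nth_rewrite 1 [← Real.exp_log (hp z (hΛ hz))]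
    rw [← Real.exp_add]
    congr 1
    simp only [f]
    push_cast
    ring
  · rw [measureReal_def, measureReal_def]
    have := ENNReal.toReal_mono (ENNReal.mul_ne_top ENNReal.ofReal_ne_top hPtop.ne) hcompl
    rwa [ENNReal.toReal_mul, ENNReal.toReal_ofReal he.le] at this
  · have hsr : 3 * r < s := by
      rcases hr.eq_or_lt with h | h <;> linarith
    exact (shifted_stdGaussian_compl_closedBall_le hq0 hd hyn hsr).trans hse
  · exact ENNReal.toReal_pos hP0 hPtop.ne

end LaplaceApproximationTheorem

end

noncomputable section

/-! ### Smoothness of Laplace transforms on an open domain. -/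

section LaplaceTransform

variable {k : ℕ} {μ : Measure (EuclideanSpace ℝ (Fin k))}

local notation "V" => EuclideanSpace ℝ (Fin k)

/-- The norm is at most `k` times the largest coordinate, and one of the two signs gives its
absolute value. The summand 1 covers k = 0. -/
lemma exp_mul_norm_le_sum (a : ℝ) (ha : 0 ≤ a) (y : V) :
    Real.exp (a * ‖y‖) ≤ 1 + ∑ i, (Real.exp (a * k * y i) + Real.exp (-(a * k) * y i)) := by
  have hnn : ∀ i, 0 ≤ Real.exp (a * k * y i) + Real.exp (-(a * k) * y i) := fun i => by positivity
  rcases isEmpty_or_nonempty (Fin k) with h | h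
  · have : y = 0 := Subsingleton.elim _ _
    simp [this]
  obtain ⟨j, hj⟩ := Finite.exists_max fun i => |y i|
  have hnorm : ‖y‖ ≤ k * |y j| := by
    rw [EuclideanSpace.norm_eq]
    have hk : (1 : ℝ) ≤ k := by
      have : 0 < k := Fin.pos j
      exact_mod_cast this
    refine Real.sqrt_le_iff.2 ⟨by positivity, ?_⟩
    calc ∑ i, ‖y i‖ ^ 2 ≤ ∑ _i : Fin k, |y j| ^ 2 := by
          refine Finset.sum_le_sum fun i _ => ?_
          rw [Real.norm_eq_abs]
          exact pow_le_pow_left₀ (abs_nonneg _) (hj i) 2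
      _ = k * |y j| ^ 2 := by simp
      _ ≤ k ^ 2 * |y j| ^ 2 := by gcongr; nlinarith
      _ = _ := by ring
  have h1 : Real.exp (a * ‖y‖) ≤ Real.exp (a * k * y j) + Real.exp (-(a * k) * y j) := by
    have h2 : a * ‖y‖ ≤ a * k * |y j| := by rw [mul_assoc]; gcongr
    rcases abs_cases (y j) with h3 | h3
    · rw [h3.1] at h2
      have := Real.exp_le_exp.2 h2
      have := Real.exp_pos (-(a * k) * y j)
      linarith
    · rw [h3.1] at h2
      have h4 : a * ‖y‖ ≤ -(a * k) * y j := by linarith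
      have := Real.exp_le_exp.2 h4
      have := Real.exp_pos (a * k * y j)
      linarith
  have h2 := Finset.single_le_sum (fun i _ => hnn i) (Finset.mem_univ j)
  linarith

/-- By openness the finitely many perturbations of `ω` along the coordinate axes stay in the domain,
and their exponentials dominate. This gives the room needed to differentiate under the integral. -/
lemma exists_integrable_exp_add_norm (hreg : IsOpen (ExpFam.Omega μ)) {ω : V}
    (hω : ω ∈ ExpFam.Omega μ) :
    ∃ a > 0, Integrable (fun y : V => Real.exp (inner ℝ ω y + a * ‖y‖)) μ := by
  obtain ⟨ε, hε, hball⟩ := Metric.isOpen_iff.1 hreg ω hω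
  have hk : (0 : ℝ) < 2 * (k + 1) := by positivity
  set a := ε / (2 * (k + 1)) with ha
  have ha0 : 0 < a := by positivity
  have hak : |a * k| < ε := by
    rw [abs_of_nonneg (by positivity), ha]
    calc ε / (2 * (k + 1)) * k = ε * (k / (2 * (k + 1))) := by ring
      _ < ε * 1 := by
          gcongr
          rw [div_lt_one hk]
          linarith [(Nat.cast_nonneg k : (0 : ℝ) ≤ k)]
      _ = ε := mul_one _
  have hmem : ∀ (b : ℝ) (i : Fin k), |b| = |a * k| →
      Integrable (fun y : V => Real.exp (inner ℝ ω y + b * y i)) μ := by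
    intro b i hb
    have : ω + EuclideanSpace.single i b ∈ ExpFam.Omega μ := hball (by
      rw [Metric.mem_ball, dist_eq_norm, add_sub_cancel_left, PiLp.norm_single,
        Real.norm_eq_abs, hb]
      exact hak)
    refine Integrable.congr this (ae_of_all _ fun y => ?_)
    simp only [inner_add_left, EuclideanSpace.inner_single_left]
    simp
  refine ⟨a, ha0, ?_⟩
  have hsum : Integrable (fun y : V => Real.exp (inner ℝ ω y) +
      ∑ i, (Real.exp (inner ℝ ω y + a * k * y i) + Real.exp (inner ℝ ω y + -(a * k) * y i))) μ :=
    Integrable.add hω (integrable_finsetSum _ fun i _ =>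
      (hmem _ i rfl).add (hmem _ i (abs_neg _)))
  refine hsum.mono' (by fun_prop) (ae_of_all _ fun y => ?_)
  rw [Real.norm_eq_abs, Real.abs_exp, Real.exp_add]
  have h := exp_mul_norm_le_sum a ha0.le y
  calc Real.exp (inner ℝ ω y) * Real.exp (a * ‖y‖) ≤ Real.exp (inner ℝ ω y) *
        (1 + ∑ i, (Real.exp (a * k * y i) + Real.exp (-(a * k) * y i))) := by gcongr
    _ = _ := by
        rw [mul_add, mul_one, Finset.mul_sum]
        simp_rw [Real.exp_add, mul_add]

/-- Growth slower than every exponential. -/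
def SubexponentialGrowth {F : Type} [NormedAddCommGroup F] (g : V → F) : Prop :=
  ∀ a > 0, ∃ A : ℝ, 0 ≤ A ∧ ∀ y, ‖g y‖ ≤ A * Real.exp (a * ‖y‖)

/-- Differentiating the integral multiplies the integrand by a further factor `y`; closure of the
growth class under this drives the induction in `contDiffOn_integral_exp_smul`. -/
lemma SubexponentialGrowth.smulRight {F : Type} [NormedAddCommGroup F] [NormedSpace ℝ F]
    {g : V → F} (hg : SubexponentialGrowth g) :
    SubexponentialGrowth fun y => (innerSL ℝ y).smulRight (g y) := by
  intro a ha
  obtain ⟨A, hA, h⟩ := hg (a / 2) (by positivity)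
  refine ⟨2 / a * A, by positivity, fun y => ?_⟩
  rw [ContinuousLinearMap.norm_smulRight_apply, innerSL_apply_norm]
  have h1 : ‖y‖ ≤ 2 / a * Real.exp (a / 2 * ‖y‖) := by
    have := Real.add_one_le_exp (a / 2 * ‖y‖)
    rw [div_mul_eq_mul_div, le_div_iff₀ ha]
    nlinarith
  calc ‖y‖ * ‖g y‖ ≤ (2 / a * Real.exp (a / 2 * ‖y‖)) * (A * Real.exp (a / 2 * ‖y‖)) := by
        gcongr; exact h y
    _ = 2 / a * A * (Real.exp (a / 2 * ‖y‖) * Real.exp (a / 2 * ‖y‖)) := by ring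
    _ = _ := by rw [← Real.exp_add]; congr 2; ring

lemma hasFDerivAt_integral_exp_smul (hreg : IsOpen (ExpFam.Omega μ)) {F : Type}
    [NormedAddCommGroup F] [NormedSpace ℝ F] {g : V → F} (hgc : Continuous g)
    (hg : SubexponentialGrowth g) {ω : V} (hω : ω ∈ ExpFam.Omega μ) :
    HasFDerivAt (fun ω : V => ∫ y, Real.exp (inner ℝ ω y) • g y ∂μ)
      (∫ y, Real.exp (inner ℝ ω y) • (innerSL ℝ y).smulRight (g y) ∂μ) ω := by
  obtain ⟨a, ha, hint⟩ := exists_integrable_exp_add_norm hreg hω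
  obtain ⟨A, hA, hgA⟩ := hg a ha
  -- Half of the exponential room pays for moving `ω` within a ball of radius a/2, the other half
  -- for the growth of the derivative.
  obtain ⟨A', hA', hgA'⟩ := hg.smulRight (a / 2) (by positivity)
  have hsr : Continuous fun y : V => (innerSL ℝ y).smulRight (g y) := by fun_prop
  refine hasFDerivAt_integral_of_dominated_of_fderiv_le
    (bound := fun y => A' * Real.exp (inner ℝ ω y + a * ‖y‖))
    (F' := fun ω y => Real.exp (inner ℝ ω y) • (innerSL ℝ y).smulRight (g y))
    (Metric.ball_mem_nhds ω (half_pos ha)) (Eventually.of_forall fun ω' => by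
      exact Continuous.aestronglyMeasurable (by fun_prop)) ?_ ?_ ?_ (hint.const_mul _) ?_
  · refine (hint.const_mul A).mono' (Continuous.aestronglyMeasurable (by fun_prop))
      (ae_of_all _ fun y => ?_)
    rw [norm_smul, Real.norm_eq_abs, Real.abs_exp, Real.exp_add]
    calc _ ≤ Real.exp (inner ℝ ω y) * (A * Real.exp (a * ‖y‖)) := by gcongr; exact hgA y
      _ = _ := by ring
  · exact Continuous.aestronglyMeasurable (by fun_prop)
  · refine ae_of_all _ fun y ω' hω' => ?_
    rw [norm_smul, Real.norm_eq_abs, Real.abs_exp]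
    have h1 : inner ℝ ω' y ≤ inner ℝ ω y + a / 2 * ‖y‖ := by
      have : inner ℝ (ω' - ω) y ≤ ‖ω' - ω‖ * ‖y‖ := real_inner_le_norm _ _
      rw [inner_sub_left] at this
      have h2 : ‖ω' - ω‖ * ‖y‖ ≤ a / 2 * ‖y‖ := by
        gcongr
        rw [Metric.mem_ball, dist_eq_norm] at hω'
        exact hω'.le
      linarith
    calc _ ≤ Real.exp (inner ℝ ω y + a / 2 * ‖y‖) * (A' * Real.exp (a / 2 * ‖y‖)) := by
          gcongr; exact hgA' y
      _ = A' * (Real.exp (inner ℝ ω y + a / 2 * ‖y‖) * Real.exp (a / 2 * ‖y‖)) := by ring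
      _ = _ := by rw [← Real.exp_add]; congr 2; ring
  · refine ae_of_all _ fun y ω' _ => ?_
    have h1 : HasFDerivAt (fun ω : V => inner ℝ ω y) (innerSL ℝ y) ω' := by
      have := (innerSL ℝ y).hasFDerivAt (x := ω')
      refine this.congr_of_eventuallyEq (Eventually.of_forall fun z => ?_)
      simp [innerSL_apply_apply ℝ, real_inner_comm]
    have := h1.exp.smul_const (g y)
    convert! this using 1
    ext v
    simp [smul_smul]

/-- The target space varies in the induction, because the derivative is an integral of the same form
with values in continuous linear maps. -/
lemma contDiffOn_integral_exp_smul (hreg : IsOpen (ExpFam.Omega μ)) (n : ℕ) :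
    ∀ {F : Type} [NormedAddCommGroup F] [NormedSpace ℝ F] {g : V → F}, Continuous g →
      SubexponentialGrowth g →
      ContDiffOn ℝ n (fun ω : V => ∫ y, Real.exp (inner ℝ ω y) • g y ∂μ) (ExpFam.Omega μ) := by
  induction n with
  | zero =>
    intro F _ _ g hgc hg
    rw [Nat.cast_zero, contDiffOn_zero]
    exact fun ω hω =>
      (hasFDerivAt_integral_exp_smul hreg hgc hg hω).continuousAt.continuousWithinAt
  | succ n ih =>
    intro F _ _ g hgc hg
    push_cast
    rw [contDiffOn_succ_iff_hasFDerivWithinAt_of_uniqueDiffOn hreg.uniqueDiffOn]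
    refine ⟨by simp, _, ih (g := fun y => (innerSL ℝ y).smulRight (g y)) (by fun_prop)
      hg.smulRight, fun ω hω => ?_⟩
    exact (hasFDerivAt_integral_exp_smul hreg hgc hg hω).hasFDerivWithinAt

namespace ExpFam

lemma integral_exp_inner_pos (hμ : μ ≠ 0) {ω : V} (hω : ω ∈ Omega μ) :
    0 < ∫ y, Real.exp (inner ℝ ω y) ∂μ := by
  have : NeZero μ := ⟨hμ⟩
  exact integral_exp_pos hω

lemma contDiffOn_psi (hμ : μ ≠ 0) (hreg : IsRegular μ) (n : ℕ) :
    ContDiffOn ℝ n (psi μ) (Omega μ) := by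
  have h := contDiffOn_integral_exp_smul (μ := μ) hreg n (g := fun _ => (1 : ℝ))
    continuous_const fun a ha => ⟨1, zero_le_one, fun y => by
      simp only [norm_one, one_mul]; exact Real.one_le_exp (by positivity)⟩
  simp only [smul_eq_mul, mul_one] at h
  exact h.log fun ω hω => (integral_exp_inner_pos hμ hω).ne'

lemma contDiffAt_psi (hμ : μ ≠ 0) (hreg : IsRegular μ) (n : ℕ) {ω : V} (hω : ω ∈ Omega μ) :
    ContDiffAt ℝ n (psi μ) ω :=
  (contDiffOn_psi hμ hreg n).contDiffAt (hreg.mem_nhds hω)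

end ExpFam

end LaplaceTransform

end

noncomputable section

/-! ### Derivatives along lines; mean, variance and convexity in exponential families. -/

section DirectionalDerivatives

variable {V : Type*} [NormedAddCommGroup V] [NormedSpace ℝ V] {f : V → ℝ} {x : V}

lemma hasDerivAt_comp_line (hf : DifferentiableAt ℝ f x) (v : V) (t : ℝ) (y : V)
    (hx : x = y + t • v) : HasDerivAt (fun t : ℝ => f (y + t • v)) (fderiv ℝ f x v) t := by
  have h1 : HasDerivAt (fun t : ℝ => y + t • v) v t := by
    simpa using ((hasDerivAt_id t).smul_const v).const_add y
  subst hx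
  exact hf.hasFDerivAt.comp_hasDerivAt t h1

lemma eventually_deriv_comp_line (hf : ContDiffAt ℝ 2 f x) (v : V) :
    deriv (fun t : ℝ => f (x + t • v)) =ᶠ[𝓝 0] fun t => fderiv ℝ f (x + t • v) v := by
  have h1 : ∀ᶠ y in 𝓝 x, DifferentiableAt ℝ f y :=
    (hf.eventually (by simp)).mono fun y hy => hy.differentiableAt (by simp)
  have h2 : Tendsto (fun t : ℝ => x + t • v) (𝓝 0) (𝓝 x) := by
    have : Continuous fun t : ℝ => x + t • v := by fun_prop
    simpa using this.tendsto 0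
  filter_upwards [h2.eventually h1] with t ht
  exact (hasDerivAt_comp_line ht v t x rfl).deriv

lemma hasDerivAt_fderiv_comp_line (hf : ContDiffAt ℝ 2 f x) (v : V) (t : ℝ) (y : V)
    (hx : x = y + t • v) : HasDerivAt (fun t : ℝ => fderiv ℝ f (y + t • v) v)
      (iteratedFDeriv ℝ 2 f x fun _ => v) t := by
  have hd : DifferentiableAt ℝ (fderiv ℝ f) x :=
    (hf.fderiv_right (m := 1) (by norm_num)).differentiableAt (by simp)
  have hg : HasFDerivAt (fun z => fderiv ℝ f z v)
      ((ContinuousLinearMap.apply ℝ ℝ v).comp (fderiv ℝ (fderiv ℝ f) x)) x :=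
    (ContinuousLinearMap.apply ℝ ℝ v).hasFDerivAt.comp x hd.hasFDerivAt
  have h := hasDerivAt_comp_line hg.differentiableAt v t y hx
  rw [hg.fderiv] at h
  rw [iteratedFDeriv_two_apply]
  exact h

lemma iteratedDeriv_two_comp_line (hf : ContDiffAt ℝ 2 f x) (v : V) :
    iteratedDeriv 2 (fun t : ℝ => f (x + t • v)) 0 = iteratedFDeriv ℝ 2 f x fun _ => v := by
  rw [iteratedDeriv_succ, iteratedDeriv_one, (eventually_deriv_comp_line hf v).deriv_eq]
  exact (hasDerivAt_fderiv_comp_line hf v 0 x (by simp)).deriv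

end DirectionalDerivatives

namespace ExpFam

variable {k : ℕ} {μ : Measure (EuclideanSpace ℝ (Fin k))}

local notation "V" => EuclideanSpace ℝ (Fin k)

variable (μ) in
/-- The member of the exponential family with natural parameter `ω`. -/
def labelLaw (ω : V) : Measure V :=
  μ.withDensity fun y => ENNReal.ofReal (density μ ω y)

lemma continuous_density (ω : V) : Continuous (density μ ω) := by
  unfold density; fun_prop

lemma exp_psi (hμ : μ ≠ 0) {ω : V} (hω : ω ∈ Omega μ) :
    Real.exp (psi μ ω) = ∫ y, Real.exp (inner ℝ ω y) ∂μ :=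
  Real.exp_log (integral_exp_inner_pos hμ hω)

lemma isProbabilityMeasure_labelLaw (hμ : μ ≠ 0) {ω : V} (hω : ω ∈ Omega μ) :
    IsProbabilityMeasure (labelLaw μ ω) := by
  constructor
  have h1 : ∀ y, density μ ω y = Real.exp (inner ℝ ω y) / Real.exp (psi μ ω) := fun y => by
    rw [density, Real.exp_sub]
  have hint : Integrable (density μ ω) μ := by
    simp_rw [funext h1]; exact Integrable.div_const hω _
  rw [labelLaw, withDensity_apply _ MeasurableSet.univ, Measure.restrict_univ,
    ← ofReal_integral_eq_lintegral_ofReal hint (ae_of_all _ fun y => (Real.exp_pos _).le)]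
  simp_rw [h1]
  rw [integral_div, ← exp_psi hμ hω, div_self (Real.exp_pos _).ne', ENNReal.ofReal_one]

lemma integrable_labelLaw_iff {ω : V} {g : V → ℝ} :
    Integrable g (labelLaw μ ω) ↔ Integrable (fun y => density μ ω y * g y) μ := by
  rw [labelLaw, integrable_withDensity_iff_integrable_smul'
    (continuous_density ω).measurable.ennreal_ofReal (by simp)]
  simp only [smul_eq_mul]
  refine integrable_congr (ae_of_all _ fun y => ?_)
  simp only [ENNReal.toReal_ofReal (show 0 ≤ density μ ω y from (Real.exp_pos _).le)]

lemma mgf_labelLaw (ω v : V) (t : ℝ) :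
    mgf (fun y => inner ℝ v y) (labelLaw μ ω) t =
      (∫ y, Real.exp (inner ℝ (ω + t • v) y) ∂μ) / Real.exp (psi μ ω) := by
  rw [mgf, labelLaw, integral_withDensity_eq_integral_toReal_smul
    (continuous_density ω).measurable.ennreal_ofReal (by simp), ← integral_div]
  congr 1 with y
  rw [ENNReal.toReal_ofReal (show 0 ≤ density μ ω y from (Real.exp_pos _).le), smul_eq_mul, density, Real.exp_sub, inner_add_left,
    real_inner_smul_left, Real.exp_add]
  ring

lemma mem_integrableExpSet_labelLaw_iff {ω v : V} {t : ℝ} :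
    t ∈ integrableExpSet (fun y => inner ℝ v y) (labelLaw μ ω) ↔ ω + t • v ∈ Omega μ := by
  simp only [integrableExpSet, Omega, Set.mem_ofPred_eq, integrable_labelLaw_iff]
  have : ∀ y, density μ ω y * Real.exp (t * inner ℝ v y) =
      Real.exp (inner ℝ (ω + t • v) y) / Real.exp (psi μ ω) := fun y => by
    rw [density, Real.exp_sub, inner_add_left, real_inner_smul_left, Real.exp_add]; ring
  simp_rw [this]
  refine ⟨fun h => ?_, fun h => Integrable.div_const h _⟩
  have := h.mul_const (Real.exp (psi μ ω))
  simpa using this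

lemma tendsto_line (ω v : V) : Tendsto (fun t : ℝ => ω + t • v) (𝓝 0) (𝓝 ω) := by
  have : Continuous fun t : ℝ => ω + t • v := by fun_prop
  simpa using this.tendsto 0

lemma zero_mem_interior_integrableExpSet (hreg : IsRegular μ) {ω : V} (hω : ω ∈ Omega μ) (v : V) :
    (0 : ℝ) ∈ interior (integrableExpSet (fun y => inner ℝ v y) (labelLaw μ ω)) := by
  rw [mem_interior_iff_mem_nhds]
  filter_upwards [(tendsto_line ω v).eventually (hreg.mem_nhds hω)] with t ht
  exact mem_integrableExpSet_labelLaw_iff.2 ht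

/-- Moving `t` tilts the law to the natural parameter ω + t • v. Hence the cumulants of ⟨v, Y⟩ are
the directional derivatives of ψ. -/
lemma cgf_labelLaw_eventuallyEq (hμ : μ ≠ 0) (hreg : IsRegular μ) {ω : V} (hω : ω ∈ Omega μ)
    (v : V) : cgf (fun y => inner ℝ v y) (labelLaw μ ω) =ᶠ[𝓝 0]
      fun t => psi μ (ω + t • v) - psi μ ω := by
  filter_upwards [(tendsto_line ω v).eventually (hreg.mem_nhds hω)] with t ht
  rw [cgf, mgf_labelLaw, Real.log_div (integral_exp_inner_pos hμ ht).ne' (Real.exp_pos _).ne',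
    Real.log_exp]
  rfl

lemma memLp_inner_labelLaw (hreg : IsRegular μ) {ω : V} (hω : ω ∈ Omega μ)
    (v : V) : MemLp (fun y => inner ℝ v y) 2 (labelLaw μ ω) :=
  memLp_of_mem_interior_integrableExpSet (zero_mem_interior_integrableExpSet hreg hω v) 2

/-- The mean of `⟨v, Y⟩` is the derivative of `ψ` in direction `v`. -/
lemma integral_inner_labelLaw (hμ : μ ≠ 0) (hreg : IsRegular μ) {ω : V} (hω : ω ∈ Omega μ)
    (v : V) : ∫ y, inner ℝ v y ∂(labelLaw μ ω) = fderiv ℝ (psi μ) ω v := by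
  have := isProbabilityMeasure_labelLaw hμ hω
  have h1 := deriv_cgf_zero (zero_mem_interior_integrableExpSet hreg hω v)
  rw [(cgf_labelLaw_eventuallyEq hμ hreg hω v).deriv_eq, deriv_sub_const,
    (hasDerivAt_comp_line ((contDiffAt_psi hμ hreg 1 hω).differentiableAt (by simp)) v 0 ω
      (by simp)).deriv] at h1
  simpa using h1.symm

/-- The variance of `⟨v, Y⟩` is the second derivative of `ψ` in direction `v`. -/
lemma variance_inner_labelLaw (hμ : μ ≠ 0) (hreg : IsRegular μ) {ω : V} (hω : ω ∈ Omega μ)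
    (v : V) : Var[fun y => inner ℝ v y; labelLaw μ ω] =
      iteratedFDeriv ℝ 2 (psi μ) ω fun _ => v := by
  have := isProbabilityMeasure_labelLaw hμ hω
  have h0 := zero_mem_interior_integrableExpSet hreg hω v
  have h1 := variance_tilted_mul h0
  simp only [zero_mul] at h1
  rw [tilted_const, (cgf_labelLaw_eventuallyEq hμ hreg hω v).iteratedDeriv_eq] at h1
  rw [← iteratedDeriv_two_comp_line (contDiffAt_psi hμ hreg 2 hω)]
  refine Eq.trans ?_ (h1.trans ?_)
  · simp
  simp [iteratedDeriv_succ]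

lemma iteratedFDeriv_two_psi_nonneg (hμ : μ ≠ 0) (hreg : IsRegular μ) {ω : V} (hω : ω ∈ Omega μ)
    (v : V) : 0 ≤ iteratedFDeriv ℝ 2 (psi μ) ω fun _ => v := by
  rw [← variance_inner_labelLaw hμ hreg hω]
  exact variance_nonneg _ _

/-- Zero variance makes ⟨v, y⟩ almost surely constant; the density is positive, so this holds for
the base measure too, against minimality. -/
lemma iteratedFDeriv_two_psi_pos (hμ : μ ≠ 0) (hreg : IsRegular μ) (hmin : IsMinimal μ) {ω : V}
    (hω : ω ∈ Omega μ) {v : V} (hv : v ≠ 0) : 0 < iteratedFDeriv ℝ 2 (psi μ) ω fun _ => v := by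
  refine lt_of_le_of_ne (iteratedFDeriv_two_psi_nonneg hμ hreg hω v) fun h => ?_
  rw [← variance_inner_labelLaw hμ hreg hω] at h
  have := isProbabilityMeasure_labelLaw hμ hω
  have h1 := ae_eq_integral_of_variance_eq_zero (memLp_inner_labelLaw hreg hω v) h.symm
  refine hmin v hv (∫ x, inner ℝ v x ∂(labelLaw μ ω)) ?_
  rw [labelLaw, ae_withDensity_iff
    (continuous_density ω).measurable.ennreal_ofReal] at h1
  filter_upwards [h1] with y hy
  exact hy (ENNReal.ofReal_pos.2 (Real.exp_pos _)).ne'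

lemma convex_Omega : Convex ℝ (Omega μ) := by
  intro x hx y hy a b ha hb hab
  refine Integrable.mono' ((Integrable.const_mul hx a).add (Integrable.const_mul hy b))
    (Continuous.aestronglyMeasurable (by fun_prop)) (ae_of_all _ fun z => ?_)
  rw [Real.norm_eq_abs, Real.abs_exp, inner_add_left, real_inner_smul_left, real_inner_smul_left]
  exact convexOn_exp.2 (Set.mem_univ _) (Set.mem_univ _) ha hb hab

lemma convexOn_psi (hμ : μ ≠ 0) (hreg : IsRegular μ) : ConvexOn ℝ (Omega μ) (psi μ) := by
  refine ⟨convex_Omega, fun x hx y hy a b ha hb hab => ?_⟩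
  let g : ℝ → ℝ := fun t => psi μ (x + t • (y - x))
  have hmem : ∀ t ∈ Set.Icc (0 : ℝ) 1, x + t • (y - x) ∈ Omega μ := fun t ht =>
    convex_Omega.add_smul_sub_mem hx hy ht
  have hd : ∀ t ∈ Set.Icc (0 : ℝ) 1, HasDerivAt g (fderiv ℝ (psi μ) (x + t • (y - x)) (y - x)) t :=
    fun t ht => hasDerivAt_comp_line
      ((contDiffAt_psi hμ hreg 1 (hmem t ht)).differentiableAt (by simp)) _ t x rfl
  have hconv : ConvexOn ℝ (Set.Icc (0 : ℝ) 1) g := by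
    refine convexOn_of_hasDerivWithinAt2_nonneg (convex_Icc 0 1)
      (f' := fun t => fderiv ℝ (psi μ) (x + t • (y - x)) (y - x))
      (f'' := fun t => iteratedFDeriv ℝ 2 (psi μ) (x + t • (y - x)) fun _ => y - x)
      (fun t ht => (hd t ht).continuousAt.continuousWithinAt)
      (fun t ht => (hd t (interior_subset ht)).hasDerivWithinAt) (fun t ht => ?_)
      (fun t ht => iteratedFDeriv_two_psi_nonneg hμ hreg (hmem t (interior_subset ht)) _)
    exact (hasDerivAt_fderiv_comp_line
      (contDiffAt_psi hμ hreg 2 (hmem t (interior_subset ht))) _ t x rfl).hasDerivWithinAt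
  have h := hconv.2 (Set.left_mem_Icc.2 zero_le_one) (Set.right_mem_Icc.2 zero_le_one) ha hb hab
  have hb' : a = 1 - b := by linarith
  simp only [g, smul_eq_mul, mul_zero, mul_one, zero_add, zero_smul, add_zero, one_smul,
    add_sub_cancel] at h
  convert! h using 2
  rw [hb']
  module

end ExpFam

end

noncomputable section

set_option maxSynthPendingDepth 3

/-! ### From a third derivative bound on the diagonal to near-quadraticity. -/

section ThirdDerivative

variable {E : Type*} [NormedAddCommGroup E] [NormedSpace ℝ E]

/-- Polarization: a symmetric trilinear form bounded on the diagonal is bounded. -/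
lemma norm_le_of_symmetric_of_cube_le {T : E →L[ℝ] E →L[ℝ] E →L[ℝ] ℝ} {κ : ℝ} (hκ : 0 ≤ κ)
    (h12 : ∀ a b c, T a b c = T b a c) (h23 : ∀ a b c, T a b c = T a c b)
    (hT : ∀ u, T u u u ≤ κ * ‖u‖ ^ 3) (a : E) : ‖T a‖ ≤ 5 * κ * ‖a‖ := by
  have habs : ∀ u, |T u u u| ≤ κ * ‖u‖ ^ 3 := fun u => by
    rw [abs_le]
    have h := hT (-u)
    simp only [map_neg, neg_apply, neg_neg, norm_neg] at h
    exact ⟨by linarith, hT u⟩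
  have hunit : ∀ a b c : E, ‖a‖ = 1 → ‖b‖ = 1 → ‖c‖ = 1 → |T a b c| ≤ 5 * κ := by
    intro a b c ha hb hc
    -- Each of the four cubes is at most 27κ for unit vectors, so the bound is 4·27/24·κ = 4.5κ,
    -- rounded up to 5κ.
    have hpol : 24 * T a b c = T (a + b + c) (a + b + c) (a + b + c)
        - T (a + b - c) (a + b - c) (a + b - c) - T (a - b + c) (a - b + c) (a - b + c)
        - T (-a + b + c) (-a + b + c) (-a + b + c) := by
      simp only [map_add, map_sub, map_neg, add_apply,
        sub_apply, neg_apply]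
      have e1 : T a c b = T a b c := (h23 _ _ _).symm
      have e2 : T b a c = T a b c := (h12 _ _ _).symm
      have e3 : T b c a = T a b c := by rw [← h23 b a c, e2]
      have e4 : T c a b = T a b c := by rw [← h12 a c b, e1]
      have e5 : T c b a = T a b c := by rw [← h23 c a b, e4]
      rw [e1, e2, e3, e4, e5]
      ring
    have hn : ∀ u : E, ‖u‖ ≤ 3 → |T u u u| ≤ 27 * κ := fun u hu => by
      refine (habs u).trans ?_
      have : ‖u‖ ^ 3 ≤ 3 ^ 3 := pow_le_pow_left₀ (norm_nonneg _) hu 3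
      nlinarith
    have n1 : ‖a + b + c‖ ≤ 3 := (norm_add₃_le).trans (by rw [ha, hb, hc]; norm_num)
    have n2 : ‖a + b - c‖ ≤ 3 := by
      rw [sub_eq_add_neg]; exact (norm_add₃_le).trans (by rw [norm_neg, ha, hb, hc]; norm_num)
    have n3 : ‖a - b + c‖ ≤ 3 := by
      rw [sub_eq_add_neg]; exact (norm_add₃_le).trans (by rw [norm_neg, ha, hb, hc]; norm_num)
    have n4 : ‖-a + b + c‖ ≤ 3 := (norm_add₃_le).trans (by rw [norm_neg, ha, hb, hc]; norm_num)
    have m1 := abs_le.1 (hn _ n1)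
    have m2 := abs_le.1 (hn _ n2)
    have m3 := abs_le.1 (hn _ n3)
    have m4 := abs_le.1 (hn _ n4)
    rw [abs_le]
    constructor <;> linarith [m1.1, m1.2, m2.1, m2.2, m3.1, m3.2, m4.1, m4.2]
  have hall : ∀ a b c : E, |T a b c| ≤ 5 * κ * ‖a‖ * ‖b‖ * ‖c‖ := by
    intro a b c
    rcases eq_or_ne a 0 with rfl | ha
    · simp
    rcases eq_or_ne b 0 with rfl | hb
    · simp
    rcases eq_or_ne c 0 with rfl | hc
    · simp
    have hu : ∀ u : E, u ≠ 0 → ‖‖u‖⁻¹ • u‖ = 1 := fun u hu => by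
      rw [norm_smul, norm_inv, norm_norm, inv_mul_cancel₀ (norm_ne_zero_iff.2 hu)]
    have h := hunit _ _ _ (hu a ha) (hu b hb) (hu c hc)
    simp only [map_smul, smul_apply, smul_eq_mul] at h
    have ha' := norm_pos_iff.2 ha
    have hb' := norm_pos_iff.2 hb
    have hc' := norm_pos_iff.2 hc
    rw [abs_mul, abs_mul, abs_mul, abs_of_pos (inv_pos.2 ha'), abs_of_pos (inv_pos.2 hb'),
      abs_of_pos (inv_pos.2 hc')] at h
    field_simp at h
    linarith
  refine ContinuousLinearMap.opNorm_le_bound₂ _ (by positivity) fun b c => ?_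
  exact hall a b c

variable {J : E → ℝ} {z : E}

lemma iteratedFDeriv_three_apply (m : Fin 3 → E) :
    iteratedFDeriv ℝ 3 J z m = fderiv ℝ (fderiv ℝ (fderiv ℝ J)) z (m 0) (m 1) (m 2) := by
  rw [iteratedFDeriv_succ_apply_right, iteratedFDeriv_two_apply]
  rfl

lemma contDiffAt_fderiv (hJ : ContDiffAt ℝ 3 J z) : ContDiffAt ℝ 2 (fderiv ℝ J) z :=
  hJ.fderiv_right (by norm_num)

lemma fderiv_three_swap_left (hJ : ContDiffAt ℝ 3 J z) (a b c : E) :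
    fderiv ℝ (fderiv ℝ (fderiv ℝ J)) z a b c = fderiv ℝ (fderiv ℝ (fderiv ℝ J)) z b a c := by
  rw [((contDiffAt_fderiv hJ).isSymmSndFDerivAt (by simp)).eq a b]

/-- The Hessian is symmetric in a whole neighbourhood of `z`, so its derivative inherits the
symmetry. -/
lemma fderiv_three_swap_right (hJ : ContDiffAt ℝ 3 J z) (a b c : E) :
    fderiv ℝ (fderiv ℝ (fderiv ℝ J)) z a b c = fderiv ℝ (fderiv ℝ (fderiv ℝ J)) z a c b := by
  have hd : HasFDerivAt (fderiv ℝ (fderiv ℝ J)) (fderiv ℝ (fderiv ℝ (fderiv ℝ J)) z) z :=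
    (((contDiffAt_fderiv hJ).fderiv_right (m := 1) (by norm_num)).differentiableAt
      (by simp)).hasFDerivAt
  have happ : ∀ b c : E, HasFDerivAt (fun y => fderiv ℝ (fderiv ℝ J) y b c)
      ((ContinuousLinearMap.apply ℝ ℝ c).comp ((ContinuousLinearMap.apply ℝ (E →L[ℝ] ℝ) b).comp
        (fderiv ℝ (fderiv ℝ (fderiv ℝ J)) z))) z := fun b c => by
    have h1 : HasFDerivAt (fun y => fderiv ℝ (fderiv ℝ J) y b)
        ((ContinuousLinearMap.apply ℝ (E →L[ℝ] ℝ) b).comp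
          (fderiv ℝ (fderiv ℝ (fderiv ℝ J)) z)) z :=
      (ContinuousLinearMap.apply ℝ (E →L[ℝ] ℝ) b).hasFDerivAt.comp z hd
    exact (ContinuousLinearMap.apply ℝ ℝ c).hasFDerivAt.comp z h1
  have hev : (fun y => fderiv ℝ (fderiv ℝ J) y b c) =ᶠ[𝓝 z]
      fun y => fderiv ℝ (fderiv ℝ J) y c b := by
    have h3 : ∀ᶠ y in 𝓝 z, ContDiffAt ℝ 3 J y := hJ.eventually (by simp)
    filter_upwards [h3] with y hy
    exact ((hy.of_le (by norm_num : (2 : WithTop ℕ∞) ≤ 3)).isSymmSndFDerivAt (by simp)).eq b c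
  have := (happ b c).unique ((happ c b).congr_of_eventuallyEq hev)
  simpa using congrArg (fun L : E →L[ℝ] ℝ => L a) this

lemma norm_fderiv_two_sub_le {R κ : ℝ} (hR : 0 ≤ R) (hκ : 0 ≤ κ)
    (hJ : ∀ z ∈ Metric.closedBall (0 : E) R, ContDiffAt ℝ 3 J z)
    (h3 : ∀ z ∈ Metric.closedBall (0 : E) R, ∀ u,
      iteratedFDeriv ℝ 3 J z (fun _ => u) ≤ κ * ‖u‖ ^ 3)
    (hz : z ∈ Metric.closedBall (0 : E) R) :
    ‖fderiv ℝ (fderiv ℝ J) z - fderiv ℝ (fderiv ℝ J) 0‖ ≤ 5 * κ * R := by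
  have hdd : ∀ z ∈ Metric.closedBall (0 : E) R, HasFDerivAt (fderiv ℝ (fderiv ℝ J))
      (fderiv ℝ (fderiv ℝ (fderiv ℝ J)) z) z := fun z hz =>
    (((contDiffAt_fderiv (hJ z hz)).fderiv_right (m := 1) (by norm_num)).differentiableAt
      (by simp)).hasFDerivAt
  have hbound : ∀ z ∈ Metric.closedBall (0 : E) R,
      ‖fderiv ℝ (fderiv ℝ (fderiv ℝ J)) z‖ ≤ 5 * κ := fun z hz =>
    ContinuousLinearMap.opNorm_le_bound _ (by positivity) fun a =>
      norm_le_of_symmetric_of_cube_le hκ (fderiv_three_swap_left (hJ z hz))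
        (fderiv_three_swap_right (hJ z hz)) (fun u => by
          have := h3 z hz u
          rwa [iteratedFDeriv_three_apply] at this) a
  have := (convex_closedBall (0 : E) R).norm_image_sub_le_of_norm_hasFDerivWithin_le
    (fun x hx => (hdd x hx).hasFDerivWithinAt) hbound (Metric.mem_closedBall_self hR) hz
  refine this.trans ?_
  have := mem_closedBall_zero_iff.1 hz
  rw [sub_zero]
  gcongr

end ThirdDerivative

section NearlyQuadraticOfThird

variable {E : Type*} [NormedAddCommGroup E] [InnerProductSpace ℝ E]

/-- A function whose Hessian at the origin is the identity and whose third derivative is small on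
a ball is nearly quadratic there. -/
lemma nearlyQuadratic_of_third_derivative_le {J : E → ℝ} {R κ : ℝ} (hR : 0 ≤ R) (hκ : 0 ≤ κ)
    (hJ : ∀ z ∈ Metric.closedBall (0 : E) R, ContDiffAt ℝ 3 J z)
    (h2 : ∀ u, iteratedFDeriv ℝ 2 J 0 (fun _ => u) = ‖u‖ ^ 2)
    (h3 : ∀ z ∈ Metric.closedBall (0 : E) R, ∀ u,
      iteratedFDeriv ℝ 3 J z (fun _ => u) ≤ κ * ‖u‖ ^ 3) :
    NearlyQuadratic J (fderiv ℝ J) R (5 * κ * R) := by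
  have h0 : (0 : E) ∈ Metric.closedBall (0 : E) R := Metric.mem_closedBall_self hR
  have hid : ∀ a, fderiv ℝ (fderiv ℝ J) 0 a = innerSL ℝ a := by
    have hs : ∀ a b, fderiv ℝ (fderiv ℝ J) 0 a b = fderiv ℝ (fderiv ℝ J) 0 b a := fun a b =>
      (((hJ 0 h0).of_le (by norm_num : (2 : WithTop ℕ∞) ≤ 3)).isSymmSndFDerivAt (by simp)).eq a b
    have hq : ∀ u, fderiv ℝ (fderiv ℝ J) 0 u u = ‖u‖ ^ 2 := fun u => by
      rw [← h2 u, iteratedFDeriv_two_apply]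
    intro a
    ext b
    have e1 := hq (a + b)
    simp only [map_add, add_apply] at e1
    rw [hq, hq, hs b a, norm_add_sq_real] at e1
    rw [innerSL_apply_apply ℝ]
    linarith
  refine ⟨fun z hz => ((hJ z hz).differentiableAt (by simp)).hasFDerivAt, fun z hz y hy => ?_⟩
  have hd : ∀ x ∈ Metric.closedBall (0 : E) R,
      HasFDerivAt (fun x => fderiv ℝ J x - fderiv ℝ (fderiv ℝ J) 0 x)
        (fderiv ℝ (fderiv ℝ J) x - fderiv ℝ (fderiv ℝ J) 0) x := fun x hx =>
    ((contDiffAt_fderiv (hJ x hx)).differentiableAt (by simp)).hasFDerivAt.sub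
      (fderiv ℝ (fderiv ℝ J) 0).hasFDerivAt
  have := (convex_closedBall (0 : E) R).norm_image_sub_le_of_norm_hasFDerivWithin_le
    (fun x hx => (hd x hx).hasFDerivWithinAt)
    (fun x hx => norm_fderiv_two_sub_le hR hκ hJ h3 hx) hy hz
  rw [← hid, map_sub]
  convert! this using 2
  abel

end NearlyQuadraticOfThird

section AffineComposition

variable {E F : Type*} [NormedAddCommGroup E] [NormedSpace ℝ E] [NormedAddCommGroup F]
  [NormedSpace ℝ F]

lemma iteratedFDeriv_comp_affine {f : F → ℝ} {s : Set F} (hs : IsOpen s) {n : ℕ}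
    (hf : ContDiffOn ℝ n f s) (ω : F) (L : E →L[ℝ] F) {z : E} (hz : ω + L z ∈ s) (m : Fin n → E) :
    iteratedFDeriv ℝ n (fun z => f (ω + L z)) z m =
      iteratedFDeriv ℝ n f (ω + L z) fun i => L (m i) := by
  set s' : Set F := (fun y => ω + y) ⁻¹' s with hs'
  have hs'o : IsOpen s' := hs.preimage (by fun_prop)
  have hf' : ContDiffOn ℝ n (fun y => f (ω + y)) s' :=
    hf.comp (contDiff_const.add contDiff_id).contDiffOn fun y hy => hy
  have hzs : L z ∈ s' := hz
  have hpre : IsOpen (L ⁻¹' s') := hs'o.preimage L.continuous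
  have h := L.iteratedFDerivWithin_comp_right hf' hs'o.uniqueDiffOn hpre.uniqueDiffOn hzs le_rfl
  rw [iteratedFDerivWithin_of_isOpen n hpre hzs, iteratedFDerivWithin_of_isOpen n hs'o hzs,
    iteratedFDeriv_comp_add_left] at h
  have h2 := congrArg (fun T => T m) h
  simpa [Function.comp_def] using h2

end AffineComposition

end

noncomputable section

/-! ### Whitening and positivity of the Fisher information. -/

section Whitening

open scoped MatrixOrder

variable {d : ℕ} {A : Matrix (Fin d) (Fin d) ℝ}

lemma sqrt_inv_mul_mul_sqrt_inv (hA : A.PosDef) :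
    CFC.sqrt A⁻¹ * A * CFC.sqrt A⁻¹ = 1 := by
  have hS : CFC.sqrt A⁻¹ * CFC.sqrt A⁻¹ = A⁻¹ :=
    CFC.sqrt_mul_sqrt_self _ hA.inv.posSemidef.nonneg
  have h1 : CFC.sqrt A⁻¹ * (CFC.sqrt A⁻¹ * A) = 1 := by
    rw [← mul_assoc, hS, Matrix.nonsing_inv_mul _ ((Matrix.isUnit_iff_isUnit_det _).1 hA.isUnit)]
  exact mul_eq_one_comm.1 h1

lemma transpose_sqrt_inv (A : Matrix (Fin d) (Fin d) ℝ) : (CFC.sqrt A⁻¹)ᵀ = CFC.sqrt A⁻¹ := by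
  have := (CFC.sqrt_nonneg A⁻¹).isSelfAdjoint.star_eq
  rwa [Matrix.star_eq_conjTranspose, Matrix.conjTranspose_eq_transpose_of_trivial] at this

/-- The linear map `A^{-1/2}`. -/
def whiten (A : Matrix (Fin d) (Fin d) ℝ) :
    EuclideanSpace ℝ (Fin d) →L[ℝ] EuclideanSpace ℝ (Fin d) :=
  Matrix.toEuclideanCLM (𝕜 := ℝ) (CFC.sqrt A⁻¹)

lemma dotProduct_whiten (hA : A.PosDef) (z : EuclideanSpace ℝ (Fin d)) :
    (whiten A z).ofLp ⬝ᵥ A *ᵥ (whiten A z).ofLp = ‖z‖ ^ 2 := by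
  have h1 : (whiten A z).ofLp = CFC.sqrt A⁻¹ *ᵥ z.ofLp := rfl
  rw [h1, Matrix.mulVec_mulVec, Matrix.dotProduct_mulVec, ← Matrix.mulVec_transpose,
    Matrix.mulVec_mulVec, Matrix.transpose_mul, transpose_sqrt_inv, mul_assoc,
    ← Matrix.conjTranspose_eq_transpose_of_trivial A, hA.isHermitian.eq, ← mul_assoc,
    sqrt_inv_mul_mul_sqrt_inv hA, Matrix.one_mulVec, EuclideanSpace.real_norm_sq_eq]
  simp [dotProduct, sq]

/-- The linear map `A^{1/2}`, inverse to `whiten A`. -/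
def unwhiten (A : Matrix (Fin d) (Fin d) ℝ) :
    EuclideanSpace ℝ (Fin d) →L[ℝ] EuclideanSpace ℝ (Fin d) :=
  Matrix.toEuclideanCLM (𝕜 := ℝ) (CFC.sqrt A⁻¹ * A)

lemma unwhiten_whiten (hA : A.PosDef) (z : EuclideanSpace ℝ (Fin d)) :
    unwhiten A (whiten A z) = z := by
  rw [unwhiten, whiten, ← mul_apply_eq_comp, ← map_mul,
    sqrt_inv_mul_mul_sqrt_inv hA, map_one]
  rfl

lemma whiten_unwhiten (hA : A.PosDef) (z : EuclideanSpace ℝ (Fin d)) :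
    whiten A (unwhiten A z) = z := by
  rw [unwhiten, whiten, ← mul_apply_eq_comp, ← map_mul,
    mul_eq_one_comm.1 (sqrt_inv_mul_mul_sqrt_inv hA), map_one]
  rfl

end Whitening

lemma dotProduct_hessian_mulVec {k : ℕ} (f : EuclideanSpace ℝ (Fin k) → ℝ)
    (x v w : EuclideanSpace ℝ (Fin k)) :
    v.ofLp ⬝ᵥ hessian f x *ᵥ w.ofLp = fderiv ℝ (fderiv ℝ f) x v w := by
  have hexp : ∀ u : EuclideanSpace ℝ (Fin k), u = ∑ a, u a • EuclideanSpace.single a (1 : ℝ) :=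
    fun u => by
      have := (EuclideanSpace.basisFun (Fin k) ℝ).sum_repr u
      simpa using this.symm
  conv_rhs => rw [hexp v, hexp w]
  simp only [map_sum, map_smul, sum_apply, smul_apply,
    smul_eq_mul, dotProduct, Matrix.mulVec, hessian, Matrix.of_apply, iteratedFDeriv_two_apply,
    Matrix.cons_val_zero, Matrix.cons_val_one, Finset.mul_sum]
  rw [Finset.sum_comm]
  exact Finset.sum_congr rfl fun a _ => Finset.sum_congr rfl fun b _ => by ring

namespace GLM

variable {n d k : ℕ} (M : GLM n d k)

local notation "Param" => EuclideanSpace ℝ (Fin d)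

/-- The linear predictor as a continuous linear map. -/
def predL (i : Fin n) : EuclideanSpace ℝ (Fin d) →L[ℝ] EuclideanSpace ℝ (Fin k) :=
  LinearMap.toContinuousLinearMap (Matrix.toEuclideanLin (M.X i)ᵀ)

@[simp] lemma predL_apply (i : Fin n) (θ : Param) : M.predL i θ = M.pred i θ := rfl

lemma pred_add (i : Fin n) (θ η : Param) : M.pred i (θ + η) = M.pred i θ + M.pred i η :=
  map_add _ _ _

/-- A vector killed by every X_iᵀ is orthogonal to all columns, hence to the whole space. -/
lemma exists_pred_ne_zero
    (hspan : Submodule.span ℝ (Set.range fun p : Fin n × Fin k => (M.X p.1).col p.2) = ⊤)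
    {u : Param} (hu : u ≠ 0) : ∃ i, M.pred i u ≠ 0 := by
  by_contra! h
  let φ : (Fin d → ℝ) →ₗ[ℝ] ℝ := dotProductBilin ℝ ℝ u.ofLp
  have hφ : φ = 0 := by
    refine LinearMap.ext_on_range (v := fun p : Fin n × Fin k => (M.X p.1).col p.2) hspan ?_
    rintro ⟨i, j⟩
    have := congrArg (fun v : EuclideanSpace ℝ (Fin k) => v j) (h i)
    simp only [pred, Matrix.toLpLin_apply, Matrix.mulVec, PiLp.zero_apply] at this
    simp only [φ, LinearMap.zero_apply]
    rw [← this]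
    change u.ofLp ⬝ᵥ _ = _
    rw [dotProduct_comm]
    rfl
  apply hu
  have : u.ofLp ⬝ᵥ u.ofLp = 0 := congrArg (fun f => f u.ofLp) hφ
  rw [dotProduct_self_eq_zero] at this
  ext i
  exact congrFun this i

lemma dotProduct_fisher_mulVec (u v : Param) :
    u.ofLp ⬝ᵥ M.fisher *ᵥ v.ofLp = (n : ℝ)⁻¹ * ∑ i,
      fderiv ℝ (fderiv ℝ (ExpFam.psi M.base)) (M.pred i M.truth) (M.pred i u) (M.pred i v) := by
  rw [fisher, Matrix.smul_mulVec, dotProduct_smul, smul_eq_mul, Matrix.sum_mulVec,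
    dotProduct_sum]
  congr 1
  refine Finset.sum_congr rfl fun i _ => ?_
  rw [← dotProduct_hessian_mulVec, ← Matrix.mulVec_mulVec, ← Matrix.mulVec_mulVec,
    Matrix.dotProduct_mulVec, ← Matrix.mulVec_transpose]
  rfl

lemma dotProduct_fisher_mulVec_self (u : Param) :
    u.ofLp ⬝ᵥ M.fisher *ᵥ u.ofLp = (n : ℝ)⁻¹ * ∑ i,
      iteratedFDeriv ℝ 2 (ExpFam.psi M.base) (M.pred i M.truth) fun _ => M.pred i u := by
  simp_rw [dotProduct_fisher_mulVec, iteratedFDeriv_two_apply]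

/-- The standing assumptions on a model with `n` observations. -/
structure Regular : Prop where
  n_pos : 0 < n
  d_pos : 0 < d
  isRegular : ExpFam.IsRegular M.base
  isMinimal : ExpFam.IsMinimal M.base
  truth_mem : M.truth ∈ M.Theta
  span_eq_top :
    Submodule.span ℝ (Set.range fun p : Fin n × Fin k => (M.X p.1).col p.2) = ⊤
  prior_pos : ∀ θ ∈ M.Theta, 0 < M.prior θ

variable {M}

namespace Regular

variable (hM : M.Regular)
include hM

lemma base_ne_zero : M.base ≠ 0 := by
  intro h
  have hd := hM.d_pos
  -- A nonzero label direction is needed to contradict minimality; d > 0 and the spanning condition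
  -- provide one.
  obtain ⟨i, hi⟩ := M.exists_pred_ne_zero hM.span_eq_top
    (u := EuclideanSpace.single (⟨0, hd⟩ : Fin d) (1 : ℝ)) (by simp)
  exact hM.isMinimal _ hi 0 (by simp [h])

lemma isOpen_Theta : IsOpen M.Theta := by
  have : M.Theta = ⋂ i, M.predL i ⁻¹' ExpFam.Omega M.base := by
    ext θ; simp [Theta]
  rw [this]
  exact isOpen_iInter_of_finite fun i => hM.isRegular.preimage (M.predL i).continuous

omit hM in
lemma _root_.GLM.convex_Theta : Convex ℝ M.Theta := by
  have : M.Theta = ⋂ i, M.predL i ⁻¹' ExpFam.Omega M.base := by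
    ext θ; simp [Theta]
  rw [this]
  exact convex_iInter fun i => ExpFam.convex_Omega.linear_preimage (M.predL i).toLinearMap

lemma dotProduct_fisher_pos {u : Param} (hu : u ≠ 0) : 0 < u.ofLp ⬝ᵥ M.fisher *ᵥ u.ofLp := by
  rw [dotProduct_fisher_mulVec_self]
  have hn : (0 : ℝ) < n := by exact_mod_cast hM.n_pos
  obtain ⟨i, hi⟩ := M.exists_pred_ne_zero hM.span_eq_top hu
  refine mul_pos (inv_pos.2 hn) (Finset.sum_pos' (fun j _ => ?_) ⟨i, Finset.mem_univ _, ?_⟩)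
  · exact ExpFam.iteratedFDeriv_two_psi_nonneg hM.base_ne_zero hM.isRegular (hM.truth_mem j) _
  · exact ExpFam.iteratedFDeriv_two_psi_pos hM.base_ne_zero hM.isRegular hM.isMinimal
      (hM.truth_mem i) hi

lemma posDef_fisher : M.fisher.PosDef := by
  refine Matrix.PosDef.of_dotProduct_mulVec_pos ?_ fun x hx => ?_
  · rw [Matrix.IsHermitian, Matrix.conjTranspose_eq_transpose_of_trivial]
    have h : ∀ u v : Param, u.ofLp ⬝ᵥ M.fisher *ᵥ v.ofLp = v.ofLp ⬝ᵥ M.fisher *ᵥ u.ofLp := by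
      intro u v
      simp_rw [dotProduct_fisher_mulVec]
      congr 1
      refine Finset.sum_congr rfl fun i _ => ?_
      exact ((ExpFam.contDiffAt_psi hM.base_ne_zero hM.isRegular 2
        (hM.truth_mem i)).isSymmSndFDerivAt (by simp)).eq _ _
    ext a b
    have := h (EuclideanSpace.single b 1) (EuclideanSpace.single a 1)
    simpa using this
  · have := hM.dotProduct_fisher_pos (u := WithLp.toLp 2 x) (by simpa using hx)
    simpa using this

lemma posDef_smul_fisher : ((n : ℝ) • M.fisher).PosDef :=
  hM.posDef_fisher.smul (by exact_mod_cast hM.n_pos)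

/-- Whitening uses n F*, while the norm uses F*; the factor √n is the one that turns the radius
s√(d/n) into s√d. -/
lemma wnorm_whiten (z : Param) :
    wnorm M.fisher (whiten ((n : ℝ) • M.fisher) z) = ‖z‖ / √n := by
  have hn : (0 : ℝ) < n := by exact_mod_cast hM.n_pos
  have h := dotProduct_whiten hM.posDef_smul_fisher z
  rw [Matrix.smul_mulVec, dotProduct_smul, smul_eq_mul] at h
  have h2 : (whiten ((n : ℝ) • M.fisher) z).ofLp ⬝ᵥ
      M.fisher *ᵥ (whiten ((n : ℝ) • M.fisher) z).ofLp = ‖z‖ ^ 2 / n := by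
    rw [eq_div_iff hn.ne', mul_comm]; exact h
  rw [wnorm, h2, Real.sqrt_div (by positivity), Real.sqrt_sq (norm_nonneg _)]

end Regular

end GLM

end

noncomputable section

/-! ### The model in whitened coordinates. -/

namespace GLM

variable {n d k : ℕ} (M : GLM n d k)

local notation "Param" => EuclideanSpace ℝ (Fin d)
local notation "Label" => EuclideanSpace ℝ (Fin k)

/-- The affine coordinates in which `n F*` becomes the identity and the truth the origin. -/
def reparam (z : EuclideanSpace ℝ (Fin d)) : EuclideanSpace ℝ (Fin d) :=
  M.truth + whiten ((n : ℝ) • M.fisher) z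

/-- The linear part of the predictor in whitened coordinates. -/
def wpred (i : Fin n) : EuclideanSpace ℝ (Fin d) →L[ℝ] EuclideanSpace ℝ (Fin k) :=
  (M.predL i).comp (whiten ((n : ℝ) • M.fisher))

lemma pred_reparam (i : Fin n) (z : Param) :
    M.pred i (M.reparam z) = M.pred i M.truth + M.wpred i z :=
  M.pred_add i _ _

/-- The sum of the log-partition functions in whitened coordinates. -/
def logPartition (z : EuclideanSpace ℝ (Fin d)) : ℝ :=
  ∑ i, ExpFam.psi M.base (M.pred i M.truth + M.wpred i z)

/-- The linear functional `∑ᵢ ⟨Y_i, X_iᵀ ·⟩` in whitened coordinates. -/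
def labelFunctional (Y : Fin n → EuclideanSpace ℝ (Fin k)) :
    EuclideanSpace ℝ (Fin d) →L[ℝ] ℝ :=
  ∑ i, (innerSL ℝ (Y i)).comp (M.wpred i)

/-- The unnormalized negative log likelihood in whitened coordinates, up to a constant. -/
def whitenedNLL (Y : Fin n → EuclideanSpace ℝ (Fin k)) (z : EuclideanSpace ℝ (Fin d)) : ℝ :=
  M.logPartition z - M.labelFunctional Y z - ∑ i, inner ℝ (M.pred i M.truth) (Y i)

/-- The derivative of `whitenedNLL` at the truth. -/
def score (Y : Fin n → EuclideanSpace ℝ (Fin k)) : EuclideanSpace ℝ (Fin d) →L[ℝ] ℝ :=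
  fderiv ℝ M.logPartition 0 - M.labelFunctional Y

lemma labelFunctional_apply (Y : Fin n → Label) (z : Param) :
    M.labelFunctional Y z = ∑ i, inner ℝ (Y i) (M.wpred i z) := by
  simp [labelFunctional]

lemma nll_mul (hn : 0 < n) (Y : Fin n → Label) (θ : Param) :
    (n : ℝ) * M.nll Y θ =
      ∑ i, (ExpFam.psi M.base (M.pred i θ) - inner ℝ (M.pred i θ) (Y i)) := by
  have hn' : (n : ℝ) ≠ 0 := by exact_mod_cast hn.ne'
  simp only [nll, ExpFam.density]
  rw [Real.log_prod fun i _ => (Real.exp_pos _).ne']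
  simp only [Real.log_exp, Finset.sum_sub_distrib]
  field_simp
  ring

lemma nll_reparam (hn : 0 < n) (Y : Fin n → Label) (z : Param) :
    (n : ℝ) * M.nll Y (M.reparam z) = M.whitenedNLL Y z := by
  rw [M.nll_mul hn, whitenedNLL, labelFunctional_apply, logPartition, ← Finset.sum_sub_distrib,
    ← Finset.sum_sub_distrib]
  refine Finset.sum_congr rfl fun i _ => ?_
  rw [pred_reparam, inner_add_left, real_inner_comm (Y i) (M.wpred i z)]
  ring

namespace Regular

variable {M} (hM : M.Regular)
include hM

lemma reparam_mem_nbhd {s : ℝ} {z : Param} (hz : z ∈ Metric.closedBall (0 : Param) (s * √d)) :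
    M.reparam z ∈ M.nbhd s := by
  have hn : (0 : ℝ) < n := by exact_mod_cast hM.n_pos
  have hn' : 0 < √(n : ℝ) := Real.sqrt_pos.2 hn
  rw [mem_closedBall_zero_iff] at hz
  simp only [nbhd, Set.mem_ofPred_eq, reparam, add_sub_cancel_left, hM.wnorm_whiten]
  rw [Real.sqrt_div (Nat.cast_nonneg d), ← mul_div_assoc]
  gcongr

lemma contDiffOn_summand (m : ℕ) (i : Fin n) :
    ContDiffOn ℝ m (fun z => ExpFam.psi M.base (M.pred i M.truth + M.wpred i z))
      (M.reparam ⁻¹' M.Theta) := by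
  refine (ExpFam.contDiffOn_psi hM.base_ne_zero hM.isRegular m).comp
    (contDiff_const.add (M.wpred i).contDiff).contDiffOn fun z hz => ?_
  rw [← pred_reparam]
  exact hz i

lemma isOpen_preimage_Theta : IsOpen (M.reparam ⁻¹' M.Theta) :=
  hM.isOpen_Theta.preimage (by unfold reparam; fun_prop)

lemma contDiffAt_summand (m : ℕ) (i : Fin n) {z : Param} (hz : M.reparam z ∈ M.Theta) :
    ContDiffAt ℝ m (fun z => ExpFam.psi M.base (M.pred i M.truth + M.wpred i z)) z :=
  (hM.contDiffOn_summand m i).contDiffAt (hM.isOpen_preimage_Theta.mem_nhds hz)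

lemma contDiffAt_logPartition (m : ℕ) {z : Param} (hz : M.reparam z ∈ M.Theta) :
    ContDiffAt ℝ m M.logPartition z := by
  unfold logPartition
  exact ContDiffAt.sum fun i _ => hM.contDiffAt_summand m i hz

lemma iteratedFDeriv_logPartition (m : ℕ) {z : Param} (hz : M.reparam z ∈ M.Theta) (u : Param) :
    iteratedFDeriv ℝ m M.logPartition z (fun _ => u) =
      ∑ i, iteratedFDeriv ℝ m (ExpFam.psi M.base) (M.pred i (M.reparam z))
        fun _ => M.wpred i u := by
  unfold logPartition
  rw [iteratedFDeriv_fun_sum_apply fun i _ => hM.contDiffAt_summand m i hz,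
    sum_apply]
  refine Finset.sum_congr rfl fun i _ => ?_
  rw [iteratedFDeriv_comp_affine hM.isRegular
    (ExpFam.contDiffOn_psi hM.base_ne_zero hM.isRegular m), pred_reparam]
  rw [← pred_reparam]
  exact hz i

lemma reparam_zero_mem : M.reparam 0 ∈ M.Theta := by
  simpa [reparam] using hM.truth_mem

lemma iteratedFDeriv_two_logPartition (u : Param) :
    iteratedFDeriv ℝ 2 M.logPartition 0 (fun _ => u) = ‖u‖ ^ 2 := by
  have hn : (n : ℝ) ≠ 0 := by exact_mod_cast hM.n_pos.ne'
  rw [hM.iteratedFDeriv_logPartition 2 hM.reparam_zero_mem,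
    ← dotProduct_whiten hM.posDef_smul_fisher u, Matrix.smul_mulVec, dotProduct_smul, smul_eq_mul,
    dotProduct_fisher_mulVec_self, ← mul_assoc, mul_inv_cancel₀ hn, one_mul]
  simp [reparam, wpred]

omit hM in
lemma rpow_three_half_eq (x : ℝ) (hx : 0 ≤ x) : x ^ (3 / 2 : ℝ) = √x ^ 3 := by
  rw [Real.sqrt_eq_rpow, ← Real.rpow_natCast, ← Real.rpow_mul hx]
  norm_num

lemma third_derivative_le {s : ℝ} (hfin : M.delta3 s ≠ ∞) {θ : Param} (hθ : θ ∈ M.nbhd s)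
    (u : Param) :
    (n : ℝ)⁻¹ * ∑ i, iteratedFDeriv ℝ 3 (ExpFam.psi M.base) (M.pred i θ) (fun _ => M.pred i u) ≤
      (M.delta3 s).toReal * wnorm M.fisher u ^ 3 := by
  rcases eq_or_ne u 0 with rfl | hu
  · have : ∀ i, (fun _ : Fin 3 => M.pred i (0 : Param)) = 0 := fun i => by
      funext j; exact map_zero (M.predL i)
    simp only [this, ContinuousMultilinearMap.map_zero, Finset.sum_const_zero, mul_zero]
    exact mul_nonneg ENNReal.toReal_nonneg (pow_nonneg (Real.sqrt_nonneg _) 3)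
  have hpos := hM.dotProduct_fisher_pos hu
  have hle : ENNReal.ofReal
      (((n : ℝ)⁻¹ * ∑ i, iteratedFDeriv ℝ 3 (ExpFam.psi M.base) (M.pred i θ)
        (fun _ => M.pred i u)) / ((n : ℝ)⁻¹ * ∑ i, iteratedFDeriv ℝ 2 (ExpFam.psi M.base)
        (M.pred i M.truth) (fun _ => M.pred i u)) ^ (3 / 2 : ℝ)) ≤ M.delta3 s := by
    unfold delta3
    exact le_iSup₂_of_le θ hθ (le_iSup₂_of_le u hu le_rfl)
  rw [← dotProduct_fisher_mulVec_self, rpow_three_half_eq _ hpos.le] at hle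
  have h2 := (ENNReal.ofReal_le_iff_le_toReal hfin).1 hle
  rwa [div_le_iff₀ (by have := Real.sqrt_pos.2 hpos; positivity)] at h2

/-- The sum carries a factor n, and each direction a factor 1/√n by `wnorm_whiten`: n·n^{-3/2} =
n^{-1/2}. -/
lemma iteratedFDeriv_three_logPartition_le {s : ℝ} (hfin : M.delta3 s ≠ ∞)
    (hsub : M.nbhd s ⊆ M.Theta) {z : Param} (hz : z ∈ Metric.closedBall (0 : Param) (s * √d))
    (u : Param) : iteratedFDeriv ℝ 3 M.logPartition z (fun _ => u) ≤
      (M.delta3 s).toReal / √n * ‖u‖ ^ 3 := by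
  have hn : (0 : ℝ) < n := by exact_mod_cast hM.n_pos
  have hn' : 0 < √(n : ℝ) := Real.sqrt_pos.2 hn
  have hmem := hM.reparam_mem_nbhd hz
  have h := hM.third_derivative_le hfin hmem (whiten ((n : ℝ) • M.fisher) u)
  rw [hM.wnorm_whiten, inv_mul_le_iff₀ hn] at h
  rw [hM.iteratedFDeriv_logPartition 3 (hsub hmem)]
  refine h.trans (le_of_eq ?_)
  nth_rewrite 1 [← Real.mul_self_sqrt hn.le]
  field_simp

lemma nearlyQuadratic_logPartition {s : ℝ} (hs : 0 ≤ s) (hfin : M.delta3 s ≠ ∞)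
    (hsub : M.nbhd s ⊆ M.Theta) :
    NearlyQuadratic M.logPartition (fderiv ℝ M.logPartition) (s * √d)
      (5 * ((M.delta3 s).toReal / √n) * (s * √d)) :=
  nearlyQuadratic_of_third_derivative_le (by positivity) (by positivity)
    (fun z hz => hM.contDiffAt_logPartition 3 (hsub (hM.reparam_mem_nbhd hz)))
    hM.iteratedFDeriv_two_logPartition
    fun z hz u => hM.iteratedFDeriv_three_logPartition_le hfin hsub hz u

/-- The labels enter linearly and cancel in differences of gradients, so the constant is
deterministic. -/
lemma nearlyQuadratic_whitenedNLL {s : ℝ} (hs : 0 ≤ s) (hfin : M.delta3 s ≠ ∞)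
    (hsub : M.nbhd s ⊆ M.Theta) (Y : Fin n → Label) :
    NearlyQuadratic (M.whitenedNLL Y) (fun z => fderiv ℝ M.logPartition z - M.labelFunctional Y)
      (s * √d) (5 * ((M.delta3 s).toReal / √n) * (s * √d)) := by
  have h := hM.nearlyQuadratic_logPartition hs hfin hsub
  refine ⟨fun z hz => ?_, fun z hz y hy => ?_⟩
  · exact ((h.hasFDerivAt z hz).sub (M.labelFunctional Y).hasFDerivAt).sub_const _
  · rw [sub_sub_sub_cancel_right]
    exact h.norm_sub_le z hz y hy

omit hM in
lemma _root_.GLM.convex_preimage_Theta : Convex ℝ (M.reparam ⁻¹' M.Theta) := by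
  have : M.reparam ⁻¹' M.Theta =
      (whiten ((n : ℝ) • M.fisher)).toLinearMap ⁻¹' ((fun z => M.truth + z) ⁻¹' M.Theta) := rfl
  rw [this]
  exact (convex_Theta.translate_preimage_right M.truth).linear_preimage _

lemma convexOn_whitenedNLL (Y : Fin n → Label) :
    ConvexOn ℝ (M.reparam ⁻¹' M.Theta) (M.whitenedNLL Y) := by
  refine ⟨convex_preimage_Theta, fun x hx y hy a b ha hb hab => ?_⟩
  have hlog : M.logPartition (a • x + b • y) ≤ a * M.logPartition x + b * M.logPartition y := by
    unfold logPartition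
    rw [Finset.mul_sum, Finset.mul_sum, ← Finset.sum_add_distrib]
    refine Finset.sum_le_sum fun i _ => ?_
    have h := (ExpFam.convexOn_psi hM.base_ne_zero hM.isRegular).2 (hx i) (hy i) ha hb hab
    rw [pred_reparam, pred_reparam] at h
    simp only [smul_eq_mul] at h
    convert! h using 2
    rw [map_add, map_smul, map_smul]
    nth_rewrite 1 [← one_smul ℝ (M.pred i M.truth)]
    rw [← hab]
    module
  simp only [whitenedNLL, map_add, map_smul, smul_eq_mul]
  have : ∀ c : ℝ, c = a * c + b * c := fun c => by rw [← add_mul, hab, one_mul]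
  have := this (∑ i, inner ℝ (M.pred i M.truth) (Y i))
  linarith

/-- The prior is log-Lipschitz on the neighbourhood, in whitened coordinates. -/
lemma abs_log_prior_sub_le {s : ℝ} (hfin : M.delta01 s ≠ ∞)
    {x z : Param} (hx : x ∈ Metric.closedBall (0 : Param) (s * √d))
    (hz : z ∈ Metric.closedBall (0 : Param) (s * √d)) :
    |Real.log (M.prior (M.reparam z)) - Real.log (M.prior (M.reparam x))| ≤
      (M.delta01 s).toReal / √n * ‖z - x‖ := by
  have hn : (0 : ℝ) < n := by exact_mod_cast hM.n_pos
  have hn' : 0 < √(n : ℝ) := Real.sqrt_pos.2 hn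
  have hsmooth : ∀ θ ∈ M.nbhd s, ContDiffAt ℝ 1 M.prior θ ∧ 0 < M.prior θ := by
    by_contra h
    exact hfin (if_neg h)
  have hdelta : M.delta01 s =
      ⨆ θ ∈ M.nbhd s, dualNorm M.fisher (gradient (fun t => Real.log (M.prior t)) θ) :=
    if_pos hsmooth
  have hgrad : ∀ θ ∈ M.nbhd s, ∀ u : Param,
      inner ℝ (gradient (fun t => Real.log (M.prior t)) θ) u ≤
        (M.delta01 s).toReal * wnorm M.fisher u := by
    intro θ hθ u
    set g := gradient (fun t => Real.log (M.prior t)) θ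
    rcases eq_or_ne u 0 with rfl | hu
    · simp [wnorm]
    have hw : 0 < wnorm M.fisher u := Real.sqrt_pos.2 (hM.dotProduct_fisher_pos hu)
    -- The supremum in `dualNorm` is over unit vectors only; homogeneity recovers the bound for all
    -- u.
    have hunit : wnorm M.fisher ((wnorm M.fisher u)⁻¹ • u) = 1 := by
      have hsq : wnorm M.fisher u ^ 2 = u.ofLp ⬝ᵥ M.fisher *ᵥ u.ofLp :=
        Real.sq_sqrt (hM.dotProduct_fisher_pos hu).le
      conv_lhs => rw [wnorm]
      rw [WithLp.ofLp_smul, Matrix.mulVec_smul, smul_dotProduct, dotProduct_smul, ← hsq]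
      simp only [smul_eq_mul]
      rw [show (wnorm M.fisher u)⁻¹ * ((wnorm M.fisher u)⁻¹ * wnorm M.fisher u ^ 2) = 1 by
        field_simp, Real.sqrt_one]
    have hle : ENNReal.ofReal (inner ℝ g ((wnorm M.fisher u)⁻¹ • u)) ≤ M.delta01 s := by
      rw [hdelta]
      refine le_iSup₂_of_le θ hθ ?_
      unfold dualNorm
      exact le_iSup₂_of_le _ hunit le_rfl
    have h2 := (ENNReal.ofReal_le_iff_le_toReal hfin).1 hle
    rw [real_inner_smul_right, inv_mul_le_iff₀ hw] at h2
    linarith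
  set B := whiten ((n : ℝ) • M.fisher)
  have hderiv : ∀ y ∈ Metric.closedBall (0 : Param) (s * √d),
      HasFDerivAt (fun y => Real.log (M.prior (M.reparam y)))
        ((fderiv ℝ (fun t => Real.log (M.prior t)) (M.reparam y)).comp B) y := by
    intro y hy
    obtain ⟨h1, h2⟩ := hsmooth _ (hM.reparam_mem_nbhd hy)
    have hd : DifferentiableAt ℝ (fun t => Real.log (M.prior t)) (M.reparam y) :=
      (h1.differentiableAt (by simp)).log h2.ne'
    exact hd.hasFDerivAt.comp y (B.hasFDerivAt.const_add M.truth)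
  have hbound : ∀ y ∈ Metric.closedBall (0 : Param) (s * √d),
      ‖(fderiv ℝ (fun t => Real.log (M.prior t)) (M.reparam y)).comp B‖ ≤
        (M.delta01 s).toReal / √n := by
    intro y hy
    have hle : ∀ u, fderiv ℝ (fun t => Real.log (M.prior t)) (M.reparam y) (B u) ≤
        (M.delta01 s).toReal / √n * ‖u‖ := fun u => by
      have h := hgrad _ (hM.reparam_mem_nbhd hy) (B u)
      rw [hM.wnorm_whiten, gradient, InnerProductSpace.toDual_symm_apply] at h
      refine h.trans (le_of_eq ?_)
      ring
    refine ContinuousLinearMap.opNorm_le_bound _ (by positivity) fun u => ?_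
    rw [Real.norm_eq_abs, abs_le]
    have h1 := hle u
    have h2 := hle (-u)
    rw [map_neg, map_neg, norm_neg] at h2
    simp only [ContinuousLinearMap.comp_apply]
    constructor <;> linarith
  have := (convex_closedBall (0 : Param) (s * √d)).norm_image_sub_le_of_norm_hasFDerivWithin_le
    (fun y hy => (hderiv y hy).hasFDerivWithinAt) hbound hx hz
  rwa [Real.norm_eq_abs] at this

end Regular

end GLM

end

noncomputable section

/-! ### Transport back to the original parameter, and concentration of the score. -/

namespace GLM

variable {n d k : ℕ} {M : GLM n d k}

local notation "Param" => EuclideanSpace ℝ (Fin d)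
local notation "Label" => EuclideanSpace ℝ (Fin k)

namespace Regular

variable (hM : M.Regular)
include hM

/-- `reparam` as a homeomorphism. -/
def reparamHomeomorph : EuclideanSpace ℝ (Fin d) ≃ₜ EuclideanSpace ℝ (Fin d) where
  toFun := M.reparam
  invFun θ := unwhiten ((n : ℝ) • M.fisher) (θ - M.truth)
  left_inv z := by simp [reparam, unwhiten_whiten hM.posDef_smul_fisher]
  right_inv θ := by simp [reparam, whiten_unwhiten hM.posDef_smul_fisher]
  continuous_toFun := by unfold reparam; fun_prop
  continuous_invFun := by fun_prop

lemma measurableEmbedding_reparam : MeasurableEmbedding M.reparam :=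
  hM.reparamHomeomorph.measurableEmbedding

lemma reparam_surjective : Function.Surjective M.reparam := hM.reparamHomeomorph.surjective

lemma exists_map_volume_reparam :
    ∃ c : ℝ≥0∞, c ≠ 0 ∧ c ≠ ∞ ∧
      (volume : Measure (EuclideanSpace ℝ (Fin d))).map M.reparam = c • volume := by
  set B := whiten ((n : ℝ) • M.fisher) with hB
  have hdet : LinearMap.det B.toLinearMap ≠ 0 := by
    have h : B.toLinearMap * (unwhiten ((n : ℝ) • M.fisher)).toLinearMap = 1 := by
      ext1 z
      exact whiten_unwhiten hM.posDef_smul_fisher z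
    intro h0
    have := congrArg LinearMap.det h
    rw [map_mul, h0, zero_mul, map_one] at this
    exact zero_ne_one this
  refine ⟨ENNReal.ofReal |(LinearMap.det B.toLinearMap)⁻¹|, ?_, ENNReal.ofReal_ne_top, ?_⟩
  · rw [ne_eq, ENNReal.ofReal_eq_zero, not_le]
    exact abs_pos.2 (inv_ne_zero hdet)
  · have h1 : M.reparam = (M.truth + ·) ∘ B := rfl
    rw [h1, ← Measure.map_map (by fun_prop) (by fun_prop)]
    have h2 := Measure.map_linearMap_addHaar_eq_smul_addHaar (volume : Measure Param) hdet
    have h3 : (volume : Measure Param).map B = (volume : Measure Param).map B.toLinearMap := rfl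
    rw [h3, h2, Measure.map_smul, map_add_left_eq_self]

/-- The unnormalized posterior is a multiple of the image of the Gibbs measure of the whitened
likelihood. -/
lemma exists_unnormPosterior_eq (Y : Fin n → Label) :
    ∃ c : ℝ≥0∞, c ≠ 0 ∧ c ≠ ∞ ∧ ∀ A, MeasurableSet A → c * M.unnormPosterior Y A =
      gibbsMeasure (M.reparam ⁻¹' M.Theta) (M.whitenedNLL Y) (fun z => M.prior (M.reparam z))
        (M.reparam ⁻¹' A) := by
  obtain ⟨c, hc0, hc, hmap⟩ := hM.exists_map_volume_reparam
  have hemb := hM.measurableEmbedding_reparam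
  refine ⟨c, hc0, hc, fun A hA => ?_⟩
  rw [gibbsMeasure_apply (hemb.measurable hA), unnormPosterior, withDensity_apply _ hA,
    Measure.restrict_restrict hA, ← Set.preimage_inter]
  set f : Param → ℝ≥0∞ := fun θ =>
    ENNReal.ofReal (Real.exp (-(n : ℝ) * M.nll Y θ) * M.prior θ)
  have h : ∀ z, ENNReal.ofReal (Real.exp (-M.whitenedNLL Y z) * M.prior (M.reparam z)) =
      f (M.reparam z) := by
    intro z
    simp only [f]
    rw [neg_mul, M.nll_reparam hM.n_pos]
  have e : ∫⁻ z in M.reparam ⁻¹' (A ∩ M.Theta), f (M.reparam z) =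
      ∫⁻ θ in A ∩ M.Theta, f θ ∂((volume : Measure Param).map M.reparam) := by
    rw [hemb.restrict_map, hemb.lintegral_map]
  rw [lintegral_congr h, e, hmap, Measure.restrict_smul, lintegral_smul_measure, smul_eq_mul]

-- The Gaussian N(θhat, (nF*)⁻¹) is by construction the image of the standard one under the same
-- square root that defines `whiten`.
omit hM in
lemma bvmGaussian_apply_reparam (y : Param) {A : Set Param} (hA : MeasurableSet A) :
    M.bvmGaussian (M.reparam y) A = (stdGaussian Param).map (y + ·) (M.reparam ⁻¹' A) := by
  have hmeas : Measurable M.reparam := by unfold reparam; fun_prop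
  rw [Measure.map_apply (by fun_prop) (hmeas hA), bvmGaussian, multivariateGaussian,
    Measure.map_apply (by fun_prop) hA]
  congr 1
  ext x
  simp only [Set.mem_preimage, reparam, map_add, ← add_assoc]
  rfl

/-- Transport of an approximation in whitened coordinates to the posterior. -/
lemma mem_bvmEvent_of_gibbsMeasure {Y : Fin n → Label} {ε : ℝ} {y : Param}
    (hy : y ∈ M.reparam ⁻¹' M.Theta)
    (hmin : ∀ z ∈ M.reparam ⁻¹' M.Theta, z ≠ y → M.whitenedNLL Y y < M.whitenedNLL Y z)
    (h0 : gibbsMeasure (M.reparam ⁻¹' M.Theta) (M.whitenedNLL Y)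
      (fun z => M.prior (M.reparam z)) Set.univ ≠ 0)
    (hfin : gibbsMeasure (M.reparam ⁻¹' M.Theta) (M.whitenedNLL Y)
      (fun z => M.prior (M.reparam z)) Set.univ ≠ ∞)
    (hTV : ∀ A, MeasurableSet A →
      |(gibbsMeasure (M.reparam ⁻¹' M.Theta) (M.whitenedNLL Y)
          (fun z => M.prior (M.reparam z))).real A /
        (gibbsMeasure (M.reparam ⁻¹' M.Theta) (M.whitenedNLL Y)
          (fun z => M.prior (M.reparam z))).real Set.univ -
        ((stdGaussian Param).map (y + ·)).real A| ≤ ε) :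
    Y ∈ M.bvmEvent ε := by
  set P := gibbsMeasure (M.reparam ⁻¹' M.Theta) (M.whitenedNLL Y)
    (fun z => M.prior (M.reparam z))
  have hn : (0 : ℝ) < n := by exact_mod_cast hM.n_pos
  have hmeas : Measurable M.reparam := hM.measurableEmbedding_reparam.measurable
  obtain ⟨c, hc0, hc, hP⟩ := hM.exists_unnormPosterior_eq Y
  have huniv := hP Set.univ MeasurableSet.univ
  rw [Set.preimage_univ] at huniv
  change _ = P Set.univ at huniv
  have hU0 : M.unnormPosterior Y Set.univ ≠ 0 := fun h => h0 (by rw [← huniv, h, mul_zero])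
  have hUfin : M.unnormPosterior Y Set.univ ≠ ∞ := fun h =>
    hfin (by rw [← huniv, h, ENNReal.mul_top hc0])
  refine ⟨M.reparam y, ⟨hy, fun θ hθ hne => ?_⟩, ⟨?_⟩, ?_⟩
  · obtain ⟨z, rfl⟩ := hM.reparam_surjective θ
    have h := hmin z hθ fun h => hne (by rw [h])
    rw [← M.nll_reparam hM.n_pos, ← M.nll_reparam hM.n_pos] at h
    exact lt_of_mul_lt_mul_left h hn.le
  · rw [posterior, Measure.smul_apply, smul_eq_mul, ENNReal.inv_mul_cancel hU0 hUfin]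
  · refine ciSup_le fun ⟨A, hA⟩ => ?_
    have h1 : (M.bvmGaussian (M.reparam y)).real A =
        ((stdGaussian Param).map (y + ·)).real (M.reparam ⁻¹' A) := by
      rw [measureReal_def, measureReal_def, bvmGaussian_apply_reparam y hA]
    have h2 : (M.posterior Y).real A = P.real (M.reparam ⁻¹' A) / P.real Set.univ := by
      have hPA := hP A hA
      change _ = P _ at hPA
      have hc' : c.toReal ≠ 0 := ENNReal.toReal_ne_zero.2 ⟨hc0, hc⟩
      rw [measureReal_def, measureReal_def, measureReal_def, ← hPA, ← huniv, posterior,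
        Measure.smul_apply, smul_eq_mul, ENNReal.toReal_mul, ENNReal.toReal_mul,
        ENNReal.toReal_mul, ENNReal.toReal_inv, mul_div_mul_left _ _ hc', inv_mul_eq_div]
    rw [h1, h2]
    exact hTV _ (hmeas hA)

/-- The non-asymptotic Bernstein–von Mises theorem on the event that the score is not large. -/
theorem mem_bvmEvent {Y : Fin n → Label} {s r C e ρ : ℝ} (hscore : ‖M.score Y‖ ≤ r * √d)
    (hs : 8 ≤ s) (hrs : 8 * r ≤ s) (hsub : M.nbhd s ⊆ M.Theta)
    (h3 : M.delta3 s ≠ ∞) (h01 : M.delta01 s ≠ ∞)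
    (hprior : ∀ θ ∈ M.Theta, M.prior θ ≤ Real.exp (C * d) * M.prior M.truth)
    (he : 0 < e) (he' : e ≤ 1 / 4) (hexp : C + r + 2 - Real.log e ≤ s ^ 2 / 8)
    (hse : 1 / (s - 3 * r) ^ 2 ≤ e) (hρ : 0 < ρ) (hρ' : ρ ≤ 1 / 16)
    (h3ρ : 40 * s ^ 2 * ((M.delta3 s).toReal * (d / √n)) ≤ ρ)
    (h01ρ : 4 * ((M.delta01 s).toReal / √n) ≤ ρ) :
    Y ∈ M.bvmEvent (18 * ρ + 8 * e) := by
  have hd1 : (1 : ℝ) ≤ d := by exact_mod_cast hM.d_pos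
  have hfr : Module.finrank ℝ Param = d := by simp
  obtain ⟨y, hy, hmin, h0, hfin, hTV⟩ := exists_gaussian_approximation
    (G := M.whitenedNLL Y) (p := fun z => M.prior (M.reparam z)) (Λ := M.reparam ⁻¹' M.Theta)
    (hM.nearlyQuadratic_whitenedNLL (by linarith) h3 hsub Y) (r := r) (C := C)
    (η := (M.delta01 s).toReal / √n) (by positivity) (Real.one_le_sqrt.2 hd1)
    (by rw [hfr, Real.sq_sqrt (by positivity)]) hs hrs hscore (hM.convexOn_whitenedNLL Y)
    hM.isOpen_preimage_Theta.measurableSet (fun z hz => hsub (hM.reparam_mem_nbhd hz))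
    (fun z hz => hM.prior_pos _ hz) (fun z hz => by
      rw [hfr]; simpa [reparam] using hprior _ hz)
    (fun x hx z hz => hM.abs_log_prior_sub_le h01 hx hz) (by positivity) he he' hexp hse hρ hρ'
    -- Here τ = 5·(δ₃/√n)·s√d and the radius is s√d, so 8·τ·s√d = 40·s²·δ₃·d/√n: this is where the
    -- rate d/√n arises.
    (by
      refine le_trans (le_of_eq ?_) h3ρ
      have : √(d : ℝ) * √d = d := Real.mul_self_sqrt (by positivity)
      rw [show ∀ a : ℝ, 8 * (5 * a * (s * √d) * (s * √d)) = 40 * s ^ 2 * (a * (√d * √d)) from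
        fun a => by ring, this]
      ring) h01ρ
  exact hM.mem_bvmEvent_of_gibbsMeasure hy hmin h0 hfin hTV

lemma isProbabilityMeasure_labelLaw (i : Fin n) :
    IsProbabilityMeasure (ExpFam.labelLaw M.base (M.pred i M.truth)) :=
  ExpFam.isProbabilityMeasure_labelLaw hM.base_ne_zero (hM.truth_mem i)

omit hM in
lemma law_eq : M.law M.truth =
    Measure.pi fun i => ExpFam.labelLaw M.base (M.pred i M.truth) := rfl

lemma isProbabilityMeasure_law : IsProbabilityMeasure (M.law M.truth) := by
  have := hM.isProbabilityMeasure_labelLaw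
  rw [law_eq]
  infer_instance

lemma fderiv_logPartition_zero (u : Param) : fderiv ℝ M.logPartition 0 u =
    ∑ i, fderiv ℝ (ExpFam.psi M.base) (M.pred i M.truth) (M.wpred i u) := by
  have h : ∀ i, HasFDerivAt (fun z => ExpFam.psi M.base (M.pred i M.truth + M.wpred i z))
      ((fderiv ℝ (ExpFam.psi M.base) (M.pred i M.truth)).comp (M.wpred i)) 0 := fun i => by
    have h1 : HasFDerivAt (ExpFam.psi M.base)
        (fderiv ℝ (ExpFam.psi M.base) (M.pred i M.truth)) (M.pred i M.truth + M.wpred i 0) := by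
      rw [map_zero, add_zero]
      exact ((ExpFam.contDiffAt_psi hM.base_ne_zero hM.isRegular 1
        (hM.truth_mem i)).differentiableAt (by simp)).hasFDerivAt
    exact h1.comp 0 ((M.wpred i).hasFDerivAt.const_add (M.pred i M.truth))
  have h2 : HasFDerivAt M.logPartition
      (∑ i, (fderiv ℝ (ExpFam.psi M.base) (M.pred i M.truth)).comp (M.wpred i)) 0 := by
    unfold logPartition
    exact HasFDerivAt.fun_sum fun i _ => h i
  rw [h2.fderiv]
  simp

omit hM in
lemma continuous_score : Continuous M.score := by
  unfold score labelFunctional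
  fun_prop

omit hM in
lemma score_apply (Y : Fin n → Label) (u : Param) :
    M.score Y u = fderiv ℝ M.logPartition 0 u - ∑ i, inner ℝ (M.wpred i u) (Y i) := by
  rw [score, sub_apply, labelFunctional_apply]
  simp_rw [real_inner_comm]

/-- In whitened coordinates every directional score has second moment equal to the squared
length of the direction. -/
lemma integral_score_sq (u : Param) :
    Integrable (fun Y => M.score Y u ^ 2) (M.law M.truth) ∧
      ∫ Y, M.score Y u ^ 2 ∂(M.law M.truth) = ‖u‖ ^ 2 := by
  have := hM.isProbabilityMeasure_labelLaw
  have hprob := hM.isProbabilityMeasure_law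
  set X : Fin n → Label → ℝ := fun i y => inner ℝ (M.wpred i u) y
  have hX : ∀ i, MemLp (X i) 2 (ExpFam.labelLaw M.base (M.pred i M.truth)) := fun i =>
    ExpFam.memLp_inner_labelLaw hM.isRegular (hM.truth_mem i) _
  have hXe : ∀ i, MemLp (fun Y : Fin n → Label => X i (Y i)) 2 (M.law M.truth) := fun i => by
    rw [law_eq]
    exact (hX i).comp_measurePreserving
      (measurePreserving_eval (fun i => ExpFam.labelLaw M.base (M.pred i M.truth)) i)
  set S : (Fin n → Label) → ℝ := ∑ i, fun Y => X i (Y i) with hS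
  have hSmem : MemLp S 2 (M.law M.truth) := memLp_finsetSum' _ fun i _ => hXe i
  have hmean : ∫ Y, S Y ∂(M.law M.truth) = fderiv ℝ M.logPartition 0 u := by
    rw [hM.fderiv_logPartition_zero]
    simp only [hS, Finset.sum_apply]
    rw [integral_finsetSum _ fun i _ => (hXe i).integrable (by norm_num)]
    refine Finset.sum_congr rfl fun i _ => ?_
    rw [law_eq, integral_comp_eval (hX i).aestronglyMeasurable]
    exact ExpFam.integral_inner_labelLaw hM.base_ne_zero hM.isRegular (hM.truth_mem i) _
  have hvar : Var[S; M.law M.truth] = ‖u‖ ^ 2 := by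
    rw [hS, law_eq, variance_sum_pi hX, ← hM.iteratedFDeriv_two_logPartition,
      hM.iteratedFDeriv_logPartition 2 hM.reparam_zero_mem]
    refine Finset.sum_congr rfl fun i _ => ?_
    rw [ExpFam.variance_inner_labelLaw hM.base_ne_zero hM.isRegular (hM.truth_mem i),
      pred_reparam, map_zero, add_zero]
  have hsc : ∀ Y, M.score Y u ^ 2 = (S Y - ∫ Y, S Y ∂(M.law M.truth)) ^ 2 := fun Y => by
    rw [hmean, score_apply, hS, Finset.sum_apply]
    ring
  simp_rw [hsc]
  refine ⟨(hSmem.sub (memLp_const _)).integrable_sq, ?_⟩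
  rw [← hvar, variance_eq_integral hSmem.aemeasurable]

/-- Each direction of an orthonormal basis contributes 1: the second moment is the trace of the
identity. -/
lemma integral_norm_score_sq :
    Integrable (fun Y => ‖M.score Y‖ ^ 2) (M.law M.truth) ∧
      ∫ Y, ‖M.score Y‖ ^ 2 ∂(M.law M.truth) = d := by
  let b := stdOrthonormalBasis ℝ Param
  have h : ∀ Y, ‖M.score Y‖ ^ 2 = ∑ j, M.score Y (b j) ^ 2 := fun Y => by
    rw [b.norm_dual]
  simp_rw [h]
  refine ⟨integrable_finsetSum _ fun j _ => (hM.integral_score_sq (b j)).1, ?_⟩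
  rw [integral_finsetSum _ fun j _ => (hM.integral_score_sq (b j)).1]
  simp_rw [(hM.integral_score_sq _).2]
  simp

/-- Chebyshev's bound for the score. -/
lemma law_score_ge {r : ℝ} (hr : 0 < r) :
    1 - ENNReal.ofReal (1 / r ^ 2) ≤ M.law M.truth {Y | ‖M.score Y‖ ≤ r * √d} := by
  have hprob := hM.isProbabilityMeasure_law
  have hd : (0 : ℝ) < d := by exact_mod_cast hM.d_pos
  have hmeas : MeasurableSet {Y | ‖M.score Y‖ ≤ r * √d} :=
    (isClosed_le continuous_score.norm continuous_const).measurableSet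
  have hm := mul_meas_ge_le_integral_of_nonneg (μ := M.law M.truth)
    (f := fun Y => ‖M.score Y‖ ^ 2) (ae_of_all _ fun x => by positivity)
    hM.integral_norm_score_sq.1 (r ^ 2 * d)
  rw [hM.integral_norm_score_sq.2] at hm
  have hc : (M.law M.truth).real {Y | ‖M.score Y‖ ≤ r * √d}ᶜ ≤ 1 / r ^ 2 := by
    refine (measureReal_mono (s₂ := {Y | r ^ 2 * d ≤ ‖M.score Y‖ ^ 2}) fun Y hY => ?_).trans ?_
    · simp only [Set.mem_compl_iff, Set.mem_ofPred_eq, not_le] at hY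
      have h1 : r ^ 2 * d = (r * √d) ^ 2 := by
        rw [mul_pow, Real.sq_sqrt hd.le]
      change r ^ 2 * d ≤ ‖M.score Y‖ ^ 2
      rw [h1]
      exact pow_le_pow_left₀ (by positivity) hY.le 2
    · rw [le_div_iff₀ (by positivity)]
      refine le_of_mul_le_mul_right ?_ hd
      linarith
  rw [measureReal_def, ← ENNReal.le_ofReal_iff_toReal_le (measure_ne_top _ _) (by positivity)] at hc
  rw [prob_compl_eq_one_sub hmeas] at hc
  have := tsub_le_tsub_left hc (1 : ℝ≥0∞)
  rwa [ENNReal.sub_sub_cancel ENNReal.one_ne_top prob_le_one] at this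

end Regular

end GLM

end

noncomputable section

lemma ENNReal.toReal_mul_le_of_mul_ofReal_le {a b : ℝ≥0∞} {x c : ℝ} (hx : 0 < x) (hc : 0 ≤ c)
    (hb : b = ENNReal.ofReal x) (h : a * b ≤ ENNReal.ofReal c) : a ≠ ∞ ∧ a.toReal * x ≤ c := by
  subst hb
  refine ⟨?_, ?_⟩
  · rintro rfl
    rw [ENNReal.top_mul (by simpa using hx)] at h
    exact absurd h (by simp)
  · have := ENNReal.toReal_mono ENNReal.ofReal_ne_top h
    rwa [ENNReal.toReal_mul, ENNReal.toReal_ofReal hx.le, ENNReal.toReal_ofReal hc] at this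

/-! ### Measurable events and the passage to the limit. -/

namespace GLM

variable {n d k : ℕ} {M : GLM n d k}

lemma bvmEvent_mono {ε ε' : ℝ} (h : ε ≤ ε') : M.bvmEvent ε ⊆ M.bvmEvent ε' :=
  fun _ ⟨y, hy, hp, hle⟩ => ⟨y, hy, hp, hle.trans h⟩

lemma Regular.prior_le_of_M0_le (hM : M.Regular) {C : ℝ} (hC : M.M0 ≤ (C : EReal))
    {θ : EuclideanSpace ℝ (Fin d)} (hθ : θ ∈ M.Theta) :
    M.prior θ ≤ Real.exp (C * d) * M.prior M.truth := by
  have hd : (0 : ℝ) < d := by exact_mod_cast hM.d_pos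
  have ht := hM.prior_pos _ hM.truth_mem
  have hd' : (d : EReal) = ((d : ℝ) : EReal) := rfl
  rw [M0, hd', EReal.div_le_iff_le_mul (by exact_mod_cast hd) (EReal.coe_ne_top _),
    ← EReal.coe_mul, ← EReal.exp_le_exp_iff, ENNReal.exp_log, EReal.exp_coe] at hC
  have h := (le_iSup₂ (f := fun θ (_ : θ ∈ M.Theta) =>
    ENNReal.ofReal (M.prior θ / M.prior M.truth)) θ hθ).trans hC
  rw [ENNReal.ofReal_le_ofReal_iff (Real.exp_nonneg _), div_le_iff₀ ht] at h
  rwa [mul_comm C]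

lemma measurableSet_norm_score_le (c : ℝ) : MeasurableSet {Y | ‖M.score Y‖ ≤ c} :=
  (isClosed_le Regular.continuous_score.norm continuous_const).measurableSet

/-- The part of the event of the Bernstein–von Mises approximation which is described by bounds
on the score. -/
def scoreEvent (M : GLM n d k) (ε : ℝ) : Set (Fin n → EuclideanSpace ℝ (Fin k)) :=
  ⋃ (r : ℕ) (_ : {Y | ‖M.score Y‖ ≤ r * √d} ⊆ M.bvmEvent ε), {Y | ‖M.score Y‖ ≤ r * √d}

/-- Measurability of `bvmEvent` itself is not established. A countable union of score events
contained in it is measurable, and one such set serves all radii `r` at once. -/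
lemma measurableSet_scoreEvent (ε : ℝ) : MeasurableSet (M.scoreEvent ε) :=
  MeasurableSet.iUnion fun _ => MeasurableSet.iUnion fun _ => measurableSet_norm_score_le _

lemma scoreEvent_subset (ε : ℝ) : M.scoreEvent ε ⊆ M.bvmEvent ε :=
  Set.iUnion₂_subset fun _ h => h

lemma Regular.law_scoreEvent_ge (hM : M.Regular) {ε : ℝ} {r : ℕ} (hr : 0 < r)
    (h : {Y | ‖M.score Y‖ ≤ r * √d} ⊆ M.bvmEvent ε) :
    1 - ENNReal.ofReal (1 / (r : ℝ) ^ 2) ≤ M.law M.truth (M.scoreEvent ε) :=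
  (hM.law_score_ge (by exact_mod_cast hr)).trans (measure_mono
    (Set.subset_iUnion₂ (s := fun (r : ℕ) (_ : {Y | ‖M.score Y‖ ≤ r * √d} ⊆ M.bvmEvent ε) =>
      {Y | ‖M.score Y‖ ≤ r * √d}) r h))

end GLM

end

theorem corollary4p4 (d k : ℕ → ℕ) (M : (n : ℕ) → GLM n (d n) (k n))
    (hd : ∀ n, 0 < n → 0 < d n)
    (hreg : ∀ n, 0 < n → ExpFam.IsRegular (M n).base)
    (hmin : ∀ n, 0 < n → ExpFam.IsMinimal (M n).base)
    (htruth : ∀ n, 0 < n → (M n).truth ∈ (M n).Theta)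
    (hprior_meas : ∀ n, 0 < n → AEMeasurable (M n).prior (volume.restrict (M n).Theta))
    (hprior_pos : ∀ n, 0 < n → ∀ θ ∈ (M n).Theta, 0 < (M n).prior θ)
    (hspan : ∀ n, 0 < n →
      Submodule.span ℝ (Set.range fun p : Fin n × Fin (k n) => ((M n).X p.1).col p.2) = ⊤)
    (hM0 : ∃ C : ℝ, ∀ᶠ n in atTop, (M n).M0 ≤ (C : EReal))
    (hnbhd : ∀ s : ℝ, 0 ≤ s → ∀ᶠ n in atTop, (M n).nbhd s ⊆ (M n).Theta)
    (hdelta01 : ∀ s : ℝ, 0 ≤ s →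
      Tendsto (fun n => (M n).delta01 s / ENNReal.ofReal (√(n : ℝ))) atTop (𝓝 0))
    (hdelta3 : ∀ s : ℝ, 0 ≤ s →
      Tendsto (fun n => (M n).delta3 s * ((d n : ℝ≥0∞) / ENNReal.ofReal (√(n : ℝ))))
        atTop (𝓝 0)) :
    ∀ ε : ℝ, 0 < ε →
      ∃ A : (n : ℕ) → Set (Fin n → EuclideanSpace ℝ (Fin (k n))),
        (∀ n, MeasurableSet (A n)) ∧ (∀ n, A n ⊆ (M n).bvmEvent ε) ∧
        Tendsto (fun n => (M n).law (M n).truth (A n)) atTop (𝓝 1) := by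
  intro ε hε
  refine ⟨fun n => (M n).scoreEvent ε, fun n => GLM.measurableSet_scoreEvent ε,
    fun n => GLM.scoreEvent_subset ε, ?_⟩
  have hregular : ∀ n, 0 < n → (M n).Regular := fun n hn =>
    ⟨hn, hd n hn, hreg n hn, hmin n hn, htruth n hn, hspan n hn, hprior_pos n hn⟩
  obtain ⟨C, hC⟩ := hM0
  -- For fixed `r` the deterministic theorem applies for all large n on the event that the score is
  -- at most r√d.
  have key : ∀ r : ℕ, 0 < r → ∀ᶠ n in atTop,
      1 - ENNReal.ofReal (1 / (r : ℝ) ^ 2) ≤ (M n).law (M n).truth ((M n).scoreEvent ε) := by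
    intro r hr
    set ε' := min ε 1 with hε'
    have hε'0 : 0 < ε' := lt_min hε one_pos
    have hε'1 : ε' ≤ 1 := min_le_right _ _
    -- Chosen so that 18ρ + 8e = ε'/2 + ε'/2 = ε'; capping ε' at 1 ensures e ≤ 1/4 and ρ ≤ 1/16.
    set e := ε' / 16 with he
    set ρ := ε' / 36 with hρ
    have he0 : 0 < e := by positivity
    have hρ0 : 0 < ρ := by positivity
    have t1 : Tendsto (fun s : ℝ => s ^ 2 / 8) atTop atTop :=
      (tendsto_pow_atTop two_ne_zero).atTop_div_const (by norm_num)
    have t2 : Tendsto (fun s : ℝ => 1 / (s - 3 * r) ^ 2) atTop (𝓝 0) := by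
      simp_rw [one_div]
      exact tendsto_inv_atTop_zero.comp ((tendsto_pow_atTop two_ne_zero).comp
        (tendsto_atTop_add_const_right _ (-(3 * (r : ℝ))) tendsto_id))
    -- The radius depends on `C`, `r` and `ε` but not on n, so the hypotheses for fixed s apply.
    obtain ⟨s, hs8, hsr, hs1, hs2⟩ := ((eventually_ge_atTop (8 : ℝ)).and
      ((eventually_ge_atTop (8 * (r : ℝ))).and
        ((t1.eventually_ge_atTop (C + r + 2 - Real.log e)).and
          (t2.eventually_le_const he0)))).exists
    have hs0 : 0 ≤ s := by linarith
    have h3 := (hdelta3 s hs0).eventually_le_const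
      (show 0 < ENNReal.ofReal (ρ / (40 * s ^ 2)) by rw [ENNReal.ofReal_pos]; positivity)
    have h01 := (hdelta01 s hs0).eventually_le_const
      (show 0 < ENNReal.ofReal (ρ / 4) by rw [ENNReal.ofReal_pos]; positivity)
    filter_upwards [h3, h01, hnbhd s hs0, hC, eventually_gt_atTop 0] with n h3 h01 hsub hC hn
    have hM := hregular n hn
    have hnR : (0 : ℝ) < √n := Real.sqrt_pos.2 (by exact_mod_cast hn)
    have hdR : (0 : ℝ) < d n := by exact_mod_cast hM.d_pos
    obtain ⟨h3t, h3b⟩ := ENNReal.toReal_mul_le_of_mul_ofReal_le (x := d n / √n) (by positivity)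
      (by positivity) (by rw [ENNReal.ofReal_div_of_pos hnR, ENNReal.ofReal_natCast]) h3
    obtain ⟨h01t, h01b⟩ := ENNReal.toReal_mul_le_of_mul_ofReal_le (x := (√n)⁻¹) (by positivity)
      (by positivity) (ENNReal.ofReal_inv_of_pos hnR).symm h01
    refine hM.law_scoreEvent_ge hr fun Y hY => ?_
    refine GLM.bvmEvent_mono ?_ (hM.mem_bvmEvent hY hs8 hsr hsub h3t h01t
      (fun θ hθ => hM.prior_le_of_M0_le hC hθ) he0 (by linarith) hs1 hs2 hρ0 (by linarith) ?_ ?_)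
    · have : ε' ≤ ε := min_le_left _ _
      linarith
    · rwa [le_div_iff₀' (by positivity)] at h3b
    · rw [div_eq_mul_inv]
      linarith
  -- The events do not depend on `r`, so letting r grow in `key` pushes the lower bound to 1.
  refine tendsto_order.2 ⟨fun a ha => ?_, fun a ha => ?_⟩
  · have t : Tendsto (fun r : ℕ => 1 - ENNReal.ofReal (1 / (r : ℝ) ^ 2)) atTop (𝓝 1) := by
      have t0 : Tendsto (fun r : ℕ => 1 / (r : ℝ) ^ 2) atTop (𝓝 0) := by
        simp_rw [one_div]
        exact tendsto_inv_atTop_zero.comp ((tendsto_pow_atTop two_ne_zero).comp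
          tendsto_natCast_atTop_atTop)
      simpa using ENNReal.Tendsto.sub (tendsto_const_nhds (x := (1 : ℝ≥0∞)))
        (ENNReal.tendsto_ofReal t0) (Or.inl ENNReal.one_ne_top)
    obtain ⟨r, har, hr⟩ := ((t.eventually_const_lt ha).and (eventually_gt_atTop 0)).exists
    filter_upwards [key r hr] with n hn using har.trans_le hn
  · filter_upwards [eventually_gt_atTop 0] with n hn
    have := (hregular n hn).isProbabilityMeasure_law
    exact prob_le_one.trans_lt ha
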